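/- **Spaces.** For $x,t\in[-\infty,\infty]$ put $\Phi(x,t)=\tanh(x)/(1+|t|)$ (with $\tanh(\pm\infty)=\pm1$ and $\Phi(x,\pm\infty)=0$). A *path* is a pair $(f,t_0)$ with $t_0\in[-\infty,\infty]$ and $f:[t_0,\infty]\to[-\infty,\infty]$ such that $t\mapsto\Phi(f(t),t)$ is continuous; $\hat f$ is the extension of $f$ to $[-\infty,\infty]$ that equals $f(t_0)$ on $[-\infty,t_0)$. Let $\Pi$ be the set of paths with the metric $$d((f_1,t_1),(f_2,t_2))=\sup_t|\Phi(\hat f_1(t),t)-\Phi(\hat f_2(t),t)|\ \vee\ |\tanh t_1-\tanh t_2|$$ (paths at distance $0$ are identified), and let $\mathcal H$ be the set of nonempty compact subsets of $\Pi$ with the Hausdorff metric $d_{\mathcal H}$ and its Borel $\sigma$-field $\mathcal F_{\mathcal H}$. A path $(f,s)$ *touches* $(x,t)\in\mathbb R^2$ if $s\le t$ and $f(t)=x$, and *starts at* $(x,t)$ if $s=t$ and $f(t)=x$. Two paths $(f,s),(g,r)$ *cross* if there are real $u,v\ge\max(s,r)$ with $f(u)<g(u)$ and $g(v)<f(v)$;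 $K\in\mathcal H$ is *noncrossing* if no two of its paths cross. For $K\in\mathcal H$, $t>0$ and $a<b$, $t_0$ real, $\eta(t_0,t;a,b)$ is the number of distinct points of $\mathbb R\times\{t_0+t\}$ touched by paths of $K$ that also touch some point of $[a,b]\times\{t_0\}$, and $\hat\eta=\eta-1$. **Coalescing Brownian motions.** Given $y_j=(x_j,t_j)\in\mathbb R^2$, $1\le j\le m$, and independent standard Brownian motions $B_1,\dots,B_m$, let $W_j(t)=x_j+B_j(t-t_j)$ for $t\ge t_j$. Coalescing Brownian motions starting at $y_1,\dots,y_m$ are (distributed as) the paths $\tilde W_1,\dots,\tilde W_m$ with starting times $t_1,\dots,t_m$, where $\tilde W_j$ equals $W_j$ up to the first time $\tau_j\le\infty$ at which $W_j$ meets some $\tilde W_i$ with $i<j$, and after $\tau_j$ equals $\tilde W_i$ for the least such $i$ met at time $\tau_j$. **Brownian web.** The standard Brownian web is the $\mathcal H$-valued random variable $\bar{\mathcal W}$ whose distribution is the unique one such that (o) from any deterministic $(x,t)\in\mathbb R^2$ there is almost surely a unique path $W_{x,t}\in\bar{\mathcal W}$ starting at $(x,t)$; (i) for any deterministic $y_1,\dots,y_m\in\mathbb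 R^2$, $(W_{y_1},\dots,W_{y_m})$ is distributed as coalescing Brownian motions starting at $y_1,\dots,y_m$; (ii) for any deterministic countable dense $\mathcal D'\subset\mathbb R^2$, almost surely $\bar{\mathcal W}$ is the closure in $(\Pi,d)$ of $\{W_{y}:y\in\mathcal D'\}$. **Theorem 2.2.** Let $\mathcal D$ be a countable dense subset of $\mathbb R^2$ and let $\mathcal X_1,\mathcal X_2,\dots$ be $(\mathcal H,\mathcal F_{\mathcal H})$-valued random variables, with distributions $\mu_1,\mu_2,\dots$, that are almost surely noncrossing. Suppose that - $(I_1)$ there are path-valued random variables $\theta_n^y$ ($n\ge1$, $y\in\mathcal D$) with $\theta^y_n\in\mathcal X_n$ almost surely such that, for any deterministic $y_1,\dots,y_m\in\mathcal D$, $(\theta_n^{y_1},\dots,\theta_n^{y_m})$ converges in distribution, as $n\to\infty$, to coalescing Brownian motions (with unit diffusion constant) starting at $y_1,\dots,y_m$; - $(B_1)$ for all $t>0$, $\ \limsup_{n\to\infty}\sup_{(a,t_0)\in\mathbb R^2}\mu_n\big(\hat\eta(t_0,t;a,a+\epsilon)\ge1\big)\to0$ as $\epsilon\to0+$; - $(B_2)$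 for all $t>0$, $\ \epsilon^{-1}\limsup_{n\to\infty}\sup_{(a,t_0)\in\mathbb R^2}\mu_n\big(\hat\eta(t_0,t;a,a+\epsilon)\ge2\big)\to0$ as $\epsilon\to0+$. Then the standard Brownian web exists and $\mathcal X_n$ converges in distribution to it, that is, $\mu_n$ converges weakly to the distribution $\mu_{\bar{\mathcal W}}$ of the standard Brownian web. -/

import Mathlib

open MeasureTheory ProbabilityTheory Filter Topology TopologicalSpace
open scoped NNReal ENNReal

namespace BrownianWeb

noncomputable section

/-! ### The compactified plane -/

/-- The hyperbolic tangent on `[-∞, ∞]`, with `tanh (±∞) = ±1`. -/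
def etanh : EReal → ℝ
  | ⊥ => -1
  | ⊤ => 1
  | (x : ℝ) => Real.tanh x

@[simp] lemma etanh_bot : etanh ⊥ = -1 := rfl

@[simp] lemma etanh_top : etanh ⊤ = 1 := rfl

@[simp] lemma etanh_coe (x : ℝ) : etanh (x : EReal) = Real.tanh x := rfl

lemma etanh_mem (x : EReal) : etanh x ∈ Set.Icc (-1 : ℝ) 1 := by
  induction x with
  | bot => simp
  | top => simp
  | coe x => exact ⟨(Real.neg_one_lt_tanh x).le, (Real.tanh_lt_one x).le⟩

lemma etanh_strictMono : StrictMono etanh := by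
  intro x y h
  induction x with
  | top => simp at h
  | bot =>
    induction y with
    | bot => simp at h
    | top => norm_num
    | coe y => simpa using Real.neg_one_lt_tanh y
  | coe x =>
    induction y with
    | bot => simp at h
    | top => simpa using Real.tanh_lt_one x
    | coe y =>
      have hxy : x < y := by exact_mod_cast h
      rw [etanh_coe, etanh_coe]
      by_contra hc
      have := (Real.artanh_le_artanh (Real.neg_one_lt_tanh y) (Real.tanh_lt_one x)
        (not_lt.mp hc))
      rw [Real.artanh_tanh, Real.artanh_tanh] at this
      exact absurd hxy (not_lt.mpr this)

lemma etanh_continuous : Continuous etanh := by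
  have hm : Monotone (fun x : EReal => (⟨etanh x, etanh_mem x⟩ : Set.Icc (-1 : ℝ) 1)) :=
    fun x y h => etanh_strictMono.monotone h
  have hs : Function.Surjective
      (fun x : EReal => (⟨etanh x, etanh_mem x⟩ : Set.Icc (-1 : ℝ) 1)) := by
    rintro ⟨r, hr1, hr2⟩
    rcases hr1.eq_or_lt with h1 | h1
    · exact ⟨⊥, Subtype.ext (by simpa using h1)⟩
    rcases hr2.eq_or_lt with h2 | h2
    · exact ⟨⊤, Subtype.ext (by simpa using h2.symm)⟩
    · exact ⟨(Real.artanh r : ℝ), Subtype.ext (by simpa using Real.tanh_artanh ⟨h1, h2⟩)⟩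
  exact continuous_subtype_val.comp (hm.continuous_of_surjective hs)

/-- `Φ(x, t) = tanh x / (1 + |t|)`. -/
def Phi (x : EReal) (t : ℝ) : ℝ := etanh x / (1 + |t|)

lemma abs_Phi_sub_le (x y : EReal) (t : ℝ) : |Phi x t - Phi y t| ≤ 2 / (1 + |t|) := by
  have hx := etanh_mem x
  have hy := etanh_mem y
  have ht : 0 < 1 + |t| := by positivity
  rw [Phi, Phi, ← sub_div, abs_div, abs_of_pos ht]
  gcongr
  rw [abs_le]
  constructor <;> linarith [hx.1, hx.2, hy.1, hy.2]

/-! ### The space of paths -/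

/-- A path `(f, t₀)`, `t₀ ∈ [-∞, ∞]`, in the compactified plane. The field `toMap` is the
extension of `f` which is constant equal to `f(t₀)` before the starting time `t₀`, recorded at
finite times. Because `Φ(x, ±∞) = 0` for all `x`, the condition that `t ↦ Φ(f(t), t)` be continuous
on `[t₀, ∞]` just says that `f` is continuous with values in `[-∞, ∞]` at finite times; and for the
same reason the values at `t = ±∞` are invisible to the distance `d` below, so that paths that
differ only there are the same path. For `t₀ = ∞` the path is determined by the constant `f(∞)`. -/
@[ext] structure WebPath where
  toMap : C(ℝ, EReal)
  start : EReal
  const_before : ∀ s t : ℝ, (s : EReal) ≤ start → (t : EReal) ≤ start → toMap s = toMap t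

instance : CoeFun WebPath (fun _ => ℝ → EReal) := ⟨fun p => p.toMap⟩

namespace WebPath

lemma bddAbove_dist (p q : WebPath) :
    BddAbove (Set.range fun t : ℝ => |Phi (p t) t - Phi (q t) t|) := by
  refine ⟨2, ?_⟩
  rintro _ ⟨t, rfl⟩
  refine (abs_Phi_sub_le _ _ _).trans ?_
  rw [div_le_iff₀ (by positivity)]
  nlinarith [abs_nonneg t]

/-- The distance
`d((f₁,t₁),(f₂,t₂)) = (sup_t |Φ(f̂₁(t),t) - Φ(f̂₂(t),t)|) ∨ |tanh t₁ - tanh t₂|`. -/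
instance : MetricSpace WebPath where
  dist p q := max (⨆ t : ℝ, |Phi (p t) t - Phi (q t) t|) |etanh p.start - etanh q.start|
  dist_self p := by simp
  dist_comm p q := by simp only [abs_sub_comm]
  dist_triangle p q r := by
    apply max_le
    · apply ciSup_le
      intro t
      calc |Phi (p t) t - Phi (r t) t|
          ≤ |Phi (p t) t - Phi (q t) t| + |Phi (q t) t - Phi (r t) t| := abs_sub_le _ _ _
        _ ≤ _ := add_le_add
            ((le_ciSup (bddAbove_dist p q) t).trans (le_max_left _ _))
            ((le_ciSup (bddAbove_dist q r) t).trans (le_max_left _ _))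
    · exact (abs_sub_le _ (etanh q.start) _).trans
        (add_le_add (le_max_right _ _) (le_max_right _ _))
  eq_of_dist_eq_zero {p q} h := by
    have h1 : ∀ t : ℝ, p t = q t := by
      intro t
      have h2 : |Phi (p t) t - Phi (q t) t| ≤ 0 := by
        rw [← h]
        exact (le_ciSup (bddAbove_dist p q) t).trans (le_max_left _ _)
      have h3 : Phi (p t) t = Phi (q t) t := by
        have := abs_nonpos_iff.mp h2
        linarith
      have ht : (1 + |t|) ≠ 0 := by positivity
      rw [Phi, Phi, div_left_inj' ht] at h3
      exact etanh_strictMono.injective h3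
    have h4 : |etanh p.start - etanh q.start| ≤ 0 := by
      rw [← h]
      exact le_max_right _ _
    have h5 : etanh p.start = etanh q.start := by
      have := abs_nonpos_iff.mp h4
      linarith
    exact WebPath.ext (ContinuousMap.ext h1) (etanh_strictMono.injective h5)

lemma dist_def (p q : WebPath) : dist p q =
    max (⨆ t : ℝ, |Phi (p t) t - Phi (q t) t|) |etanh p.start - etanh q.start| := rfl

/-- The path space is separable; this makes the product and the Borel `σ`-algebras on finite
tuples of paths agree. -/
instance : SecondCountableTopology WebPath := by
  -- the pairs `(f̂, t₀)` with locally uniform convergence form a separable space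
  let S : Type := {x : C(ℝ, EReal) × EReal //
    ∀ s t : ℝ, (s : EReal) ≤ x.2 → (t : EReal) ≤ x.2 → x.1 s = x.1 t}
  let φ : S → WebPath := fun x => ⟨x.1.1, x.1.2, x.2⟩
  have hsurj : Function.Surjective φ := fun p => ⟨⟨(p.toMap, p.start), p.const_before⟩, rfl⟩
  have hcont : Continuous φ := by
    rw [continuous_iff_continuousAt]
    intro x
    rw [ContinuousAt, Metric.tendsto_nhds]
    intro ε hε
    obtain ⟨T, hT⟩ : ∃ T : ℕ, 2 / (ε / 2) < T := exists_nat_gt _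
    have hT2 : (2 : ℝ) < T * (ε / 2) := by rwa [div_lt_iff₀ (by positivity)] at hT
    let e : C(EReal, ℝ) := ⟨etanh, etanh_continuous⟩
    have hA : Continuous fun z : S => e.comp z.1.1 :=
      (ContinuousMap.continuous_postcomp e).comp (continuous_fst.comp continuous_subtype_val)
    have hB : Continuous fun z : S => etanh z.1.2 :=
      etanh_continuous.comp (continuous_snd.comp continuous_subtype_val)
    have hA' := (ContinuousMap.tendsto_iff_forall_isCompact_tendstoUniformlyOn.mp
      (hA.tendsto x)) (Set.Icc (-(T : ℝ)) T) isCompact_Icc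
    have hA'' := Metric.tendstoUniformlyOn_iff.mp hA' (ε / 2) (by positivity)
    have hB' := Metric.tendsto_nhds.mp (hB.tendsto x) ε hε
    filter_upwards [hA'', hB'] with z hz1 hz2
    rw [dist_def]
    refine max_lt (lt_of_le_of_lt (ciSup_le fun t => ?_) (half_lt_self hε)) ?_
    · by_cases ht : t ∈ Set.Icc (-(T : ℝ)) T
      · have h1 := hz1 t ht
        rw [Real.dist_eq, abs_sub_comm] at h1
        have h2 : |etanh (z.1.1 t) - etanh (x.1.1 t)| < ε / 2 := h1
        change |Phi (z.1.1 t) t - Phi (x.1.1 t) t| ≤ ε / 2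
        have ht : 0 < 1 + |t| := by positivity
        rw [Phi, Phi, ← sub_div, abs_div, abs_of_pos ht]
        exact (div_le_self (abs_nonneg _) (by linarith [abs_nonneg t])).trans h2.le
      · refine (abs_Phi_sub_le _ _ _).trans ?_
        have h3 : (T : ℝ) < |t| := by
          by_contra hc
          exact ht (abs_le.mp (not_lt.mp hc))
        rw [div_le_iff₀ (by positivity)]
        nlinarith
    · simpa [Real.dist_eq] using hz2
  have : SecondCountableTopology S :=
    IsEmbedding.subtypeVal.secondCountableTopology
  have : SeparableSpace S := inferInstance
  have : SeparableSpace WebPath := hsurj.denseRange.separableSpace hcont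
  exact UniformSpace.secondCountable_of_separable WebPath

instance : MeasurableSpace WebPath := borel WebPath

instance : BorelSpace WebPath := ⟨rfl⟩

/-- The path `p = (f, t₀)` touches the space-time point `z = (x, t)`:
`t₀ ≤ t` and `f(t) = x`. -/
def Touches (p : WebPath) (z : ℝ × ℝ) : Prop :=
  p.start ≤ (z.2 : EReal) ∧ p z.2 = (z.1 : EReal)

/-- The path `p = (f, t₀)` starts at the space-time point `z = (x, t)`:
`t₀ = t` and `f(t) = x`. -/
def StartsAt (p : WebPath) (z : ℝ × ℝ) : Prop :=
  p.start = (z.2 : EReal) ∧ p z.2 = (z.1 : EReal)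

/-- Two paths cross if, at times at which both of them are defined, each one is
somewhere strictly to the left of the other. -/
def Crosses (p q : WebPath) : Prop :=
  ∃ s t : ℝ, max p.start q.start ≤ s ∧ max p.start q.start ≤ t ∧ p s < q s ∧ q t < p t

end WebPath

/-! ### The space of compact sets of paths -/

/-- The space `ℋ` of nonempty compact sets of paths, with the Hausdorff distance. -/
abbrev PathSets : Type := NonemptyCompacts WebPath

instance : MeasurableSpace PathSets := borel PathSets

instance : BorelSpace PathSets := ⟨rfl⟩

/-- No two paths of `K` cross. -/
def Noncrossing (K : PathSets) : Prop := ∀ p ∈ K, ∀ q ∈ K, ¬ p.Crosses q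

/-- `η(t₀, t; a, b)`: the number of points of `ℝ × {t₀ + t}` that are touched by paths in `K`
which also touch some point of `[a, b] × {t₀}`. -/
def eta (K : PathSets) (t₀ t a b : ℝ) : ℕ∞ :=
  Set.encard {x : ℝ | ∃ p ∈ K, (∃ x₀ ∈ Set.Icc a b, p.Touches (x₀, t₀)) ∧ p.Touches (x, t₀ + t)}

/-- `η̂ = η - 1`, truncated to `0` when `η = 0`; only events `η̂ ≥ k` with `k ≥ 1` are used, and
these do not see the truncation. -/
def etaHat (K : PathSets) (t₀ t a b : ℝ) : ℕ∞ := eta K t₀ t a b - 1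

/-! ### Coalescing Brownian motions -/

/-- The times at which the trajectory `W j` started at time `t_j` is at the same place as one
of the paths `Z i` with lower label `i < j`; here `y j = (x_j, t_j)`. -/
def meetingTimes {m : ℕ} (y : Fin m → ℝ × ℝ) (W : Fin m → ℝ → ℝ) (Z : Fin m → WebPath)
    (j : Fin m) : Set ℝ :=
  {s | (y j).2 ≤ s ∧ ∃ i < j, (y i).2 ≤ s ∧ Z i s = (W j s : EReal)}

/-- The paths `Z` arise from the trajectories `W j` on `[t_j, ∞)`, `y j = (x_j, t_j)`, by the
coalescing rule: `Z j` follows `W j` up to the first time `τ_j` (possibly `∞`) at which `W j` meets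
some `Z i` with `i < j`, and from then on it follows the `Z i` met at time `τ_j` with `i` least. -/
structure IsCoalescence {m : ℕ} (y : Fin m → ℝ × ℝ) (W : Fin m → ℝ → ℝ)
    (Z : Fin m → WebPath) : Prop where
  start_eq : ∀ j, (Z j).start = ((y j).2 : EReal)
  before : ∀ j, ∀ t : ℝ, (y j).2 ≤ t → t ∈ lowerBounds (meetingTimes y W Z j) →
    Z j t = (W j t : EReal)
  after : ∀ j, ∀ τ : ℝ, IsLeast (meetingTimes y W Z j) τ →
    ∀ i, IsLeast {i | i < j ∧ (y i).2 ≤ τ ∧ Z i τ = (W j τ : EReal)} i →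
      ∀ t : ℝ, τ ≤ t → Z j t = Z i t

/-- `ν` is the joint law of coalescing Brownian motions (with unit diffusion constant) starting
from the space-time points `y j = (x_j, t_j)`: the law of the paths obtained by the coalescing rule
from `W j t = x_j + B_j (t - t_j)`, `t ≥ t_j`, with independent standard Brownian motions `B_j`. -/
def IsCoalescingBrownianLaw {m : ℕ} (y : Fin m → ℝ × ℝ) (ν : Measure (Fin m → WebPath)) : Prop :=
  ∃ (Ω : Type) (_ : MeasurableSpace Ω) (P : Measure Ω) (_ : IsProbabilityMeasure P)
    (B : Fin m → ℝ≥0 → Ω → ℝ) (Z : Ω → Fin m → WebPath),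
    (∀ j, IsBrownianReal (B j) P) ∧
    iIndepFun (fun j ω t => B j t ω) P ∧
    (∀ᵐ ω ∂P, IsCoalescence y (fun j t => (y j).1 + B j (t - (y j).2).toNNReal ω) (Z ω)) ∧
    HasLaw Z ν P

/-! ### The Brownian web -/

/-- `ν` is the distribution of the (standard) Brownian web. -/
structure IsBrownianWebLaw (ν : Measure PathSets) : Prop where
  /-- From any deterministic point there is almost surely a unique path. -/
  unique_path : ∀ y : ℝ × ℝ, ∀ᵐ K ∂ν, ∃! p : WebPath, p ∈ K ∧ p.StartsAt y
  /-- The paths from finitely many deterministic points are coalescing Brownian motions. -/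
  finite_dim : ∀ (m : ℕ) (y : Fin m → ℝ × ℝ), ∃ W : PathSets → Fin m → WebPath,
    (∀ᵐ K ∂ν, ∀ j, W K j ∈ K ∧ (W K j).StartsAt (y j)) ∧
    AEMeasurable W ν ∧ IsCoalescingBrownianLaw y (ν.map W)
  /-- Almost surely, the web is the closure of its paths from any given deterministic countable
  dense set of points. -/
  closure_eq : ∀ D : Set (ℝ × ℝ), D.Countable → Dense D →
    ∀ᵐ K : PathSets ∂ν, (K : Set WebPath) = closure {p | p ∈ K ∧ ∃ y ∈ D, p.StartsAt y}

end

end BrownianWeb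

namespace BrownianWeb

noncomputable section

/-! ### Topology of the path space -/

/-! Tightness comes from noncrossing. A path that passes quickly from one side of an interval `[b,
c]` to the other must cross any path that stays inside `(b, c)` meanwhile. Cut the time window `[-N,
N]` into about `2N/δ` slots. In each slot (I₁) supplies a nearly Brownian path that stays in the
tube except with probability of order `exp (-κ/δ)`, and the sum of these errors tends to `0` with
`δ`. This bounds the modulus of continuity of all paths at once, and an Arzelà–Ascoli argument gives
compactness (`exists_tubeSet_miss`, `isTightMeasureSet`).

Every limit law `μ` is carried by noncrossing sets, puts at least the coalescing Brownian mass on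
"some tuple of paths lies in `F`" for closed `F`, and inherits (B₁) and (B₂) on open events
(`IsWebLimit`). By (B₁), two paths from one deterministic point cannot separate, so the path from
that point is unique (`ae_existsUnique`). Uniqueness turns the lower bound into an equality of laws
for tuples from `D`. It extends to all tuples because the coalescing law depends continuously on the
starting points: Brownian paths that meet also pass through each other, so meetings survive small
perturbations (`ae_transversal`, `tendsto_coal`). By (B₂), whose factor `ε⁻¹` pays for a union bound
over windows of length `ε`, at rational times no three paths through nearby points stay apart
(`ae_isThin`). A path squeezed between paths from `D` must then follow one of them after an
arbitrarily short time (`exists_eqOn`), so the web is the closure of its paths from `D`. Hence every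
limit is a Brownian web.

A Brownian web is the limit of the finite sets of its paths from a dense sequence of points, whose
laws are prescribed, so its law is unique (`IsBrownianWebLaw.eq`). Limits along all ultrafilters
therefore exist and coincide, which is convergence. -/

lemma isClosedEmbedding_etanh : IsClosedEmbedding etanh :=
  etanh_continuous.isClosedEmbedding etanh_strictMono.injective

lemma tendsto_etanh_iff {ι : Type*} {l : Filter ι} {f : ι → EReal} {x : EReal} :
    Tendsto (fun i => etanh (f i)) l (𝓝 (etanh x)) ↔ Tendsto f l (𝓝 x) :=
  (isClosedEmbedding_etanh.isEmbedding.tendsto_nhds_iff (f := f)).symm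

lemma exists_etanh_eq {r : ℝ} (h : r ∈ Set.Icc (-1 : ℝ) 1) : ∃ x, etanh x = r := by
  obtain ⟨h1, h2⟩ := h
  rcases h1.eq_or_lt with h1 | h1
  · exact ⟨⊥, by simpa using h1⟩
  rcases h2.eq_or_lt with h2 | h2
  · exact ⟨⊤, by simpa using h2.symm⟩
  · exact ⟨(Real.artanh r : ℝ), by simpa using Real.tanh_artanh ⟨h1, h2⟩⟩

namespace WebPath

lemma abs_etanh_sub_le (p q : WebPath) (t : ℝ) :
    |etanh (p t) - etanh (q t)| ≤ (1 + |t|) * dist p q := by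
  have ht : 0 < 1 + |t| := by positivity
  have h : |Phi (p t) t - Phi (q t) t| ≤ dist p q :=
    (le_ciSup (bddAbove_dist p q) t).trans (le_max_left _ _)
  rw [Phi, Phi, ← sub_div, abs_div, abs_of_pos ht, div_le_iff₀ ht] at h
  linarith

lemma abs_etanh_start_sub_le (p q : WebPath) :
    |etanh p.start - etanh q.start| ≤ dist p q := le_max_right _ _

/-- The weight `1 / (1 + |t|)` makes all times outside `[-T, T]` contribute at most `ε`, so only a
compact time interval has to be controlled. -/
lemma dist_le_of_forall {p q : WebPath} {ε T : ℝ} (hε : 0 < ε) (hT : 2 / ε ≤ T)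
    (h : ∀ t ∈ Set.Icc (-T) T, |etanh (p t) - etanh (q t)| ≤ ε)
    (hs : |etanh p.start - etanh q.start| ≤ ε) : dist p q ≤ ε := by
  refine max_le (ciSup_le fun t => ?_) hs
  by_cases ht : t ∈ Set.Icc (-T) T
  · have ht' : 0 < 1 + |t| := by positivity
    rw [Phi, Phi, ← sub_div, abs_div, abs_of_pos ht']
    exact (div_le_self (abs_nonneg _) (by linarith [abs_nonneg t])).trans (h t ht)
  · refine (abs_Phi_sub_le _ _ _).trans ?_
    have h3 : T < |t| := by
      by_contra hc
      exact ht (abs_le.mp (not_lt.mp hc))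
    rw [div_le_iff₀ hε] at hT
    rw [div_le_iff₀ (by positivity)]
    nlinarith

lemma continuous_start : Continuous WebPath.start := by
  rw [continuous_iff_continuousAt]
  intro p
  rw [ContinuousAt, ← tendsto_etanh_iff, tendsto_iff_dist_tendsto_zero]
  refine squeeze_zero (fun _ => dist_nonneg) (fun q => ?_)
    (tendsto_iff_dist_tendsto_zero.mp (tendsto_id (x := 𝓝 p)))
  rw [Real.dist_eq]
  exact abs_etanh_start_sub_le _ _

lemma continuous_eval₂ : Continuous fun z : WebPath × ℝ => z.1 z.2 := by
  rw [continuous_iff_continuousAt]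
  rintro ⟨p, t⟩
  rw [ContinuousAt, ← tendsto_etanh_iff, tendsto_iff_dist_tendsto_zero]
  have h1 : Tendsto (fun z : WebPath × ℝ => (1 + |z.2|) * dist z.1 p +
      |etanh (p z.2) - etanh (p t)|) (𝓝 (p, t)) (𝓝 ((1 + |t|) * dist p p +
      |etanh (p t) - etanh (p t)|)) := by
    apply Continuous.tendsto'
    · have : Continuous fun z : WebPath × ℝ => etanh (p z.2) :=
        etanh_continuous.comp (p.toMap.continuous.comp continuous_snd)
      fun_prop
    · rfl
  simp only [dist_self, mul_zero, sub_self, abs_zero, add_zero] at h1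
  refine squeeze_zero (fun _ => dist_nonneg) (fun z => ?_) h1
  rw [Real.dist_eq]
  calc |etanh (z.1 z.2) - etanh (p t)|
      ≤ |etanh (z.1 z.2) - etanh (p z.2)| + |etanh (p z.2) - etanh (p t)| := abs_sub_le _ _ _
    _ ≤ _ := by gcongr; exact abs_etanh_sub_le _ _ _

lemma continuous_eval (t : ℝ) : Continuous fun p : WebPath => p t :=
  continuous_eval₂.comp (Continuous.prodMk_left t)

/-- Convergence along `l ×ˢ 𝓝 t` at every `t` amounts to locally uniform convergence of the `etanh`
values, and the weight takes care of large times. In this form convergence of glued paths can be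
checked near one time, without estimates. -/
lemma tendsto_iff {ι : Type*} {l : Filter ι} {P : ι → WebPath} {p : WebPath} :
    Tendsto P l (𝓝 p) ↔ Tendsto (fun i => (P i).start) l (𝓝 p.start) ∧
      ∀ t : ℝ, Tendsto (fun z : ι × ℝ => P z.1 z.2) (l ×ˢ 𝓝 t) (𝓝 (p t)) := by
  constructor
  · intro h
    refine ⟨(continuous_start.tendsto p).comp h, fun t => ?_⟩
    have h2 : Tendsto (fun z : ι × ℝ => (P z.1, z.2)) (l ×ˢ 𝓝 t) (𝓝 (p, t)) := by
      rw [nhds_prod_eq]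
      exact (h.comp tendsto_fst).prodMk tendsto_snd
    exact (continuous_eval₂.tendsto (p, t)).comp h2
  · rintro ⟨h1, h2⟩
    let e : C(EReal, ℝ) := ⟨etanh, etanh_continuous⟩
    have hloc : TendstoLocallyUniformly (fun i t => etanh (P i t)) (fun t => etanh (p t)) l := by
      rw [tendstoLocallyUniformly_iff_forall_tendsto]
      intro t
      have a1 : Tendsto (fun z : ι × ℝ => etanh (p z.2)) (l ×ˢ 𝓝 t) (𝓝 (etanh (p t))) :=
        ((e.comp p.toMap).continuous.tendsto t).comp tendsto_snd
      have a2 : Tendsto (fun z : ι × ℝ => etanh (P z.1 z.2)) (l ×ˢ 𝓝 t) (𝓝 (etanh (p t))) :=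
        tendsto_etanh_iff.mpr (h2 t)
      have := a1.prodMk_nhds a2
      exact this.mono_right (nhds_le_uniformity _)
    rw [Metric.tendsto_nhds]
    intro ε hε
    have hu := (tendstoLocallyUniformlyOn_iff_tendstoUniformlyOn_of_compact
      (isCompact_Icc (a := -(2 / (ε / 2))) (b := 2 / (ε / 2)))).mp hloc.tendstoLocallyUniformlyOn
    have hs := (Metric.tendsto_nhds.mp (tendsto_etanh_iff.mpr h1)) (ε / 2) (by positivity)
    filter_upwards [Metric.tendstoUniformlyOn_iff.mp hu (ε / 2) (by positivity), hs] with i h3 h4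
    refine lt_of_le_of_lt (dist_le_of_forall (half_pos hε) le_rfl (fun t ht => ?_) ?_)
      (half_lt_self hε)
    · have := h3 t ht
      rw [Real.dist_eq, abs_sub_comm] at this
      exact this.le
    · rw [Real.dist_eq] at h4
      exact h4.le

lemma eq_of_start_eq {p q : WebPath} (h : p.start = q.start) (h' : ∀ t : ℝ, p t = q t) : p = q :=
  WebPath.ext (ContinuousMap.ext h') h

/-- Build a path from a function with values in `[-1, 1]`, through `etanh`. -/
lemma exists_of_etanh {g : ℝ → ℝ} (hg : Continuous g) (hg1 : ∀ t, g t ∈ Set.Icc (-1 : ℝ) 1)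
    {s : EReal} (hs : ∀ u v : ℝ, (u : EReal) ≤ s → (v : EReal) ≤ s → g u = g v) :
    ∃ p : WebPath, p.start = s ∧ ∀ t, etanh (p t) = g t := by
  choose f hf using fun t => exists_etanh_eq (hg1 t)
  have hfc : Continuous f := by
    rw [isClosedEmbedding_etanh.isEmbedding.continuous_iff]
    exact hg.congr fun t => (hf t).symm
  refine ⟨⟨⟨f, hfc⟩, s, fun u v hu hv => ?_⟩, rfl, hf⟩
  apply etanh_strictMono.injective
  change etanh (f u) = etanh (f v)
  rw [hf, hf, hs u v hu hv]

/-- For a limit of paths, constancy is inherited only strictly before the limiting starting time;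
continuity adds the starting time itself. -/
lemma eq_of_le_of_forall_lt {α : Type*} [TopologicalSpace α] [T2Space α] {g : ℝ → α}
    (hg : Continuous g) {s : EReal}
    (key : ∀ a b : ℝ, (a : EReal) < s → (b : EReal) < s → g a = g b) (a b : ℝ)
    (ha : (a : EReal) ≤ s) (hb : (b : EReal) ≤ s) : g a = g b := by
  induction s with
  | bot => simp at ha
  | top => exact key a b (EReal.coe_lt_top a) (EReal.coe_lt_top b)
  | coe s =>
    have h2 : ∀ a : ℝ, a ≤ s → g a = g s := by
      intro a ha
      rcases ha.eq_or_lt with rfl | ha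
      · rfl
      have h3 : Tendsto g (𝓝[<] s) (𝓝 (g s)) := hg.continuousAt.mono_left nhdsWithin_le_nhds
      refine tendsto_nhds_unique (tendsto_const_nhds.congr' ?_) h3
      filter_upwards [self_mem_nhdsWithin] with b hb
      exact key a b (by exact_mod_cast ha) (by exact_mod_cast hb)
    rw [h2 a (by exact_mod_cast ha), h2 b (by exact_mod_cast hb)]

instance : CompleteSpace WebPath := by
  refine Metric.complete_of_cauchySeq_tendsto fun u hu => ?_
  have hcs : ∀ t, CauchySeq fun n => etanh (u n t) := by
    intro t
    rw [Metric.cauchySeq_iff] at hu ⊢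
    intro ε hε
    obtain ⟨N, hN⟩ := hu (ε / (1 + |t|)) (by positivity)
    refine ⟨N, fun m hm n hn => ?_⟩
    have h1 := hN m hm n hn
    rw [lt_div_iff₀ (by positivity)] at h1
    rw [Real.dist_eq]
    exact (abs_etanh_sub_le _ _ _).trans_lt (by linarith)
  have hss : CauchySeq fun n => etanh (u n).start := by
    rw [Metric.cauchySeq_iff] at hu ⊢
    intro ε hε
    obtain ⟨N, hN⟩ := hu ε hε
    exact ⟨N, fun m hm n hn => (abs_etanh_start_sub_le _ _).trans_lt (hN m hm n hn)⟩
  choose g hg using fun t => cauchySeq_tendsto_of_complete (hcs t)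
  obtain ⟨σ, hσ⟩ := cauchySeq_tendsto_of_complete hss
  have hmem : ∀ t, g t ∈ Set.Icc (-1 : ℝ) 1 := fun t =>
    isClosed_Icc.mem_of_tendsto (hg t) (Eventually.of_forall fun n => etanh_mem _)
  obtain ⟨s, hs⟩ := exists_etanh_eq (isClosed_Icc.mem_of_tendsto hσ
    (Eventually.of_forall fun n => etanh_mem _))
  rw [← hs] at hσ
  have hlim : ∀ ε > 0, ∀ᶠ n in atTop, ∀ t, |etanh (u n t) - g t| ≤ (1 + |t|) * ε := by
    intro ε hε
    obtain ⟨N, hN⟩ := Metric.cauchySeq_iff.mp hu ε hε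
    filter_upwards [eventually_ge_atTop N] with n hn t
    have h2 : Tendsto (fun m => |etanh (u n t) - etanh (u m t)|) atTop
        (𝓝 |etanh (u n t) - g t|) := (tendsto_const_nhds.sub (hg t)).abs
    refine le_of_tendsto h2 ?_
    filter_upwards [eventually_ge_atTop N] with m hm
    exact (abs_etanh_sub_le _ _ _).trans (by gcongr; exact (hN n hn m hm).le)
  have hloc : TendstoLocallyUniformly (fun n t => etanh (u n t)) g atTop := by
    rw [Metric.tendstoLocallyUniformly_iff]
    intro ε hε t
    refine ⟨Metric.ball t 1, Metric.ball_mem_nhds t one_pos, ?_⟩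
    filter_upwards [hlim (ε / (2 * (2 + |t|))) (by positivity)] with n hn v hv
    rw [Real.dist_eq, abs_sub_comm]
    have h1 : |v| ≤ |t| + 1 := by
      rw [Metric.mem_ball, Real.dist_eq] at hv
      have := abs_sub_abs_le_abs_sub v t
      linarith
    calc |etanh (u n v) - g v| ≤ (1 + |v|) * (ε / (2 * (2 + |t|))) := hn v
      _ ≤ (2 + |t|) * (ε / (2 * (2 + |t|))) :=
        mul_le_mul_of_nonneg_right (by linarith) (by positivity)
      _ = ε / 2 := by field_simp
      _ < ε := half_lt_self hε
  have hgc : Continuous g := hloc.continuous (Frequently.of_forall fun n =>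
    etanh_continuous.comp (u n).toMap.continuous)
  have hconst : ∀ a b : ℝ, (a : EReal) ≤ s → (b : EReal) ≤ s → g a = g b := by
    have key : ∀ a b : ℝ, (a : EReal) < s → (b : EReal) < s → g a = g b := by
      intro a b ha hb
      have h1 : Tendsto (fun n => (u n).start) atTop (𝓝 s) := tendsto_etanh_iff.mp hσ
      refine tendsto_nhds_unique ((hg a).congr' ?_) (hg b)
      filter_upwards [h1.eventually_const_lt ha, h1.eventually_const_lt hb] with n hna hnb
      rw [(u n).const_before a b hna.le hnb.le]
    exact eq_of_le_of_forall_lt hgc key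
  obtain ⟨p, hp1, hp2⟩ := exists_of_etanh hgc hmem hconst
  refine ⟨p, ?_⟩
  rw [Metric.tendsto_nhds]
  intro ε hε
  have h0 : 0 < 1 + 2 / (ε / 2) := by positivity
  filter_upwards [hlim (ε / 2 / (1 + 2 / (ε / 2))) (by positivity),
    Metric.tendsto_nhds.mp hσ (ε / 2) (by positivity)] with n h1 h2
  refine lt_of_le_of_lt (dist_le_of_forall (half_pos hε) le_rfl (fun t ht => ?_) ?_)
    (half_lt_self hε)
  · rw [hp2]
    calc |etanh (u n t) - g t| ≤ (1 + |t|) * (ε / 2 / (1 + 2 / (ε / 2))) := h1 t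
      _ ≤ (1 + 2 / (ε / 2)) * (ε / 2 / (1 + 2 / (ε / 2))) := by
        gcongr
        exact abs_le.mpr ht
      _ = ε / 2 := by field_simp
  · rw [hp1]
    exact h2.le

instance : PolishSpace WebPath := inferInstance

instance : Inhabited WebPath := ⟨⟨ContinuousMap.const ℝ 0, 0, fun _ _ _ _ => rfl⟩⟩

/-! ### Measurability of path-valued maps -/

/-- The values of a path at rational times, and its starting time. -/
def coords (p : WebPath) : (ℚ → EReal) × EReal := (fun q => p q, p.start)

lemma continuous_coords : Continuous coords := by
  unfold coords
  exact (continuous_pi fun q : ℚ => continuous_eval (q : ℝ)).prodMk continuous_start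

lemma eq_of_eq_rat {p q : WebPath} (h : ∀ r : ℚ, p r = q r) (t : ℝ) : p t = q t := by
  have : (p : ℝ → EReal) = q := Continuous.ext_on Rat.isDenseEmbedding_coe_real.dense
    p.toMap.continuous q.toMap.continuous (by rintro _ ⟨r, rfl⟩; exact h r)
  exact congrFun this t

lemma coords_injective : Function.Injective coords := by
  intro p q h
  exact eq_of_start_eq (congrArg Prod.snd h)
    (eq_of_eq_rat fun r => congrFun (congrArg Prod.fst h) r)

/-- An injective continuous map between Polish spaces is a measurable embedding. Measurability of
path-valued maps, and equality of laws of paths, thereby reduce to countably many coordinates. -/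
lemma measurableEmbedding_coords : MeasurableEmbedding coords :=
  continuous_coords.measurableEmbedding coords_injective

lemma measurable_eval (t : ℝ) : Measurable fun p : WebPath => p t := (continuous_eval t).measurable

lemma measurable_of_eval {Ω : Type*} [MeasurableSpace Ω] {Z : Ω → WebPath}
    (hs : Measurable fun ω => (Z ω).start) (h : ∀ q : ℚ, Measurable fun ω => Z ω q) :
    Measurable Z := by
  rw [← measurableEmbedding_coords.measurable_comp_iff]
  exact (measurable_pi_lambda _ h).prodMk hs

lemma aemeasurable_of_eval {Ω : Type*} [MeasurableSpace Ω] {P : Measure Ω} {Z : Ω → WebPath}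
    (hs : AEMeasurable (fun ω => (Z ω).start) P) (h : ∀ q : ℚ, AEMeasurable (fun ω => Z ω q) P) :
    AEMeasurable Z P := by
  rw [← measurableEmbedding_coords.aemeasurable_comp_iff]
  exact (aemeasurable_pi_lambda _ h).prodMk hs

/-! ### Compact sets of paths -/

/-- The paths with modulus of continuity controlled by `δ`: on `[-N, N]`, oscillations over times
`≤ δ N` are at most `1 / (N + 1)`. -/
def modulusSet (δ : ℕ → ℝ) : Set WebPath :=
  {p | ∀ N : ℕ, ∀ s ∈ Set.Icc (-(N : ℝ)) N, ∀ t ∈ Set.Icc (-(N : ℝ)) N, |s - t| ≤ δ N →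
    |etanh (p s) - etanh (p t)| ≤ 1 / (N + 1)}

/-- Arzelà–Ascoli along an ultrafilter. Pointwise limits exist because `EReal` is compact, so no
bound on the values is needed; the common modulus makes the limit continuous and the convergence
locally uniform. -/
lemma isCompact_modulusSet {δ : ℕ → ℝ} (hδ : ∀ N, 0 < δ N) : IsCompact (modulusSet δ) := by
  rw [isCompact_iff_ultrafilter_le_nhds']
  intro 𝒰 h𝒰
  -- pointwise limits along the ultrafilter
  have hlim : ∀ t : ℝ, ∃ x : EReal, Tendsto (fun p : WebPath => p t) 𝒰 (𝓝 x) := fun t => by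
    obtain ⟨x, -, hx⟩ := isCompact_univ.ultrafilter_le_nhds (𝒰.map fun p : WebPath => p t)
      (by simp)
    exact ⟨x, hx⟩
  choose f hf using hlim
  obtain ⟨s, -, hs⟩ := isCompact_univ.ultrafilter_le_nhds (𝒰.map WebPath.start) (by simp)
  have hs : Tendsto WebPath.start 𝒰 (𝓝 s) := hs
  have hmod : ∀ N : ℕ, ∀ s ∈ Set.Icc (-(N : ℝ)) N, ∀ t ∈ Set.Icc (-(N : ℝ)) N, |s - t| ≤ δ N →
      |etanh (f s) - etanh (f t)| ≤ 1 / (N + 1) := by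
    intro N s hs t ht hst
    refine le_of_tendsto ((tendsto_etanh_iff.mpr (hf s)).sub (tendsto_etanh_iff.mpr (hf t))).abs ?_
    filter_upwards [h𝒰] with p hp using hp N s hs t ht hst
  have hN : ∀ (t ε : ℝ), 0 < ε → ∃ N : ℕ, |t| + 1 ≤ N ∧ (1 : ℝ) / (N + 1) < ε := by
    intro t ε hε
    obtain ⟨N, hN⟩ := exists_nat_gt (max (|t| + 1) (1 / ε))
    refine ⟨N, (le_max_left _ _).trans hN.le, ?_⟩
    rw [div_lt_comm₀ (by positivity) hε]
    exact ((le_max_right _ _).trans_lt hN).trans (by linarith)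
  have hball : ∀ (t : ℝ) (N : ℕ), |t| + 1 ≤ N → ∀ u, |u - t| ≤ min 1 (δ N) →
      u ∈ Set.Icc (-(N : ℝ)) N ∧ t ∈ Set.Icc (-(N : ℝ)) N ∧ |u - t| ≤ δ N := by
    intro t N hN u hu
    have h1 := hu.trans (min_le_left _ _)
    have h2 := abs_sub_abs_le_abs_sub u t
    exact ⟨abs_le.mp (by linarith), abs_le.mp (by linarith), hu.trans (min_le_right _ _)⟩
  have hfc : Continuous fun t => etanh (f t) := by
    rw [Metric.continuous_iff]
    intro t ε hε
    obtain ⟨N, hN1, hN2⟩ := hN t ε hε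
    refine ⟨min 1 (δ N), lt_min one_pos (hδ N), fun u hu => ?_⟩
    obtain ⟨h1, h2, h3⟩ := hball t N hN1 u hu.le
    exact (hmod N u h1 t h2 h3).trans_lt hN2
  have hfc' : Continuous f := by
    rwa [isClosedEmbedding_etanh.isEmbedding.continuous_iff]
  have hconst : ∀ a b : ℝ, (a : EReal) ≤ s → (b : EReal) ≤ s → f a = f b := by
    have key : ∀ a b : ℝ, (a : EReal) < s → (b : EReal) < s → f a = f b := by
      intro a b ha hb
      refine tendsto_nhds_unique ((hf a).congr' ?_) (hf b)
      filter_upwards [hs.eventually_const_lt ha, hs.eventually_const_lt hb] with p hna hnb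
      rw [p.const_before a b hna.le hnb.le]
    exact eq_of_le_of_forall_lt hfc' key
  refine ⟨⟨⟨f, hfc'⟩, s, hconst⟩, hmod, ?_⟩
  change Tendsto id (𝒰 : Filter WebPath) _
  rw [tendsto_iff]
  refine ⟨hs, fun t => ?_⟩
  rw [← tendsto_etanh_iff, Metric.tendsto_nhds]
  intro ε hε
  obtain ⟨N, hN1, hN2⟩ := hN t (ε / 2) (half_pos hε)
  have h1 : ∀ᶠ p in (𝒰 : Filter WebPath), dist (etanh (p t)) (etanh (f t)) < ε / 2 :=
    Metric.tendsto_nhds.mp (tendsto_etanh_iff.mpr (hf t)) _ (half_pos hε)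
  have h2 : ∀ᶠ u in 𝓝 t, dist u t < min 1 (δ N) :=
    Metric.ball_mem_nhds t (lt_min one_pos (hδ N))
  filter_upwards [(h1.and h𝒰).prod_mk h2] with z hz
  obtain ⟨⟨hz1, hz2⟩, hz3⟩ := hz
  obtain ⟨g1, g2, g3⟩ := hball t N hN1 z.2 hz3.le
  have g4 := hz2 N z.2 g1 t g2 g3
  calc dist (etanh (z.1 z.2)) (etanh (f t))
      ≤ dist (etanh (z.1 z.2)) (etanh (z.1 t)) + dist (etanh (z.1 t)) (etanh (f t)) :=
        dist_triangle _ _ _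
    _ < ε / 2 + ε / 2 := add_lt_add (g4.trans_lt hN2) hz1
    _ = ε := add_halves ε

/-! ### Meeting of two paths -/

/-- The set of times at which two paths, both already started, are at the same place. -/
def meetSet (p q : WebPath) : Set ℝ := {s | p.start ≤ s ∧ q.start ≤ s ∧ p s = q s}

/-- Two paths have met by time `t`. -/
def Meets (p q : WebPath) (t : ℝ) : Prop := ∃ s ≤ t, s ∈ meetSet p q

lemma Meets.mono {p q : WebPath} {s t : ℝ} (h : Meets p q s) (hst : s ≤ t) : Meets p q t := by
  obtain ⟨r, hr, h⟩ := h
  exact ⟨r, hr.trans hst, h⟩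

lemma isClosed_setOf_mem_meetSet :
    IsClosed {z : ℝ × (WebPath × WebPath) | z.1 ∈ meetSet z.2.1 z.2.2} := by
  have h1 : Continuous fun z : ℝ × (WebPath × WebPath) => (z.1 : EReal) :=
    continuous_coe_real_ereal.comp continuous_fst
  have h2 : Continuous fun z : ℝ × (WebPath × WebPath) => z.2.1.start :=
    continuous_start.comp (continuous_fst.comp continuous_snd)
  have h3 : Continuous fun z : ℝ × (WebPath × WebPath) => z.2.2.start :=
    continuous_start.comp (continuous_snd.comp continuous_snd)
  have h4 : Continuous fun z : ℝ × (WebPath × WebPath) => z.2.1 z.1 :=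
    continuous_eval₂.comp ((continuous_fst.comp continuous_snd).prodMk continuous_fst)
  have h5 : Continuous fun z : ℝ × (WebPath × WebPath) => z.2.2 z.1 :=
    continuous_eval₂.comp ((continuous_snd.comp continuous_snd).prodMk continuous_fst)
  exact (isClosed_le h2 h1).inter ((isClosed_le h3 h1).inter (isClosed_eq h4 h5))

lemma isClosed_meetSet (p q : WebPath) : IsClosed (meetSet p q) :=
  isClosed_setOf_mem_meetSet.preimage (Continuous.prodMk_left (p, q))

/-- The time ranges over a compact interval, and projection along a compact factor is a closed map.
-/
lemma isClosed_setOf_exists_meet (a t : ℝ) :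
    IsClosed {z : WebPath × WebPath | ∃ s ∈ Set.Icc a t, s ∈ meetSet z.1 z.2} := by
  have h := isClosed_setOf_mem_meetSet
  have : {z : WebPath × WebPath | ∃ s ∈ Set.Icc a t, s ∈ meetSet z.1 z.2} =
      Prod.snd '' {z : Set.Icc a t × (WebPath × WebPath) | (z.1 : ℝ) ∈ meetSet z.2.1 z.2.2} := by
    ext z
    constructor
    · rintro ⟨s, hs, h⟩
      exact ⟨(⟨s, hs⟩, z), h, rfl⟩
    · rintro ⟨⟨s, z⟩, h, rfl⟩
      exact ⟨s, s.2, h⟩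
  rw [this]
  refine isClosedMap_snd_of_compactSpace _ ?_
  have hc : Continuous fun z : Set.Icc a t × (WebPath × WebPath) => ((z.1 : ℝ), z.2) :=
    (continuous_subtype_val.comp continuous_fst).prodMk continuous_snd
  exact h.preimage hc

lemma measurableSet_meets (t : ℝ) :
    MeasurableSet {z : WebPath × WebPath | Meets z.1 z.2 t} := by
  have : {z : WebPath × WebPath | Meets z.1 z.2 t} =
      ⋃ n : ℕ, {z : WebPath × WebPath | ∃ s ∈ Set.Icc (-(n : ℝ)) t, s ∈ meetSet z.1 z.2} := by
    ext z
    simp only [Set.mem_ofPred_eq, Set.mem_iUnion]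
    constructor
    · rintro ⟨s, hs, h⟩
      obtain ⟨n, hn⟩ := exists_nat_gt (-s)
      exact ⟨n, s, ⟨by linarith, hs⟩, h⟩
    · rintro ⟨n, s, hs, h⟩
      exact ⟨s, hs.2, h⟩
  rw [this]
  exact MeasurableSet.iUnion fun n => (isClosed_setOf_exists_meet _ _).measurableSet

/-- The meeting times form a closed set bounded below by the starting time of `p`. Two paths from
time `-∞` need not have a first meeting, hence the condition on `p.start`. -/
lemma exists_first_meet {p q : WebPath} {t : ℝ} (hp : p.start ≠ ⊥) (h : Meets p q t) :
    ∃ τ ≤ t, τ ∈ meetSet p q ∧ ∀ s < τ, ¬ Meets p q s := by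
  obtain ⟨s, hs, hm⟩ := h
  have hne : (meetSet p q).Nonempty := ⟨s, hm⟩
  have hbd : BddBelow (meetSet p q) := by
    have : p.start ≠ ⊤ := fun hc => by simpa [hc] using hm.1
    lift p.start to ℝ using ⟨this, hp⟩ with a ha
    refine ⟨a, fun r hr => ?_⟩
    have := hr.1
    rw [← ha] at this
    exact_mod_cast this
  refine ⟨sInf (meetSet p q), (csInf_le hbd hm).trans hs,
    (isClosed_meetSet p q).csInf_mem hne hbd, ?_⟩
  rintro r hr ⟨r', hr', hm'⟩
  exact absurd (csInf_le hbd hm') (not_le.mpr (hr'.trans_lt hr))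

/-- Two paths that agree from any of their meeting times on. -/
def Sticky (p q : WebPath) : Prop := ∀ s ∈ meetSet p q, ∀ t, s ≤ t → p t = q t

lemma meetSet_comm (p q : WebPath) : meetSet p q = meetSet q p := by
  ext s
  exact ⟨fun h => ⟨h.2.1, h.1, h.2.2.symm⟩, fun h => ⟨h.2.1, h.1, h.2.2.symm⟩⟩

lemma Sticky.symm {p q : WebPath} (h : Sticky p q) : Sticky q p := fun s hs t hst =>
  (h s (by rwa [meetSet_comm]) t hst).symm

lemma sticky_self (p : WebPath) : Sticky p p := fun _ _ _ _ => rfl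

/-- Two paths that differ at some time differ on a neighbourhood, so rational times detect it. This
makes stickiness a countable intersection of measurable conditions. -/
lemma sticky_iff_rat {p q : WebPath} :
    Sticky p q ↔ ∀ r : ℚ, Meets p q r → p r = q r := by
  constructor
  · rintro h r ⟨s, hs, hm⟩
    exact h s hm r hs
  · intro h s hs t hst
    by_contra hne
    have hlt : s < t := lt_of_le_of_ne hst fun hc => hne (hc ▸ hs.2.2)
    have hopen : IsOpen {u : ℝ | p u ≠ q u} :=
      isOpen_ne_fun p.toMap.continuous q.toMap.continuous
    obtain ⟨ε, hε, hball⟩ := Metric.isOpen_iff.mp hopen t hne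
    obtain ⟨r, hr1, hr2⟩ := exists_rat_btwn (max_lt hlt (show t - ε < t by linarith))
    refine hball (a := (r : ℝ)) ?_ (h r ⟨s, ((le_max_left _ _).trans_lt hr1).le, hs⟩)
    rw [Metric.mem_ball, Real.dist_eq, abs_lt]
    constructor <;> linarith [(le_max_right s (t - ε)).trans_lt hr1]

lemma measurableSet_sticky : MeasurableSet {z : WebPath × WebPath | Sticky z.1 z.2} := by
  simp only [sticky_iff_rat, Set.ofPred_forall]
  refine MeasurableSet.iInter fun r => ?_
  have h1 := measurableSet_meets (r : ℝ)
  have h2 : MeasurableSet {z : WebPath × WebPath | z.1 r = z.2 r} :=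
    (isClosed_eq ((continuous_eval r).comp continuous_fst)
      ((continuous_eval r).comp continuous_snd)).measurableSet
  convert h1.compl.union h2 using 1
  ext z
  simp only [Set.mem_ofPred_eq, Set.mem_union, Set.mem_compl_iff]
  tauto

/-! ### Merging a path into another one -/

open Classical in
/-- The values of the path that follows `p` until it meets `q` and then follows `q`. -/
def mergeFun (p q : WebPath) (t : ℝ) : EReal := if Meets p q t then q t else p t

lemma mergeFun_of_le_start {p q : WebPath} {t : ℝ} (ht : (t : EReal) ≤ p.start) :
    mergeFun p q t = p t := by
  rw [mergeFun]
  split_ifs with h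
  · obtain ⟨s, hs, h1, -, h2⟩ := h
    have : s = t := le_antisymm hs (by exact_mod_cast ht.trans h1)
    rw [← this, h2]
  · rfl

/-- If the paths have met by every time the result is `q`, if they never meet it is `p`, and
otherwise the two are glued at the first meeting time, where they agree. -/
lemma continuous_mergeFun (p q : WebPath) : Continuous (mergeFun p q) := by
  by_cases hall : ∀ t, Meets p q t
  · have : mergeFun p q = q := funext fun t => by rw [mergeFun, if_pos (hall t)]
    rw [this]
    exact q.toMap.continuous
  push Not at hall
  obtain ⟨t₀, ht₀⟩ := hall
  rcases (meetSet p q).eq_empty_or_nonempty with hem | hne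
  · have : mergeFun p q = p := funext fun t => by
      rw [mergeFun, if_neg]
      rintro ⟨s, -, hs⟩
      simp [hem] at hs
    rw [this]
    exact p.toMap.continuous
  · have hbd : BddBelow (meetSet p q) :=
      ⟨t₀, fun s hs => le_of_not_ge fun hc => ht₀ ⟨s, hc, hs⟩⟩
    have hmem := (isClosed_meetSet p q).csInf_mem hne hbd
    have : mergeFun p q = fun t => if sInf (meetSet p q) ≤ t then q t else p t := by
      funext t
      rw [mergeFun]
      congr 1
      rw [eq_iff_iff]
      exact ⟨fun ⟨s, hs, h⟩ => (csInf_le hbd h).trans hs, fun h => ⟨_, h, hmem⟩⟩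
    rw [this]
    refine Continuous.if_le q.toMap.continuous p.toMap.continuous continuous_const continuous_id ?_
    rintro t rfl
    exact hmem.2.2.symm

/-- The path that follows `p` until it meets `q` and then follows `q`. -/
def merge (p q : WebPath) : WebPath where
  toMap := ⟨mergeFun p q, continuous_mergeFun p q⟩
  start := p.start
  const_before s t hs ht := by
    change mergeFun p q s = mergeFun p q t
    rw [mergeFun_of_le_start hs, mergeFun_of_le_start ht, p.const_before s t hs ht]

lemma merge_of_meets {p q : WebPath} {t : ℝ} (h : Meets p q t) : merge p q t = q t := by
  classical
  exact if_pos h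

lemma merge_of_not_meets {p q : WebPath} {t : ℝ} (h : ¬ Meets p q t) : merge p q t = p t := by
  classical
  exact if_neg h

lemma merge_of_le_start {p q : WebPath} {t : ℝ} (ht : (t : EReal) ≤ p.start) :
    merge p q t = p t := mergeFun_of_le_start ht

/-- At the meeting time itself the value can still be read from `p`, so `q` is needed only strictly
after it has started. The strictness matters later: only strictly after its start does a Brownian
path avoid a given point almost surely. -/
lemma merge_eq_or (p q : WebPath) (t : ℝ) :
    merge p q t = p t ∨ (q.start < t ∧ merge p q t = q t) := by
  by_cases h : Meets p q t
  · rw [merge_of_meets h]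
    obtain ⟨s, hs, h1, h2, h3⟩ := h
    rcases hs.eq_or_lt with rfl | hs
    · exact Or.inl h3.symm
    · exact Or.inr ⟨h2.trans_lt (by exact_mod_cast hs), rfl⟩
  · exact Or.inl (merge_of_not_meets h)

lemma measurable_merge : Measurable fun z : WebPath × WebPath => merge z.1 z.2 := by
  classical
  refine measurable_of_eval ?_ fun r => ?_
  · exact (continuous_start.measurable.comp measurable_fst :
      Measurable fun z : WebPath × WebPath => z.1.start)
  · exact Measurable.ite (measurableSet_meets r) ((measurable_eval r).comp measurable_snd)
      ((measurable_eval r).comp measurable_fst)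

/-- Both branches of the merge tend to the same value, so it is irrelevant which of them is taken.
-/
lemma tendsto_merge_of_eq {ι : Type*} {l : Filter ι} {P Q : ι → WebPath} {p q : WebPath}
    (hP : Tendsto P l (𝓝 p)) (hQ : Tendsto Q l (𝓝 q)) {t : ℝ} (h : p t = q t) :
    Tendsto (fun z : ι × ℝ => merge (P z.1) (Q z.1) z.2) (l ×ˢ 𝓝 t) (𝓝 (q t)) := by
  classical
  have h1 := (tendsto_iff.mp hP).2 t
  have h2 := (tendsto_iff.mp hQ).2 t
  rw [h] at h1
  exact Tendsto.if' h2 h1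

/-- Not having met is an open condition, whereas a meeting of the limits may be lost by the
approximations. `H` covers this: either the approximations meet soon afterwards, or the limits stay
together from then on and a missed meeting does no harm. -/
lemma tendsto_merge {ι : Type*} {l : Filter ι} {P Q : ι → WebPath} {p q : WebPath}
    (hP : Tendsto P l (𝓝 p)) (hQ : Tendsto Q l (𝓝 q)) (hp : p.start ≠ ⊥)
    (H : ∀ s, Meets p q s → (∀ t > s, ∀ᶠ n in l, Meets (P n) (Q n) t) ∨ ∀ t ≥ s, p t = q t) :
    Tendsto (fun n => merge (P n) (Q n)) l (𝓝 (merge p q)) := by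
  rw [tendsto_iff]
  refine ⟨(tendsto_iff.mp hP).1, fun t => ?_⟩
  by_cases hm : Meets p q t
  · rw [merge_of_meets hm]
    obtain ⟨τ, hτ, hτm, hτf⟩ := exists_first_meet hp hm
    rcases hτ.eq_or_lt with rfl | hlt
    · exact tendsto_merge_of_eq hP hQ hτm.2.2
    rcases H τ ⟨τ, le_rfl, hτm⟩ with h | h
    · obtain ⟨u, hu1, hu2⟩ := exists_between hlt
      refine ((tendsto_iff.mp hQ).2 t).congr' ?_
      filter_upwards [(h u hu1).prod_mk (eventually_gt_nhds hu2)] with z hz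
      rw [merge_of_meets (hz.1.mono hz.2.le)]
    · exact tendsto_merge_of_eq hP hQ (h t hlt.le)
  · rw [merge_of_not_meets hm]
    -- The first meeting time is attained, so not having met by `t` leaves room after `t`. That room
    -- is needed because convergence is tested at all times near `t`.
    have h1 : ∃ t' > t, ¬ Meets p q t' := by
      by_contra hc
      push Not at hc
      obtain ⟨τ, -, hτm, hτf⟩ := exists_first_meet hp (hc (t + 1) (by linarith))
      have : t < τ := lt_of_not_ge fun h => hm ⟨τ, h, hτm⟩
      obtain ⟨u, hu1, hu2⟩ := exists_between this
      exact hτf u hu2 (hc u hu1)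
    obtain ⟨t', ht', hnm⟩ := h1
    have h2 : ∀ᶠ n in l, ¬ Meets (P n) (Q n) t' := by
      obtain ⟨a, ha⟩ : ∃ a : ℝ, (a : EReal) < p.start := by
        obtain ⟨a, -, ha⟩ := EReal.lt_iff_exists_real_btwn.mp (bot_lt_iff_ne_bot.mpr hp)
        exact ⟨a, ha⟩
      have hc : (p, q) ∈ {z : WebPath × WebPath | ∃ s ∈ Set.Icc a t', s ∈ meetSet z.1 z.2}ᶜ := by
        rintro ⟨s, hs, h⟩
        exact hnm ⟨s, hs.2, h⟩
      have h3 := (hP.prodMk_nhds hQ).eventually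
        ((isClosed_setOf_exists_meet a t').isOpen_compl.mem_nhds hc)
      have h4 := ((continuous_start.tendsto p).comp hP).eventually_const_lt ha
      filter_upwards [h3, h4] with n hn1 hn2
      rintro ⟨s, hs, h⟩
      refine hn1 ⟨s, ⟨?_, hs⟩, h⟩
      exact_mod_cast (hn2.trans_le h.1).le
    refine ((tendsto_iff.mp hP).2 t).congr' ?_
    filter_upwards [h2.prod_mk (eventually_lt_nhds ht')] with z hz
    rw [merge_of_not_meets fun h => hz.1 (h.mono hz.2.le)]

/-- Merge `w` successively into the first `k` paths `Z`. -/
def foldMerge (Z : ℕ → WebPath) (w : WebPath) : ℕ → WebPath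
  | 0 => w
  | k + 1 => merge (foldMerge Z w k) (Z k)

@[simp] lemma foldMerge_start (Z : ℕ → WebPath) (w : WebPath) (k : ℕ) :
    (foldMerge Z w k).start = w.start := by
  induction k with
  | zero => rfl
  | succ k ih => exact ih

lemma foldMerge_congr {Z Z' : ℕ → WebPath} (w : WebPath) {k : ℕ} (h : ∀ i < k, Z i = Z' i) :
    foldMerge Z w k = foldMerge Z' w k := by
  induction k with
  | zero => rfl
  | succ k ih =>
    rw [foldMerge, foldMerge, ih fun i hi => h i (hi.trans (Nat.lt_succ_self k)),
      h k (Nat.lt_succ_self k)]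

lemma foldMerge_of_le_start (Z : ℕ → WebPath) {w : WebPath} (k : ℕ) {t : ℝ}
    (ht : (t : EReal) ≤ w.start) : foldMerge Z w k t = w t := by
  induction k with
  | zero => rfl
  | succ k ih => rw [foldMerge, merge_of_le_start (by simpa using ht), ih]

lemma foldMerge_of_not_meets {Z : ℕ → WebPath} {w : WebPath} {k : ℕ} {t : ℝ}
    (h : ∀ i < k, ¬ Meets w (Z i) t) : foldMerge Z w k t = w t := by
  induction k generalizing t with
  | zero => rfl
  | succ k ih =>
    have h' : ∀ s ≤ t, foldMerge Z w k s = w s := fun s hs =>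
      ih fun i hi hm => h i (hi.trans (Nat.lt_succ_self k)) (hm.mono hs)
    rw [foldMerge, merge_of_not_meets, h' t le_rfl]
    rintro ⟨s, hs, h1, h2, h3⟩
    rw [h' s hs] at h3
    exact h k (Nat.lt_succ_self k) ⟨s, hs, by simpa using h1, h2, h3⟩

/-- Once `w` has joined `Z i`, a merge into another `Z i'` changes nothing because `Z i` and `Z i'`
stick together when they meet. So the order of the merges, and the choice among several paths met at
the same time, do not matter. -/
lemma foldMerge_of_first {Z : ℕ → WebPath} {w : WebPath} {k : ℕ}
    (hZ : ∀ i < k, ∀ i' < k, Sticky (Z i) (Z i')) {i : ℕ} (hi : i < k) {s t : ℝ} (hst : s ≤ t)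
    (hm : s ∈ meetSet w (Z i)) (hf : ∀ i' < k, ∀ s' < s, ¬ Meets w (Z i') s') :
    foldMerge Z w k t = Z i t := by
  induction k generalizing i t with
  | zero => simp at hi
  | succ k ih =>
    have hk := Nat.lt_succ_self k
    have hZ' : ∀ i < k, ∀ i' < k, Sticky (Z i) (Z i') := fun i hi i' hi' =>
      hZ i (hi.trans hk) i' (hi'.trans hk)
    have hf' : ∀ i' < k, ∀ s' < s, ¬ Meets w (Z i') s' := fun i' hi' => hf i' (hi'.trans hk)
    have hbefore : ∀ r < s, foldMerge Z w k r = w r := fun r hr =>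
      foldMerge_of_not_meets fun i' hi' => hf' i' hi' r hr
    rcases Nat.lt_succ_iff_lt_or_eq.mp hi with hik | rfl
    · have hu : ∀ t, s ≤ t → foldMerge Z w k t = Z i t := fun t ht => ih hZ' hik ht hm hf'
      rw [foldMerge]
      by_cases h : Meets (foldMerge Z w k) (Z k) t
      · rw [merge_of_meets h]
        obtain ⟨r, hr, h1, h2, h3⟩ := h
        rcases lt_or_ge r s with hrs | hrs
        · rw [hbefore r hrs] at h3
          exact absurd ⟨r, le_rfl, by simpa using h1, h2, h3⟩ (hf k hk r hrs)
        · rw [hu r hrs] at h3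
          refine (hZ i hi k hk r ⟨hm.2.1.trans (by exact_mod_cast hrs), h2, h3⟩ t hr).symm
      · rw [merge_of_not_meets h, hu t hst]
    · rw [foldMerge, merge_of_meets]
      refine ⟨s, hst, by simpa using hm.1, hm.2.1, ?_⟩
      rw [← hm.2.2]
      by_cases hex : ∃ i' < i, s ∈ meetSet w (Z i')
      · obtain ⟨i', hi', hm'⟩ := hex
        rw [ih hZ' hi' le_rfl hm' hf', ← hm'.2.2]
      · refine foldMerge_of_not_meets fun i' hi' => ?_
        rintro ⟨r, hr, hm'⟩
        rcases hr.eq_or_lt with rfl | hr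
        · exact hex ⟨i', hi', hm'⟩
        · exact hf' i' hi' r hr ⟨r, le_rfl, hm'⟩

/-! ### Coalescence of a sequence of paths -/

/-- The coalescence of the paths `w`: path `j` follows `w j` until it meets one of the
coalesced paths with lower label, and then follows that path. -/
def coal (w : ℕ → WebPath) (j : ℕ) : WebPath :=
  -- The value `default` is never read, since the fold only uses labels below `j`; the test on `i`
  -- makes the recursion well founded.
  foldMerge (fun i => if _h : i < j then coal w i else default) (w j) j

lemma coal_eq (w : ℕ → WebPath) (j : ℕ) : coal w j = foldMerge (coal w) (w j) j := by
  rw [coal]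
  exact foldMerge_congr _ fun i hi => by simp [hi]

@[simp] lemma coal_start (w : ℕ → WebPath) (j : ℕ) : (coal w j).start = (w j).start := by
  rw [coal_eq, foldMerge_start]

lemma coal_of_le_start {w : ℕ → WebPath} {j : ℕ} {t : ℝ} (ht : (t : EReal) ≤ (w j).start) :
    coal w j t = w j t := by
  rw [coal_eq, foldMerge_of_le_start _ _ ht]

lemma coal_zero (w : ℕ → WebPath) : coal w 0 = w 0 := by
  rw [coal_eq, foldMerge]

lemma coal_congr {w w' : ℕ → WebPath} {j : ℕ} (h : ∀ i ≤ j, w i = w' i) :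
    coal w j = coal w' j := by
  induction j using Nat.strong_induction_on with
  | _ j ih =>
    rw [coal_eq, coal_eq, h j le_rfl]
    exact foldMerge_congr _ fun i hi => ih i hi fun k hk => h k (hk.trans hi.le)

lemma measurable_coal (j : ℕ) : Measurable fun w : ℕ → WebPath => coal w j := by
  induction j using Nat.strong_induction_on with
  | _ j ih =>
    have : ∀ k ≤ j, Measurable fun w : ℕ → WebPath => foldMerge (coal w) (w j) k := by
      intro k
      induction k with
      | zero => intro _; exact measurable_pi_apply j
      | succ k ihk =>
        intro hk
        exact measurable_merge.comp ((ihk (by omega)).prodMk (ih k (by omega)))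
    simp_rw [coal_eq _ j]
    exact this j le_rfl

/-- First time at which `w` meets one of `k` paths. -/
lemma exists_first_meet_family {Z : ℕ → WebPath} {w : WebPath} {k : ℕ} {t : ℝ}
    (hw : w.start ≠ ⊥) (h : ∃ i < k, Meets w (Z i) t) :
    ∃ i < k, ∃ τ ≤ t, τ ∈ meetSet w (Z i) ∧ ∀ i' < k, ∀ s < τ, ¬ Meets w (Z i') s := by
  classical
  let F := (Finset.range k).filter fun i => Meets w (Z i) t
  have hF : ∀ i ∈ F, ∃ τ ≤ t, τ ∈ meetSet w (Z i) ∧ ∀ s < τ, ¬ Meets w (Z i) s := fun i hi =>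
    exists_first_meet hw (Finset.mem_filter.mp hi).2
  choose! τ hτ1 hτ2 hτ3 using hF
  have hne : F.Nonempty := by
    obtain ⟨i, hi, hm⟩ := h
    exact ⟨i, by simp [F, hi, hm]⟩
  obtain ⟨i, hi, hmin⟩ := F.exists_min_image τ hne
  have hik : i < k := by simpa using (Finset.mem_filter.mp hi).1
  refine ⟨i, hik, τ i, hτ1 i hi, hτ2 i hi, fun i' hi' s hs hm => ?_⟩
  have hi'F : i' ∈ F := by
    simp only [F, Finset.mem_filter, Finset.mem_range]
    exact ⟨hi', hm.mono (hs.le.trans (hτ1 i hi))⟩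
  exact hτ3 i' hi'F s (hs.trans_le (hmin i' hi'F)) hm

/-- Strong induction on the larger label `j`. If `w j` has met a lower coalesced path by time `s`,
then `coal w j` follows that path and the claim is one about lower labels. Otherwise `coal w j` is
still `w j` at time `s`, and a meeting with `coal w i` there would be a meeting of `w j` after all.
-/
lemma coal_sticky {w : ℕ → WebPath} (hw : ∀ j, (w j).start ≠ ⊥) (i j : ℕ) :
    Sticky (coal w i) (coal w j) := by
  suffices h : ∀ j, ∀ i ≤ j, Sticky (coal w i) (coal w j) by
    rcases le_total i j with hij | hij
    · exact h j i hij
    · exact (h i j hij).symm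
  intro j
  induction j using Nat.strong_induction_on with
  | _ j ih =>
    intro i hij
    rcases hij.eq_or_lt with rfl | hij
    · exact sticky_self _
    have hst : ∀ a < j, ∀ b < j, Sticky (coal w a) (coal w b) := by
      intro a ha b hb
      rcases le_total a b with hab | hab
      · exact ih b hb a hab
      · exact (ih a ha b hab).symm
    intro s hs t hst'
    by_cases hex : ∃ i' < j, Meets (w j) (coal w i') s
    · obtain ⟨l, hl, τ, hτ, hτm, hτf⟩ := exists_first_meet_family (hw j) hex
      have hj : ∀ u, τ ≤ u → coal w j u = coal w l u := fun u hu => by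
        rw [coal_eq w j]
        exact foldMerge_of_first hst hl hu hτm hτf
      rw [hj t (hτ.trans hst')]
      refine hst i hij l hl s ⟨hs.1, hτm.2.1.trans (by exact_mod_cast hτ), ?_⟩ t hst'
      rw [← hj s hτ, hs.2.2]
    · push Not at hex
      exfalso
      have h1 : coal w j s = w j s := by
        rw [coal_eq w j]
        exact foldMerge_of_not_meets hex
      refine hex i hij ⟨s, le_rfl, by simpa using hs.2.1, hs.1, ?_⟩
      rw [← h1, hs.2.2]

/-- Each value of a coalesced path is traced back to an uncoalesced path that has already started.
Almost sure properties of single Brownian paths, such as finiteness and avoidance of points, thus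
carry over. -/
lemma exists_coal_eq (w : ℕ → WebPath) (j : ℕ) {t : ℝ} (ht : (w j).start < t) :
    ∃ l ≤ j, (w l).start < t ∧ coal w j t = w l t := by
  induction j using Nat.strong_induction_on with
  | _ j ih =>
    have : ∀ k ≤ j, ∃ l ≤ j, (w l).start < t ∧ foldMerge (coal w) (w j) k t = w l t := by
      intro k
      induction k with
      | zero => intro _; exact ⟨j, le_rfl, ht, rfl⟩
      | succ k ihk =>
        intro hk
        rcases merge_eq_or (foldMerge (coal w) (w j) k) (coal w k) t with h | ⟨h1, h2⟩
        · obtain ⟨l, hl, hl1, hl2⟩ := ihk (by omega)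
          exact ⟨l, hl, hl1, by rw [foldMerge, h, hl2]⟩
        · obtain ⟨l, hl, hl1, hl2⟩ := ih k (by omega) (by simpa using h1)
          exact ⟨l, by omega, hl1, by rw [foldMerge, h2, hl2]⟩
    rw [coal_eq]
    exact this j le_rfl

/-! ### Stability of coalescence under convergence of the paths -/

/-- At their first meeting the two paths go through each other. -/
def Transversal (p q : WebPath) : Prop :=
  ∀ τ ∈ meetSet p q, (∀ s < τ, ¬ Meets p q s) → ∀ t > τ,
    ∃ a b : ℝ, p.start < a ∧ q.start < a ∧ p.start < b ∧ q.start < b ∧ a < t ∧ b < t ∧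
      p a < q a ∧ q b < p b

/-- The strict inequalities at times `a` and `b` persist for nearby paths, and the intermediate
value theorem gives a meeting between these times. -/
lemma eventually_meets {ι : Type*} {l : Filter ι} {P Q : ι → WebPath} {p q : WebPath}
    (hP : Tendsto P l (𝓝 p)) (hQ : Tendsto Q l (𝓝 q)) {a b t : ℝ} (ha1 : p.start < a)
    (ha2 : q.start < a) (hb1 : p.start < b) (hb2 : q.start < b) (hat : a < t) (hbt : b < t)
    (ha : p a < q a) (hb : q b < p b) : ∀ᶠ n in l, Meets (P n) (Q n) t := by
  have e1 : ∀ u : ℝ, Tendsto (fun n => P n u) l (𝓝 (p u)) := fun u =>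
    ((continuous_eval u).tendsto p).comp hP
  have e2 : ∀ u : ℝ, Tendsto (fun n => Q n u) l (𝓝 (q u)) := fun u =>
    ((continuous_eval u).tendsto q).comp hQ
  have s1 := (continuous_start.tendsto p).comp hP
  have s2 := (continuous_start.tendsto q).comp hQ
  filter_upwards [(e1 a).eventually_lt (e2 a) ha, (e2 b).eventually_lt (e1 b) hb,
    s1.eventually_lt_const ha1, s1.eventually_lt_const hb1, s2.eventually_lt_const ha2,
    s2.eventually_lt_const hb2] with n h1 h2 h3 h4 h5 h6
  obtain ⟨c, hc, hceq⟩ := (isPreconnected_uIcc (a := a) (b := b)).intermediate_value₂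
    Set.left_mem_uIcc Set.right_mem_uIcc (P n).toMap.continuous.continuousOn
    (Q n).toMap.continuous.continuousOn h1.le h2.le
  rw [Set.mem_uIcc] at hc
  refine ⟨c, ?_, ?_, ?_, hceq⟩
  · rcases hc with hc | hc <;> linarith
  · rcases hc with hc | hc
    · exact h3.le.trans (by exact_mod_cast hc.1)
    · exact h4.le.trans (by exact_mod_cast hc.1)
  · rcases hc with hc | hc
    · exact h5.le.trans (by exact_mod_cast hc.1)
    · exact h6.le.trans (by exact_mod_cast hc.1)

/-- The two paths start at the same space-time point. -/
def SameStart (p q : WebPath) : Prop := p.start = q.start ∧ ∀ t : ℝ, p.start = t → p t = q t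

/-- Coalescence is built from merges, and a merge is continuous unless a meeting of the limits can
be perturbed away. Transversal meetings cannot be. Paths with a common starting point meet there,
for every index. -/
theorem tendsto_coal {ι : Type*} {l : Filter ι} {wn : ι → ℕ → WebPath} {w : ℕ → WebPath} {m : ℕ}
    (hbot : ∀ j, (w j).start ≠ ⊥) (hreal : ∀ n j, ∃ r : ℝ, (wn n j).start = r)
    (hconv : ∀ j < m, Tendsto (fun n => wn n j) l (𝓝 (w j)))
    (htr : ∀ j < m, ∀ i < j, (∀ᶠ n in l, SameStart (wn n i) (wn n j)) ∨
      Transversal (w j) (coal w i)) :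
    ∀ j < m, Tendsto (fun n => coal (wn n) j) l (𝓝 (coal w j)) := by
  intro j
  induction j using Nat.strong_induction_on with
  | _ j ih =>
    intro hjm
    have key : ∀ k ≤ j, Tendsto (fun n => foldMerge (coal (wn n)) (wn n j) k) l
        (𝓝 (foldMerge (coal w) (w j) k)) := by
      intro k
      induction k with
      | zero => intro _; exact hconv j hjm
      | succ k ihk =>
        intro hk
        have hu := ihk (by omega)
        have hz := ih k (by omega) (by omega)
        refine tendsto_merge hu hz (by simpa using hbot j) fun s hs => ?_
        rcases htr j hjm k (by omega) with hsame | htrans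
        · left
          intro t ht
          have hst : (w j).start < t := by
            obtain ⟨r, hr, h1, -, -⟩ := hs
            rw [foldMerge_start] at h1
            exact h1.trans_lt (by exact_mod_cast hr.trans_lt ht)
          filter_upwards [hsame, ((continuous_start.tendsto _).comp
            (hconv j hjm)).eventually_lt_const hst] with n hn1 hn2
          obtain ⟨r, hr⟩ := hreal n j
          refine ⟨r, ?_, ?_, ?_, ?_⟩
          · simp only [Function.comp, hr] at hn2
            exact_mod_cast hn2.le
          · rw [foldMerge_start, hr]
          · rw [coal_start, hn1.1, hr]
          · rw [foldMerge_of_le_start _ _ hr.ge, coal_of_le_start (by rw [hn1.1, hr]),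
              hn1.2 r (by rw [hn1.1, hr])]
        · obtain ⟨τ, hτs, hτm, hτf⟩ := exists_first_meet (by simpa using hbot j) hs
          -- The question is whether `w j` has already been absorbed by a lower path when the merged
          -- path meets `coal w k`. If so, stickiness keeps the two together from then on; if not,
          -- the merged path is still `w j` and transversality applies.
          by_cases hex : ∃ i < k, Meets (w j) (coal w i) τ
          · right
            obtain ⟨i, hi, σ, hσ, hσm, hσf⟩ := exists_first_meet_family (hbot j) hex
            have hst := fun a (_ : a < k) b (_ : b < k) => coal_sticky hbot a b
            intro t ht
            have hσu : ∀ u, σ ≤ u → foldMerge (coal w) (w j) k u = coal w i u := fun u hu =>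
              foldMerge_of_first hst hi hu hσm hσf
            rw [hσu t (by linarith)]
            refine coal_sticky hbot i k τ ⟨?_, hτm.2.1, ?_⟩ t (by linarith)
            · exact hσm.2.1.trans (by exact_mod_cast hσ)
            · rw [← hσu τ hσ, hτm.2.2]
          · left
            push Not at hex
            -- `w j` has not met the first `k` paths slightly after `τ`
            have hlate : ∃ σ > τ, ∀ i < k, ¬ Meets (w j) (coal w i) σ := by
              by_contra hc
              push Not at hc
              obtain ⟨i, hi, σ, hσ, hσm, hσf⟩ := exists_first_meet_family (hbot j)
                (hc (τ + 1) (by linarith))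
              have hlt : τ < σ := lt_of_not_ge fun h => hex i hi ⟨σ, h, hσm⟩
              obtain ⟨u, hu1, hu2⟩ := exists_between hlt
              obtain ⟨i', hi', hm'⟩ := hc u hu1
              exact hσf i' hi' u hu2 hm'
            obtain ⟨σ, hσ, hσf⟩ := hlate
            have heq : ∀ u ≤ σ, foldMerge (coal w) (w j) k u = w j u := fun u hu =>
              foldMerge_of_not_meets fun i hi hm => hσf i hi (hm.mono hu)
            have hm' : τ ∈ meetSet (w j) (coal w k) :=
              ⟨by simpa using hτm.1, hτm.2.1, by rw [← heq τ hσ.le, hτm.2.2]⟩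
            have hf' : ∀ s < τ, ¬ Meets (w j) (coal w k) s := by
              rintro s hs ⟨r, hr, h1, h2, h3⟩
              refine hτf s hs ⟨r, hr, by simpa using h1, h2, ?_⟩
              rw [heq r (by linarith), h3]
            intro t ht
            -- The witnesses must lie before `σ`, where the merged path is still `w j`.
            have ht' : τ < min t σ := lt_min (by linarith) hσ
            obtain ⟨a, b, h1, h2, h3, h4, h5, h6, h7, h8⟩ := htrans τ hm' hf' _ ht'
            have haσ : a ≤ σ := h5.le.trans (min_le_right _ _)
            have hbσ : b ≤ σ := h6.le.trans (min_le_right _ _)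
            refine eventually_meets hu hz (a := a) (b := b) (by simpa using h1) h2
              (by simpa using h3) h4 (h5.trans_le (min_le_left _ _))
              (h6.trans_le (min_le_left _ _)) ?_ ?_
            · rwa [heq a haσ]
            · rwa [heq b hbσ]
    simp_rw [coal_eq _ j]
    exact key j le_rfl

/-! ### Coalescence in the sense of the definition -/

lemma mem_meetingTimes_iff {m : ℕ} {y : Fin m → ℝ × ℝ} {W : Fin m → ℝ → ℝ} {w Z : ℕ → WebPath}
    (hst : ∀ j : Fin m, (w j).start = ((y j).2 : EReal))
    (hw : ∀ j : Fin m, ∀ t : ℝ, (y j).2 ≤ t → w j t = (W j t : EReal))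
    (hZ : ∀ j : Fin m, (Z j).start = ((y j).2 : EReal)) {j : Fin m} {s : ℝ} :
    s ∈ meetingTimes y W (fun i => Z i) j ↔ ∃ i < (j : ℕ), s ∈ meetSet (w j) (Z i) := by
  constructor
  · rintro ⟨h1, i, hi, h2, h3⟩
    refine ⟨i, hi, ?_, ?_, ?_⟩
    · rw [hst]; exact_mod_cast h1
    · rw [hZ]; exact_mod_cast h2
    · rw [hw j s h1, h3]
  · rintro ⟨i, hi, h1, h2, h3⟩
    have hi' : i < m := hi.trans j.2
    have h2' := hZ ⟨i, hi'⟩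
    simp only at h2'
    rw [h2'] at h2
    rw [hst] at h1
    have h1' : (y j).2 ≤ s := by exact_mod_cast h1
    refine ⟨h1', ⟨i, hi'⟩, hi, by exact_mod_cast h2, ?_⟩
    rw [← hw j s h1', h3]

theorem isCoalescence_coal {m : ℕ} {y : Fin m → ℝ × ℝ} {W : Fin m → ℝ → ℝ} {w : ℕ → WebPath}
    (hbot : ∀ j, (w j).start ≠ ⊥) (hst : ∀ j : Fin m, (w j).start = ((y j).2 : EReal))
    (hw : ∀ j : Fin m, ∀ t : ℝ, (y j).2 ≤ t → w j t = (W j t : EReal)) :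
    IsCoalescence y W fun j : Fin m => coal w j := by
  have hZ : ∀ j : Fin m, (coal w j).start = ((y j).2 : EReal) := fun j => by
    rw [coal_start, hst]
  have hsticky := fun k a (_ : a < k) b (_ : b < k) => coal_sticky hbot a b
  refine ⟨hZ, fun j t ht hlow => ?_, fun j τ hτ i hi t ht => ?_⟩
  · have hno : ∀ i < (j : ℕ), ∀ s < t, ¬ Meets (w j) (coal w i) s := by
      rintro i hi s hs ⟨r, hr, hm⟩
      have := hlow ((mem_meetingTimes_iff hst hw hZ).mpr ⟨i, hi, hm⟩)
      linarith
    rw [← hw j t ht]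
    by_cases hex : ∃ i < (j : ℕ), t ∈ meetSet (w j) (coal w i)
    · obtain ⟨i, hi, hm⟩ := hex
      rw [coal_eq w j, foldMerge_of_first (hsticky j) hi le_rfl hm hno, hm.2.2]
    · rw [coal_eq w j]
      refine foldMerge_of_not_meets ?_
      rintro i hi ⟨r, hr, hm⟩
      rcases hr.eq_or_lt with rfl | hr
      · exact hex ⟨i, hi, hm⟩
      · exact hno i hi r hr ⟨r, le_rfl, hm⟩
  · obtain ⟨hij, h1, h2⟩ := hi.1
    have hτj : (y j).2 ≤ τ := hτ.1.1
    rw [coal_eq w j]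
    refine foldMerge_of_first (hsticky j) hij ht ⟨?_, ?_, ?_⟩ ?_
    · rw [hst]; exact_mod_cast hτj
    · rw [hZ]; exact_mod_cast h1
    · rw [h2, hw j τ hτj]
    · rintro i' hi' s hs ⟨r, hr, hm⟩
      have := hτ.2 ((mem_meetingTimes_iff hst hw hZ).mpr ⟨i', hi', hm⟩)
      linarith

/-- The coalescing rule determines path `j` from the paths with lower labels, so induction
identifies it with `coal w j`. Coalescing Brownian motions are thereby a fixed measurable function
of independent ones. -/
theorem IsCoalescence.eq_coal {m : ℕ} {y : Fin m → ℝ × ℝ} {W : Fin m → ℝ → ℝ} {w : ℕ → WebPath}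
    {Z : Fin m → WebPath} (hbot : ∀ j, (w j).start ≠ ⊥)
    (hst : ∀ j : Fin m, (w j).start = ((y j).2 : EReal))
    (hw : ∀ j : Fin m, ∀ t : ℝ, (y j).2 ≤ t → w j t = (W j t : EReal))
    (h : IsCoalescence y W Z) (j : Fin m) : Z j = coal w j := by
  have hc := isCoalescence_coal hbot hst hw
  obtain ⟨j, hj⟩ := j
  induction j using Nat.strong_induction_on with
  | _ j ih =>
    have ih' : ∀ i : Fin m, i < ⟨j, hj⟩ → Z i = coal w i := fun i hi => ih i hi i.2
    have hmt : meetingTimes y W Z ⟨j, hj⟩ = meetingTimes y W (fun i => coal w i) ⟨j, hj⟩ := by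
      ext s
      constructor
      · rintro ⟨h1, i, hi, h2, h3⟩
        exact ⟨h1, i, hi, h2, by rw [← h3, ih' i hi]⟩
      · rintro ⟨h1, i, hi, h2, h3⟩
        exact ⟨h1, i, hi, h2, by rw [← h3, ih' i hi]⟩
    have hZ : ∀ j : Fin m, (coal w j).start = ((y j).2 : EReal) := fun j => by
      rw [coal_start, hst]
    have hafter : ∀ t : ℝ, (y ⟨j, hj⟩).2 ≤ t → Z ⟨j, hj⟩ t = coal w j t := by
      intro t ht
      by_cases hlow : t ∈ lowerBounds (meetingTimes y W Z ⟨j, hj⟩)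
      · rw [h.before ⟨j, hj⟩ t ht hlow]
        rw [hmt] at hlow
        exact (hc.before ⟨j, hj⟩ t ht hlow).symm
      · have hex : ∃ i < j, Meets (w j) (coal w i) t := by
          simp only [lowerBounds, Set.mem_ofPred_eq, not_forall, not_le] at hlow
          obtain ⟨s, hs, hst'⟩ := hlow
          rw [hmt] at hs
          obtain ⟨i, hi, hm⟩ := (mem_meetingTimes_iff hst hw hZ).mp hs
          exact ⟨i, hi, s, hst'.le, hm⟩
        obtain ⟨i, hi, τ, hτ, hτm, hτf⟩ := exists_first_meet_family (hbot j) hex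
        have hleast : IsLeast (meetingTimes y W (fun i => coal w i) ⟨j, hj⟩) τ := by
          refine ⟨(mem_meetingTimes_iff hst hw hZ).mpr ⟨i, hi, hτm⟩, fun s hs => ?_⟩
          obtain ⟨i', hi', hm⟩ := (mem_meetingTimes_iff hst hw hZ).mp hs
          exact le_of_not_gt fun hlt => hτf i' hi' s hlt ⟨s, le_rfl, hm⟩
        set S := {i : Fin m | i < ⟨j, hj⟩ ∧ (y i).2 ≤ τ ∧ coal w i τ = (W ⟨j, hj⟩ τ : EReal)}
          with hS
        have hne : S.Nonempty := by
          obtain ⟨-, i, hi, h2, h3⟩ := hleast.1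
          exact ⟨i, hi, h2, h3⟩
        obtain ⟨i₀, hi₀⟩ : ∃ i₀, IsLeast S i₀ := by
          obtain ⟨i₀, h1, h2⟩ := S.toFinite.exists_minimalFor id S hne
          exact ⟨i₀, h1, fun i hi => (le_total i₀ i).elim id fun h => h2 hi h⟩
        have hS' : {i : Fin m | i < ⟨j, hj⟩ ∧ (y i).2 ≤ τ ∧ Z i τ = (W ⟨j, hj⟩ τ : EReal)} = S := by
          ext i
          constructor
          · rintro ⟨a, b, c⟩
            exact ⟨a, b, by rw [← c, ih' i a]⟩
          · rintro ⟨a, b, c⟩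
            exact ⟨a, b, by rw [← c, ih' i a]⟩
        rw [h.after ⟨j, hj⟩ τ (hmt ▸ hleast) i₀ (hS' ▸ hi₀) t hτ, ih' i₀ hi₀.1.1]
        exact (hc.after ⟨j, hj⟩ τ hleast i₀ hi₀ t hτ).symm
    have hstart : (Z ⟨j, hj⟩).start = (coal w j).start := by
      rw [h.start_eq ⟨j, hj⟩]
      exact (hZ ⟨j, hj⟩).symm
    refine eq_of_start_eq hstart fun t => ?_
    -- Before the starting time both paths are constant, with the value they have at that time.
    rcases le_total (y ⟨j, hj⟩).2 t with ht | ht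
    · exact hafter t ht
    · have h1 : ((t : ℝ) : EReal) ≤ (Z ⟨j, hj⟩).start := by
        rw [h.start_eq]; exact_mod_cast ht
      have h2 : (((y ⟨j, hj⟩).2 : ℝ) : EReal) ≤ (Z ⟨j, hj⟩).start := by rw [h.start_eq]
      rw [(Z ⟨j, hj⟩).const_before _ _ h1 h2, hafter _ le_rfl]
      exact (coal w j).const_before _ _ (hstart ▸ h2) (hstart ▸ h1)

/-! ### Launching a path from a space-time point -/

lemma continuous_add_coe : Continuous fun z : EReal × ℝ => z.1 + (z.2 : EReal) := by
  rw [continuous_iff_continuousAt]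
  rintro ⟨x, r⟩
  have h : ContinuousAt (fun z : EReal × EReal => z.1 + z.2) (x, (r : EReal)) :=
    EReal.continuousAt_add (Or.inr (EReal.coe_ne_bot r)) (Or.inr (EReal.coe_ne_top r))
  exact ContinuousAt.comp (x := (x, r)) (f := fun z : EReal × ℝ => (z.1, (z.2 : EReal))) h
    (continuous_fst.prodMk (continuous_coe_real_ereal.comp continuous_snd)).continuousAt

/-- The path started at `y = (x, t)` with the displacements `p s - 0`, `s ≥ 0`. -/
def launch (y : ℝ × ℝ) (p : WebPath) : WebPath where
  toMap := ⟨fun t => p (max (t - y.2) 0) + (y.1 : EReal), by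
    have h : Continuous fun t : ℝ => (p (max (t - y.2) 0), y.1) :=
      (p.toMap.continuous.comp (by fun_prop)).prodMk continuous_const
    exact continuous_add_coe.comp h⟩
  start := (y.2 : EReal)
  const_before s t hs ht := by
    have hs' : s ≤ y.2 := by exact_mod_cast hs
    have ht' : t ≤ y.2 := by exact_mod_cast ht
    change p (max (s - y.2) 0) + (y.1 : EReal) = p (max (t - y.2) 0) + (y.1 : EReal)
    rw [max_eq_right (by linarith), max_eq_right (by linarith)]

@[simp] lemma launch_start (y : ℝ × ℝ) (p : WebPath) : (launch y p).start = (y.2 : EReal) := rfl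

lemma launch_apply (y : ℝ × ℝ) (p : WebPath) (t : ℝ) :
    launch y p t = p (max (t - y.2) 0) + (y.1 : EReal) := rfl

/-- Joint continuity allows the same random displacements to be launched from converging points,
which is the coupling behind continuity of the coalescing law. -/
lemma continuous_launch : Continuous fun z : (ℝ × ℝ) × WebPath => launch z.1 z.2 := by
  rw [continuous_iff_continuousAt]
  intro z
  rw [ContinuousAt, tendsto_iff]
  constructor
  · exact (continuous_coe_real_ereal.comp
      (continuous_snd.comp continuous_fst : Continuous fun z : (ℝ × ℝ) × WebPath => z.1.2)).tendsto z
  · intro t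
    rw [← nhds_prod_eq]
    have h : Continuous fun v : ((ℝ × ℝ) × WebPath) × ℝ =>
        (v.1.2 (max (v.2 - v.1.1.2) 0), v.1.1.1) := by
      refine Continuous.prodMk ?_ (by fun_prop)
      exact continuous_eval₂.comp (Continuous.prodMk (by fun_prop) (by fun_prop))
    exact (continuous_add_coe.comp h).tendsto (z, t)

lemma measurable_launch (y : ℝ × ℝ) : Measurable (launch y) :=
  (continuous_launch.comp (Continuous.prodMk_right y)).measurable

open Classical in
/-- The path started at time `0` that follows a continuous function. -/
def ofFun (b : ℝ≥0 → ℝ) : WebPath :=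
  if h : Continuous b then
    { toMap := ⟨fun t => ((b t.toNNReal : ℝ) : EReal),
        continuous_coe_real_ereal.comp (h.comp continuous_real_toNNReal)⟩
      start := 0
      const_before := fun s t hs ht => by
        have hs' : s ≤ 0 := by exact_mod_cast hs
        have ht' : t ≤ 0 := by exact_mod_cast ht
        change ((b s.toNNReal : ℝ) : EReal) = ((b t.toNNReal : ℝ) : EReal)
        rw [Real.toNNReal_of_nonpos hs', Real.toNNReal_of_nonpos ht'] }
  -- Reached only on a null event for a Brownian motion; `default` starts at time `0` as well, so
  -- the starting time never depends on continuity.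
  else default

lemma ofFun_apply {b : ℝ≥0 → ℝ} (h : Continuous b) (t : ℝ) :
    ofFun b t = ((b t.toNNReal : ℝ) : EReal) := by
  rw [ofFun, dif_pos h]
  rfl

lemma ofFun_start (b : ℝ≥0 → ℝ) : (ofFun b).start = 0 := by
  unfold ofFun
  split_ifs <;> rfl

lemma coords_ofFun {b : ℝ≥0 → ℝ} (h : Continuous b) :
    coords (ofFun b) = (fun q : ℚ => ((b (q : ℝ).toNNReal : ℝ) : EReal), 0) := by
  rw [coords, ofFun_start]
  simp only [ofFun_apply h]

lemma launch_ofFun {b : ℝ≥0 → ℝ} (h : Continuous b) (y : ℝ × ℝ) (t : ℝ) :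
    launch y (ofFun b) t = ((y.1 + b (t - y.2).toNNReal : ℝ) : EReal) := by
  rw [launch_apply, ofFun_apply h, ← EReal.coe_add, add_comm]
  congr 3
  simp [Real.toNNReal]

end WebPath

/-! ### Estimates for Brownian motion -/

section Brownian

variable {Ω : Type*} {mΩ : MeasurableSpace Ω} {P : Measure Ω} {B : ℝ≥0 → Ω → ℝ}

lemma half_le_gaussianReal_Ici (v : ℝ≥0) : 1 / 2 ≤ gaussianReal 0 v (Set.Ici 0) := by
  have h1 : gaussianReal 0 v (Set.Iic 0) = gaussianReal 0 v (Set.Ici 0) := by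
    have h := gaussianReal_map_neg (μ := 0) (v := v)
    rw [neg_zero] at h
    conv_lhs => rw [← h]
    rw [Measure.map_apply measurable_neg measurableSet_Iic]
    congr 1
    ext x
    simp
  have h2 : (1 : ℝ≥0∞) ≤ gaussianReal 0 v (Set.Ici 0) + gaussianReal 0 v (Set.Ici 0) := by
    calc (1 : ℝ≥0∞) = gaussianReal 0 v Set.univ := measure_univ.symm
      _ ≤ gaussianReal 0 v (Set.Iic 0 ∪ Set.Ici 0) := measure_mono fun x _ => le_total x 0
      _ ≤ _ := (measure_union_le _ _).trans (by rw [h1])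
  rw [← two_mul] at h2
  rw [one_div]
  exact ENNReal.inv_le_iff_le_mul (by simp) (by simp) |>.mpr h2

lemma measure_ge_le_exp_of_hasLaw_gaussianReal [IsProbabilityMeasure P] {X : Ω → ℝ} {v : ℝ≥0}
    (hv : v ≠ 0) (hX : HasLaw X (gaussianReal 0 v) P) {a : ℝ} (ha : 0 ≤ a) :
    P {ω | a ≤ X ω} ≤ ENNReal.ofReal (Real.exp (-a ^ 2 / (2 * v))) := by
  have hv' : (0 : ℝ) < v := by positivity
  have hexpI : Integrable (fun ω => Real.exp (a / v * X ω)) P := by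
    have h : Integrable (fun x : ℝ => Real.exp (a / v * x)) (gaussianReal 0 v) :=
      integrable_exp_mul_gaussianReal _
    rw [← hX.map_eq] at h
    exact h.comp_aemeasurable hX.aemeasurable
  -- Chernoff's bound with the optimal parameter `a / v`.
  have h := measure_ge_le_exp_mul_mgf (X := X) (μ := P) (t := a / v) a (by positivity) hexpI
  rw [mgf_gaussianReal hX.map_eq, ← Real.exp_add] at h
  rw [← ofReal_measureReal]
  refine ENNReal.ofReal_le_ofReal (h.trans (Real.exp_le_exp.mpr (le_of_eq ?_)))
  field_simp
  ring

/-- Decompose according to the first index `k` at which the level `a` is reached. The increment from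
`t k` to `t n` is independent of the past and nonnegative with probability at least `1/2`, in which
case the level is still exceeded at the final time. -/
lemma levy_maximal_discrete [IsProbabilityMeasure P] (hB : IsPreBrownianReal B P)
    {t : ℕ → ℝ≥0} (ht : Monotone t) (n : ℕ) (a : ℝ) :
    P {ω | ∃ k ≤ n, a ≤ B (t k) ω} ≤ 2 * P {ω | a ≤ B (t n) ω} := by
  have hm : ∀ u, NullMeasurableSet {ω | a ≤ B u ω} P := fun u =>
    nullMeasurableSet_le aemeasurable_const (hB.aemeasurable u)
  let A : ℕ → Set Ω := fun k => {ω | a ≤ B (t k) ω ∧ ∀ i < k, B (t i) ω < a}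
  let C : ℕ → Set Ω := fun k => {ω | 0 ≤ B (t n) ω - B (t k) ω}
  have hAm : ∀ k, NullMeasurableSet (A k) P := by
    intro k
    have : A k = {ω | a ≤ B (t k) ω} ∩ ⋂ i ∈ Finset.range k, {ω | a ≤ B (t i) ω}ᶜ := by
      ext ω
      simp [A]
    rw [this]
    exact (hm _).inter (NullMeasurableSet.biInter (Finset.countable_toSet _) fun i _ => (hm _).compl)
  have hCm : ∀ k, NullMeasurableSet (C k) P := fun k =>
    nullMeasurableSet_le aemeasurable_const ((hB.aemeasurable _).sub (hB.aemeasurable _))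
  have hdisj : ∀ i j, i < j → Disjoint (A i) (A j) := by
    intro i j hij
    rw [Set.disjoint_left]
    rintro ω ⟨h1, -⟩ ⟨-, h2⟩
    exact absurd (h2 i hij) (not_lt.mpr h1)
  have hcover : {ω | ∃ k ≤ n, a ≤ B (t k) ω} ⊆ ⋃ k ∈ Finset.range (n + 1), A k := by
    intro ω hω
    classical
    have hex : ∃ k, a ≤ B (t k) ω := by
      obtain ⟨k, -, hk⟩ := hω
      exact ⟨k, hk⟩
    obtain ⟨k, hkn, hk⟩ := hω
    simp only [Set.mem_iUnion, Finset.mem_range]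
    refine ⟨Nat.find hex, ?_, Nat.find_spec hex, fun i hi => not_le.mp (Nat.find_min hex hi)⟩
    exact Nat.lt_succ_of_le ((Nat.find_min' hex hk).trans hkn)
  have hstep : ∀ k ∈ Finset.range (n + 1), P (A k) ≤ 2 * P (A k ∩ C k) := by
    intro k hk
    have hkn : k ≤ n := Nat.lt_succ_iff.mp (Finset.mem_range.mp hk)
    have hind := hB.indepFun_shift (t k)
    let S : Set (Set.Iic (t k) → ℝ) := {f | a ≤ f ⟨t k, Set.mem_Iic.mpr le_rfl⟩ ∧
      ∀ i : Fin k, f ⟨t i, Set.mem_Iic.mpr (ht i.2.le)⟩ < a}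
    have hS : MeasurableSet S := by
      refine MeasurableSet.inter ?_ ?_
      · exact measurableSet_le measurable_const (measurable_pi_apply _)
      · change MeasurableSet {f : Set.Iic (t k) → ℝ | ∀ i : Fin k, f ⟨t i, Set.mem_Iic.mpr (ht i.2.le)⟩ < a}
        simp only [Set.ofPred_forall]
        exact MeasurableSet.iInter fun i =>
          measurableSet_lt (measurable_pi_apply _) measurable_const
    let T : Set (ℝ≥0 → ℝ) := {f | 0 ≤ f (t n - t k)}
    have hT : MeasurableSet T := measurableSet_le measurable_const (measurable_pi_apply _)
    have hAS : A k = (fun ω (u : Set.Iic (t k)) => B u ω) ⁻¹' S := by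
      ext ω
      constructor
      · rintro ⟨h1, h2⟩
        exact ⟨h1, fun i => h2 i i.2⟩
      · rintro ⟨h1, h2⟩
        exact ⟨h1, fun i hi => h2 ⟨i, hi⟩⟩
    have hCT : C k = (fun ω (u : ℝ≥0) => B (t k + u) ω - B (t k) ω) ⁻¹' T := by
      ext ω
      change 0 ≤ B (t n) ω - B (t k) ω ↔ 0 ≤ B (t k + (t n - t k)) ω - B (t k) ω
      rw [add_tsub_cancel_of_le (ht hkn)]
    have h1 := hind.measure_inter_preimage_eq_mul T S hT hS
    rw [← hAS, ← hCT] at h1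
    have h2 : 1 / 2 ≤ P (C k) := by
      have hl := hB.hasLaw_sub (t n) (t k)
      have : P (C k) = gaussianReal 0 (nndist (t n).1 (t k).1) (Set.Ici 0) := by
        rw [← hl.map_eq, Measure.map_apply_of_aemeasurable hl.aemeasurable measurableSet_Ici]
        rfl
      rw [this]
      exact half_le_gaussianReal_Ici _
    rw [Set.inter_comm, h1, ← mul_assoc]
    calc P (A k) = 1 * P (A k) := (one_mul _).symm
      _ ≤ 2 * P (C k) * P (A k) := by
        gcongr
        calc (1 : ℝ≥0∞) = 2 * (1 / 2) := by
              rw [one_div, ENNReal.mul_inv_cancel (by simp) (by simp)]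
          _ ≤ 2 * P (C k) := by gcongr
  calc P {ω | ∃ k ≤ n, a ≤ B (t k) ω}
      ≤ P (⋃ k ∈ Finset.range (n + 1), A k) := measure_mono hcover
    _ ≤ ∑ k ∈ Finset.range (n + 1), P (A k) := measure_biUnion_finset_le _ _
    _ ≤ ∑ k ∈ Finset.range (n + 1), 2 * P (A k ∩ C k) := Finset.sum_le_sum hstep
    _ = 2 * P (⋃ k ∈ Finset.range (n + 1), A k ∩ C k) := by
      rw [← Finset.mul_sum, measure_biUnion_finset₀]
      · intro i _ j _ hij
        refine Disjoint.aedisjoint ?_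
        rcases lt_or_gt_of_ne hij with h | h
        · exact (hdisj i j h).mono Set.inter_subset_left Set.inter_subset_left
        · exact (hdisj j i h).symm.mono Set.inter_subset_left Set.inter_subset_left
      · exact fun k _ => (hAm k).inter (hCm k)
    _ ≤ 2 * P {ω | a ≤ B (t n) ω} := by
      gcongr
      intro ω hω
      simp only [Set.mem_iUnion] at hω
      obtain ⟨k, -, ⟨h1, -⟩, h2⟩ := hω
      have h2 : 0 ≤ B (t n) ω - B (t k) ω := h2
      change a ≤ B (t n) ω
      linarith

/-- A continuous path that reaches `a` exceeds `a / 2` at a point of every sufficiently fine grid.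
The event is thus contained, up to a null set, in an increasing union of sets to which the discrete
inequality applies. -/
lemma measure_exists_ge_le [IsProbabilityMeasure P] (hB : IsBrownianReal B P) {δ : ℝ≥0}
    (hδ : δ ≠ 0) {a : ℝ} (ha : 0 < a) :
    P {ω | ∃ u ≤ δ, a ≤ B u ω} ≤ 2 * ENNReal.ofReal (Real.exp (-(a / 2) ^ 2 / (2 * δ))) := by
  let E : ℕ → Set Ω := fun n => {ω | ∃ k ≤ n, a / 2 ≤ B (k * (δ / n)) ω}
  have hE : ∀ n : ℕ, n ≠ 0 → P (E n) ≤ 2 * ENNReal.ofReal (Real.exp (-(a / 2) ^ 2 / (2 * δ))) := by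
    intro n hn
    have h1 := levy_maximal_discrete hB.toIsPreBrownianReal (t := fun k : ℕ => (k : ℝ≥0) * (δ / n))
      (fun i j hij => by dsimp only; gcongr) n (a / 2)
    have hn' : (n : ℝ≥0) ≠ 0 := by exact_mod_cast hn
    simp only [mul_div_cancel₀ _ hn'] at h1
    refine h1.trans ?_
    gcongr
    exact measure_ge_le_exp_of_hasLaw_gaussianReal hδ (hB.hasLaw_eval δ) (by positivity)
  have hsub : {ω | ∃ u ≤ δ, a ≤ B u ω} ∩ {ω | Continuous fun t => B t ω} ⊆
      ⋃ N : ℕ, ⋂ n ∈ Set.Ici (N + 1), E n := by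
    rintro ω ⟨⟨u, hu, hau⟩, hc⟩
    have hδ' : (δ : ℝ) ≠ 0 := by exact_mod_cast hδ
    have hlim : Tendsto (fun n : ℕ => (⌊((u : ℝ) / δ) * (n : ℝ)⌋₊ : ℝ≥0) * (δ / n)) atTop
        (𝓝 u) := by
      have h1 : Tendsto (fun n : ℕ => (⌊((u : ℝ) / δ) * (n : ℝ)⌋₊ : ℝ) / (n : ℝ)) atTop
          (𝓝 ((u : ℝ) / δ)) :=
        (tendsto_nat_floor_mul_div_atTop (R := ℝ) (a := (u : ℝ) / δ) (by positivity)).comp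
          tendsto_natCast_atTop_atTop
      have h2 := h1.mul_const (δ : ℝ)
      rw [div_mul_cancel₀ _ hδ'] at h2
      rw [← NNReal.tendsto_coe]
      refine h2.congr fun n => ?_
      push_cast
      rw [div_mul_eq_mul_div, mul_div_assoc]
    have hev : ∀ᶠ n : ℕ in atTop,
        a / 2 < B ((⌊((u : ℝ) / δ) * (n : ℝ)⌋₊ : ℝ≥0) * (δ / n)) ω :=
      ((hc.tendsto u).comp hlim).eventually_const_lt (by linarith)
    obtain ⟨N, hN⟩ := eventually_atTop.mp hev
    simp only [Set.mem_iUnion, Set.mem_iInter]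
    refine ⟨N, fun n hn => ⟨⌊((u : ℝ) / δ) * (n : ℝ)⌋₊, ?_, (hN n ?_).le⟩⟩
    · refine Nat.floor_le_of_le ?_
      calc ((u : ℝ) / δ) * (n : ℝ) ≤ 1 * n := by
            gcongr
            exact div_le_one_of_le₀ (by exact_mod_cast hu) (by positivity)
        _ = n := one_mul _
    · exact (Nat.le_succ N).trans hn
  have hle : P {ω | ∃ u ≤ δ, a ≤ B u ω} ≤ P (⋃ N : ℕ, ⋂ n ∈ Set.Ici (N + 1), E n) := by
    refine (measure_mono_ae ?_)
    filter_upwards [hB.cont] with ω hω h using hsub ⟨h, hω⟩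
  refine hle.trans ?_
  have hmono : Monotone fun N : ℕ => ⋂ n ∈ Set.Ici (N + 1), E n := by
    intro N M hNM
    exact Set.biInter_subset_biInter_left (Set.Ici_subset_Ici.mpr (by omega))
  rw [hmono.measure_iUnion]
  refine iSup_le fun N => ?_
  refine (measure_mono ?_).trans (hE (N + 1) (by omega))
  exact Set.biInter_subset_of_mem (Set.mem_Ici.mpr le_rfl)

lemma measure_exists_abs_ge_le [IsProbabilityMeasure P] (hB : IsBrownianReal B P) {δ : ℝ≥0}
    (hδ : δ ≠ 0) {a : ℝ} (ha : 0 < a) :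
    P {ω | ∃ u ≤ δ, a ≤ |B u ω|} ≤ 4 * ENNReal.ofReal (Real.exp (-(a / 2) ^ 2 / (2 * δ))) := by
  have h1 := measure_exists_ge_le hB hδ ha
  have h2 := measure_exists_ge_le hB.neg hδ ha
  have hsub : {ω | ∃ u ≤ δ, a ≤ |B u ω|} ⊆
      {ω | ∃ u ≤ δ, a ≤ B u ω} ∪ {ω | ∃ u ≤ δ, a ≤ (-B) u ω} := by
    rintro ω ⟨u, hu, h⟩
    rcases le_abs.mp h with h | h
    · exact Or.inl ⟨u, hu, h⟩
    · exact Or.inr ⟨u, hu, h⟩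
  calc _ ≤ _ := measure_mono hsub
    _ ≤ _ := measure_union_le _ _
    _ ≤ 2 * ENNReal.ofReal (Real.exp (-(a / 2) ^ 2 / (2 * δ))) +
        2 * ENNReal.ofReal (Real.exp (-(a / 2) ^ 2 / (2 * δ))) := add_le_add h1 h2
    _ = _ := by rw [← add_mul]; norm_num

/-- By independence and Fubini, `V` may be frozen; at most one value of `N` then satisfies the
equation, and single values carry no mass. -/
lemma measure_eq_neg_eq_zero [IsProbabilityMeasure P] {V : Ω → EReal} {N : Ω → ℝ}
    (hV : AEMeasurable V P) (hN : AEMeasurable N P) (hind : IndepFun V N P)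
    (hna : ∀ x, P.map N {x} = 0) : P {ω | V ω = -(N ω : EReal)} = 0 := by
  have hS : MeasurableSet {z : EReal × ℝ | z.1 = -(z.2 : EReal)} := by
    refine (isClosed_eq continuous_fst ?_).measurableSet
    exact continuous_neg.comp (continuous_coe_real_ereal.comp continuous_snd)
  have h1 : P {ω | V ω = -(N ω : EReal)} =
      P.map (fun ω => (V ω, N ω)) {z : EReal × ℝ | z.1 = -(z.2 : EReal)} := by
    rw [Measure.map_apply_of_aemeasurable (hV.prodMk hN) hS]
    rfl
  have := Measure.isProbabilityMeasure_map hN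
  rw [h1, (indepFun_iff_map_prod_eq_prod_map_map hV hN).mp hind, Measure.prod_apply hS]
  rw [lintegral_eq_zero_iff (measurable_measure_prodMk_left hS)]
  refine Eventually.of_forall fun v => ?_
  have hss : (Prod.mk v ⁻¹' {z : EReal × ℝ | z.1 = -(z.2 : EReal)}).Subsingleton := by
    intro x hx x' hx'
    have h2 : v = -(x : EReal) := hx
    have h3 : v = -(x' : EReal) := hx'
    rw [h2] at h3
    exact_mod_cast neg_injective h3
  rcases hss.eq_empty_or_singleton with h | ⟨x, h⟩
  · simp [h]
  · simp [h, hna x]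

/-- Write `B u = B r + (B u - B r)` on `[r, s]`. Touching `h` from above says that the infimum of
`(B u - B r) - h u` is exactly `-B r`. That infimum depends only on increments after `r`, hence is
independent of `B r`, which has no atoms because `r ≠ 0`. -/
lemma measure_touch_eq_zero [IsProbabilityMeasure P] (hB : IsBrownianReal B P) {r s : ℝ≥0}
    (hr : r ≠ 0) {h : ℝ≥0 → ℝ} (hh : ContinuousOn h (Set.Icc r s)) :
    P {ω | (∃ u ∈ Set.Icc r s, B u ω = h u) ∧ ∀ u ∈ Set.Icc r s, h u ≤ B u ω} = 0 := by
  -- The infimum is taken over a countable dense set of times so that it is measurable, and in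
  -- `EReal` so that it exists for every function.
  obtain ⟨Q, hQc, hQd⟩ := TopologicalSpace.exists_countable_dense (Set.Icc r s)
  have : Countable Q := hQc
  let V : (ℝ≥0 → ℝ) → EReal := fun f => ⨅ q : Q, ((f (q.1.1 - r) - h q.1.1 : ℝ) : EReal)
  have hV : Measurable V := by
    refine Measurable.iInf fun q => ?_
    exact measurable_coe_real_ereal.comp ((measurable_pi_apply _).sub measurable_const)
  have hind0 := hB.indepFun_shift r
  have hind : IndepFun (fun ω => V fun t => B (r + t) ω - B r ω) (B r) P :=
    hind0.comp (φ := V) (ψ := fun f : Set.Iic r → ℝ => f ⟨r, Set.mem_Iic.mpr le_rfl⟩) hV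
      (measurable_pi_apply _)
  have hVae : AEMeasurable (fun ω => V fun t => B (r + t) ω - B r ω) P := by
    refine AEMeasurable.iInf fun q => ?_
    exact measurable_coe_real_ereal.comp_aemeasurable
      (((hB.aemeasurable _).sub (hB.aemeasurable _)).sub aemeasurable_const)
  have hna : ∀ x, P.map (B r) {x} = 0 := by
    intro x
    rw [(hB.hasLaw_eval r).map_eq]
    have := nullSingletonClass_gaussianReal (μ := 0) hr
    exact measure_singleton x
  have key := measure_eq_neg_eq_zero hVae (hB.aemeasurable r) hind hna
  refine measure_mono_null_ae ?_ key
  filter_upwards [hB.cont] with ω hc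
  rintro ⟨⟨u, hu, hu1⟩, hall⟩
  change V (fun t => B (r + t) ω - B r ω) = -(B r ω : EReal)
  have hval : ∀ q : Q, ((B (r + (q.1.1 - r)) ω - B r ω - h q.1.1 : ℝ) : EReal) =
      ((B q.1.1 ω - h q.1.1 - B r ω : ℝ) : EReal) := by
    intro q
    rw [add_tsub_cancel_of_le q.1.2.1]
    congr 1
    ring
  apply le_antisymm
  · have hcont : ContinuousOn (fun v : ℝ≥0 => ((B v ω - h v - B r ω : ℝ) : EReal))
        (Set.Icc r s) :=
      continuous_coe_real_ereal.comp_continuousOn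
        ((hc.continuousOn.sub hh).sub continuousOn_const)
    have hcont' : Continuous fun v : Set.Icc r s => ((B v ω - h v - B r ω : ℝ) : EReal) :=
      continuousOn_iff_continuous_domRestrict.mp hcont
    have hle : ∀ v : Set.Icc r s,
        V (fun t => B (r + t) ω - B r ω) ≤ ((B v ω - h v - B r ω : ℝ) : EReal) := by
      intro v
      have hcl : IsClosed {v : Set.Icc r s |
          V (fun t => B (r + t) ω - B r ω) ≤ ((B v ω - h v - B r ω : ℝ) : EReal)} :=
        isClosed_le continuous_const hcont'
      have hsub : Q ⊆ {v : Set.Icc r s |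
          V (fun t => B (r + t) ω - B r ω) ≤ ((B v ω - h v - B r ω : ℝ) : EReal)} := by
        intro q hq
        have h1 : V (fun t => B (r + t) ω - B r ω) ≤ _ := iInf_le _ (⟨q, hq⟩ : Q)
        exact h1.trans (hval ⟨q, hq⟩).le
      exact closure_minimal hsub hcl (hQd v)
    have := hle ⟨u, hu⟩
    simp only [hu1, sub_self, zero_sub] at this
    rwa [EReal.coe_neg] at this
  · refine le_iInf fun q => ?_
    rw [hval q, ← EReal.coe_neg, EReal.coe_le_coe_iff]
    linarith [hall q.1.1 q.1.2]

end Brownian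

namespace WebPath

/-! ### Some closed and open sets of paths -/

lemma isClosed_exists_mem {X : Type*} [TopologicalSpace X] {F : Set (ℝ × X)} (hF : IsClosed F)
    (a b : ℝ) : IsClosed {p : X | ∃ t ∈ Set.Icc a b, (t, p) ∈ F} := by
  have : {p : X | ∃ t ∈ Set.Icc a b, (t, p) ∈ F} =
      Prod.snd '' {z : Set.Icc a b × X | ((z.1 : ℝ), z.2) ∈ F} := by
    ext p
    constructor
    · rintro ⟨t, ht, h⟩
      exact ⟨(⟨t, ht⟩, p), h, rfl⟩
    · rintro ⟨⟨t, p⟩, h, rfl⟩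
      exact ⟨t, t.2, h⟩
  rw [this]
  refine isClosedMap_snd_of_compactSpace _ ?_
  have hc : Continuous fun z : Set.Icc a b × X => ((z.1 : ℝ), z.2) :=
    (continuous_subtype_val.comp continuous_fst).prodMk continuous_snd
  exact hF.preimage hc

lemma isClosed_exists_eval_mem {F : Set EReal} (hF : IsClosed F) (a b : ℝ) :
    IsClosed {p : WebPath | ∃ t ∈ Set.Icc a b, p t ∈ F} := by
  have h : IsClosed {z : ℝ × WebPath | z.2 z.1 ∈ F} :=
    hF.preimage (continuous_eval₂.comp continuous_swap)
  exact isClosed_exists_mem h a b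

lemma isOpen_forall_eval_mem {U : Set EReal} (hU : IsOpen U) (a b : ℝ) :
    IsOpen {p : WebPath | ∀ t ∈ Set.Icc a b, p t ∈ U} := by
  have h := isClosed_exists_eval_mem hU.isClosed_compl a b
  rw [← isOpen_compl_iff] at h
  convert h using 1
  ext p
  simp

lemma isClosed_forall_eval_mem {F : Set EReal} (hF : IsClosed F) (S : Set ℝ) :
    IsClosed {p : WebPath | ∀ t ∈ S, p t ∈ F} := by
  have : {p : WebPath | ∀ t ∈ S, p t ∈ F} = ⋂ t ∈ S, {p | p t ∈ F} := by
    ext p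
    simp
  rw [this]
  exact isClosed_biInter fun t _ => hF.preimage (continuous_eval t)

/-- The path is finite at all times. -/
def IsFinite (p : WebPath) : Prop := ∀ t : ℝ, p t ≠ ⊤ ∧ p t ≠ ⊥

lemma measurableSet_isFinite : MeasurableSet {p : WebPath | p.IsFinite} := by
  have : {p : WebPath | p.IsFinite} =
      ⋂ n : ℕ, {p | ∀ t ∈ Set.Icc (-(n : ℝ)) n, p t ∈ ({⊤}ᶜ ∩ {⊥}ᶜ : Set EReal)} := by
    ext p
    simp only [Set.mem_iInter]
    constructor
    · exact fun h n t _ => h t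
    · intro h t
      obtain ⟨n, hn⟩ := exists_nat_gt |t|
      exact h n t (abs_le.mp hn.le)
  rw [this]
  exact MeasurableSet.iInter fun n => (isOpen_forall_eval_mem
    (isOpen_compl_singleton.inter isOpen_compl_singleton) _ _).measurableSet

end WebPath

open WebPath

/-! ### The law of a Brownian path -/

section Law

variable {Ω : Type*} {mΩ : MeasurableSpace Ω} {P : Measure Ω} {B : ℝ≥0 → Ω → ℝ}
  {Ω' : Type*} {mΩ' : MeasurableSpace Ω'} {P' : Measure Ω'} {B' : ℝ≥0 → Ω' → ℝ}

lemma aemeasurable_ofFun (hB : IsBrownianReal B P) :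
    AEMeasurable (fun ω => ofFun fun t => B t ω) P := by
  refine aemeasurable_of_eval ?_ fun q => ?_
  · simp only [ofFun_start]
    exact aemeasurable_const
  · have h : AEMeasurable (fun ω => ((B (q : ℝ).toNNReal ω : ℝ) : EReal)) P :=
      measurable_coe_real_ereal.comp_aemeasurable (hB.aemeasurable _)
    refine h.congr ?_
    filter_upwards [hB.cont] with ω hω
    rw [ofFun_apply hω]

lemma map_restrict_rat_eq (hB : IsPreBrownianReal B P) (I : Finset ℚ) :
    P.map (fun ω => I.restrict fun q : ℚ => B (q : ℝ).toNNReal ω) =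
      (BrownianReal.projectiveFamily (I.image fun q : ℚ => (q : ℝ).toNNReal)).map
        (fun f (q : I) => f ⟨(q.1 : ℝ).toNNReal, Finset.mem_image_of_mem _ q.2⟩) := by
  have h := hB.hasLaw (I.image fun q : ℚ => (q : ℝ).toNNReal)
  rw [← h.map_eq, AEMeasurable.map_map_of_aemeasurable _ h.aemeasurable]
  · rfl
  · exact (measurable_pi_lambda _ fun q => measurable_pi_apply _).aemeasurable

lemma map_rat_eq [IsProbabilityMeasure P] [IsProbabilityMeasure P'] (hB : IsPreBrownianReal B P)
    (hB' : IsPreBrownianReal B' P') :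
    P.map (fun ω (q : ℚ) => B (q : ℝ).toNNReal ω) =
      P'.map (fun ω (q : ℚ) => B' (q : ℝ).toNNReal ω) := by
  have h1 := isProjectiveLimit_map (X := fun (q : ℚ) ω => B (q : ℝ).toNNReal ω) (P := P)
    (aemeasurable_pi_lambda _ fun q => hB.aemeasurable _)
  have h2 := isProjectiveLimit_map (X := fun (q : ℚ) ω => B' (q : ℝ).toNNReal ω) (P := P')
    (aemeasurable_pi_lambda _ fun q => hB'.aemeasurable _)
  have hfam : (fun I : Finset ℚ => P.map fun ω => I.restrict fun q : ℚ => B (q : ℝ).toNNReal ω) =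
      fun I : Finset ℚ => P'.map fun ω => I.restrict fun q : ℚ => B' (q : ℝ).toNNReal ω := by
    funext I
    rw [map_restrict_rat_eq hB I, map_restrict_rat_eq hB' I]
  rw [hfam] at h1
  have : ∀ I : Finset ℚ, IsFiniteMeasure
      (P'.map fun ω => I.restrict fun q : ℚ => B' (q : ℝ).toNNReal ω) := fun I => by
    have := Measure.isProbabilityMeasure_map (μ := P')
      (f := fun ω => I.restrict fun q : ℚ => B' (q : ℝ).toNNReal ω)
      (aemeasurable_pi_lambda _ fun q => hB'.aemeasurable _)
    infer_instance
  exact h1.unique h2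

/-- The coordinates of a path that follows `f` at rational times. -/
def ratCoords (f : ℚ → ℝ) : (ℚ → EReal) × EReal := (fun q => ((f q : ℝ) : EReal), 0)

lemma measurable_ratCoords : Measurable ratCoords := by
  unfold ratCoords
  exact (measurable_pi_lambda _ fun q =>
    measurable_coe_real_ereal.comp (measurable_pi_apply q)).prodMk measurable_const

lemma map_coords_map_ofFun (hB : IsBrownianReal B P) :
    (P.map (fun ω => ofFun fun t => B t ω)).map coords =
      (P.map (fun ω (q : ℚ) => B (q : ℝ).toNNReal ω)).map ratCoords := by
  rw [AEMeasurable.map_map_of_aemeasurable continuous_coords.measurable.aemeasurable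
    (aemeasurable_ofFun hB), AEMeasurable.map_map_of_aemeasurable
    measurable_ratCoords.aemeasurable (aemeasurable_pi_lambda _ fun q => hB.aemeasurable _)]
  refine Measure.map_congr ?_
  filter_upwards [hB.cont] with ω hω
  exact coords_ofFun hω

/-- The values at rational times have prescribed finite-dimensional laws, hence one joint law by
uniqueness of projective limits, and `coords` transports this back to paths. -/
theorem map_ofFun_eq [IsProbabilityMeasure P] [IsProbabilityMeasure P'] (hB : IsBrownianReal B P)
    (hB' : IsBrownianReal B' P') :
    P.map (fun ω => ofFun fun t => B t ω) = P'.map (fun ω => ofFun fun t => B' t ω) := by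
  have h := (map_coords_map_ofFun hB).trans ((congrArg _ (map_rat_eq hB.toIsPreBrownianReal
    hB'.toIsPreBrownianReal)).trans (map_coords_map_ofFun hB').symm)
  have h' := congrArg (Measure.comap coords) h
  rwa [measurableEmbedding_coords.comap_map, measurableEmbedding_coords.comap_map] at h'

/-- Independence is given for the sample functions with the product `σ`-algebra, which does not see
continuity. A measurable left inverse `g` of `coords` gives a measurable functional of the sample
function that agrees almost surely with `ofFun`. -/
lemma iIndepFun_ofFun {m : ℕ} {B : Fin m → ℝ≥0 → Ω → ℝ} (hB : ∀ j, IsBrownianReal (B j) P)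
    (hind : iIndepFun (fun j ω t => B j t ω) P) :
    iIndepFun (fun j ω => ofFun fun t => B j t ω) P := by
  obtain ⟨g, hg, hgc⟩ : ∃ g : (ℚ → EReal) × EReal → WebPath, Measurable g ∧ g ∘ coords = id :=
    measurableEmbedding_coords.exists_measurable_extend measurable_id fun _ => inferInstance
  have h1 := hind.comp (fun _ (f : ℝ≥0 → ℝ) => g (ratCoords fun q : ℚ => f (q : ℝ).toNNReal))
    fun _ => hg.comp (measurable_ratCoords.comp
      (measurable_pi_lambda _ fun q => measurable_pi_apply _))
  refine h1.congr fun j => ?_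
  filter_upwards [(hB j).cont] with ω hω
  have h2 := coords_ofFun hω
  have h3 : g (coords (ofFun fun t => B j t ω)) = ofFun fun t => B j t ω := congrFun hgc _
  rw [h2] at h3
  exact h3

/-- `β` is the law of a standard Brownian path started at the origin. -/
def IsBrownianPathLaw (β : Measure WebPath) : Prop :=
  ∃ (Ω : Type) (_ : MeasurableSpace Ω) (P : Measure Ω) (_ : IsProbabilityMeasure P)
    (B : ℝ≥0 → Ω → ℝ), IsBrownianReal B P ∧ β = P.map fun ω => ofFun fun t => B t ω

namespace IsBrownianPathLaw

variable {β : Measure WebPath}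

lemma isProbabilityMeasure (hβ : IsBrownianPathLaw β) : IsProbabilityMeasure β := by
  obtain ⟨Ω, _, P, _, B, hB, rfl⟩ := hβ
  exact Measure.isProbabilityMeasure_map (aemeasurable_ofFun hB)

lemma map_eq (hβ : IsBrownianPathLaw β) [IsProbabilityMeasure P] (hB : IsBrownianReal B P) :
    P.map (fun ω => ofFun fun t => B t ω) = β := by
  obtain ⟨Ω, _, P, _, B, hB', rfl⟩ := hβ
  exact map_ofFun_eq hB hB'

lemma map_pi_eq (hβ : IsBrownianPathLaw β) [IsProbabilityMeasure P] {m : ℕ}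
    {B : Fin m → ℝ≥0 → Ω → ℝ} (hB : ∀ j, IsBrownianReal (B j) P)
    (hind : iIndepFun (fun j ω t => B j t ω) P) :
    P.map (fun ω (j : Fin m) => ofFun fun t => B j t ω) = Measure.pi fun _ => β := by
  rw [(iIndepFun_iff_map_fun_eq_pi_map fun j => aemeasurable_ofFun (hB j)).mp
    (iIndepFun_ofFun hB hind)]
  congr 1
  funext j
  exact hβ.map_eq (hB j)

lemma ae_basic (hβ : IsBrownianPathLaw β) :
    ∀ᵐ p ∂β, p.start = 0 ∧ p (0 : ℝ) = 0 ∧ p.IsFinite := by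
  obtain ⟨Ω, _, P, _, B, hB, rfl⟩ := hβ
  have hm : MeasurableSet {p : WebPath | p.start = 0 ∧ p (0 : ℝ) = 0 ∧ p.IsFinite} :=
    (isClosed_eq continuous_start continuous_const).measurableSet.inter
      ((isClosed_eq (continuous_eval 0) continuous_const).measurableSet.inter
        measurableSet_isFinite)
  rw [ae_map_iff (aemeasurable_ofFun hB) hm]
  filter_upwards [hB.cont, hB.eval_zero_ae_eq_zero] with ω hω h0
  refine ⟨ofFun_start _, ?_, fun t => ?_⟩
  · rw [ofFun_apply hω]
    simp [h0]
  · rw [ofFun_apply hω]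
    exact ⟨EReal.coe_ne_top _, EReal.coe_ne_bot _⟩

lemma measure_exit_le (hβ : IsBrownianPathLaw β) {δ a : ℝ} (hδ : 0 < δ) (ha : 0 < a) :
    β {p | ∃ u ∈ Set.Icc 0 δ, p u ∈ (Set.Ioo ((-a : ℝ) : EReal) (a : ℝ))ᶜ} ≤
      4 * ENNReal.ofReal (Real.exp (-(a / 2) ^ 2 / (2 * δ))) := by
  obtain ⟨Ω, _, P, _, B, hB, rfl⟩ := hβ
  have hm := (isClosed_exists_eval_mem (isOpen_Ioo (a := ((-a : ℝ) : EReal))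
    (b := (a : EReal))).isClosed_compl 0 δ).measurableSet
  rw [Measure.map_apply_of_aemeasurable (aemeasurable_ofFun hB) hm]
  have h := measure_exists_abs_ge_le hB (δ := δ.toNNReal) (by simpa using hδ) ha
  rw [Real.coe_toNNReal _ hδ.le] at h
  refine le_trans (measure_mono_ae ?_) h
  filter_upwards [hB.cont] with ω hω
  rintro ⟨u, hu, hmem⟩
  refine ⟨u.toNNReal, Real.toNNReal_le_toNNReal hu.2, ?_⟩
  rw [ofFun_apply hω, Set.mem_compl_iff, Set.mem_Ioo, EReal.coe_lt_coe_iff,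
    EReal.coe_lt_coe_iff, ← abs_lt, not_lt] at hmem
  exact hmem

lemma measure_eval_eq (hβ : IsBrownianPathLaw β) {r : ℝ} (hr : 0 < r) (x : EReal) :
    β {p | p r = x} = 0 := by
  obtain ⟨Ω, _, P, _, B, hB, rfl⟩ := hβ
  have hm : MeasurableSet {p : WebPath | p r = x} :=
    (isClosed_eq (continuous_eval r) continuous_const).measurableSet
  rw [Measure.map_apply_of_aemeasurable (aemeasurable_ofFun hB) hm]
  have hl := hB.hasLaw_eval r.toNNReal
  have h0 : P {ω | B r.toNNReal ω = x.toReal} = 0 := by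
    have h1 : gaussianReal 0 r.toNNReal {x.toReal} = 0 := by
      have := nullSingletonClass_gaussianReal (μ := 0) (v := r.toNNReal) (by simpa using hr)
      exact measure_singleton _
    rw [← hl.map_eq, Measure.map_apply_of_aemeasurable hl.aemeasurable
      (measurableSet_singleton _)] at h1
    exact h1
  refine measure_mono_null_ae ?_ h0
  filter_upwards [hB.cont] with ω hω h
  have h : ofFun (fun t => B t ω) r = x := h
  rw [ofFun_apply hω] at h
  change B r.toNNReal ω = x.toReal
  rw [← h, EReal.toReal_coe]

lemma measure_touch (hβ : IsBrownianPathLaw β) {r s : ℝ} (hr : 0 < r) {h : ℝ → ℝ}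
    (hh : ContinuousOn h (Set.Icc r s)) :
    β {p | (∃ u ∈ Set.Icc r s, p u = (h u : EReal)) ∧
        ∀ u ∈ Set.Icc r s, (h u : EReal) ≤ p u} = 0 ∧
      β {p | (∃ u ∈ Set.Icc r s, p u = (h u : EReal)) ∧
        ∀ u ∈ Set.Icc r s, p u ≤ (h u : EReal)} = 0 := by
  obtain ⟨Ω, _, P, _, B, hB, rfl⟩ := hβ
  have hm1 : MeasurableSet {p : WebPath | ∃ u ∈ Set.Icc r s, p u = (h u : EReal)} := by
    have hcl : IsClosed {p : WebPath | ∃ u ∈ Set.Icc r s, p u = (h u : EReal)} := by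
      have : {p : WebPath | ∃ u ∈ Set.Icc r s, p u = (h u : EReal)} =
          Prod.snd '' {z : Set.Icc r s × WebPath | z.2 z.1 = (h z.1 : EReal)} := by
        ext p
        constructor
        · rintro ⟨t, ht, h⟩
          exact ⟨(⟨t, ht⟩, p), h, rfl⟩
        · rintro ⟨⟨t, p⟩, h, rfl⟩
          exact ⟨t, t.2, h⟩
      rw [this]
      refine isClosedMap_snd_of_compactSpace _ (isClosed_eq ?_ ?_)
      · exact continuous_eval₂.comp
          (continuous_snd.prodMk (continuous_subtype_val.comp continuous_fst))
      · exact continuous_coe_real_ereal.comp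
          ((continuousOn_iff_continuous_domRestrict.mp hh).comp continuous_fst)
    exact hcl.measurableSet
  have hm2 : MeasurableSet {p : WebPath | ∀ u ∈ Set.Icc r s, (h u : EReal) ≤ p u} := by
    have : {p : WebPath | ∀ u ∈ Set.Icc r s, (h u : EReal) ≤ p u} =
        ⋂ u ∈ Set.Icc r s, {p | (h u : EReal) ≤ p u} := by ext; simp
    rw [this]
    exact (isClosed_biInter fun u _ =>
      isClosed_le continuous_const (continuous_eval u)).measurableSet
  have hm3 : MeasurableSet {p : WebPath | ∀ u ∈ Set.Icc r s, p u ≤ (h u : EReal)} := by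
    have : {p : WebPath | ∀ u ∈ Set.Icc r s, p u ≤ (h u : EReal)} =
        ⋂ u ∈ Set.Icc r s, {p | p u ≤ (h u : EReal)} := by ext; simp
    rw [this]
    exact (isClosed_biInter fun u _ =>
      isClosed_le (continuous_eval u) continuous_const).measurableSet
  have hr' : r.toNNReal ≠ 0 := by simpa using hr
  have hmem : ∀ u : ℝ≥0, u ∈ Set.Icc r.toNNReal s.toNNReal → r.toNNReal ≤ u →
      (u : ℝ) ∈ Set.Icc r s := by
    intro u hu _
    have h1 : r ≤ u := Real.toNNReal_le_iff_le_coe.mp hu.1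
    refine ⟨h1, ?_⟩
    rcases le_total s 0 with hs | hs
    · have := hu.2
      rw [Real.toNNReal_of_nonpos hs] at this
      have : (u : ℝ) ≤ 0 := by exact_mod_cast this
      linarith
    · have : (u : ℝ) ≤ (s.toNNReal : ℝ) := by exact_mod_cast hu.2
      rwa [Real.coe_toNNReal _ hs] at this
  have hcn : ContinuousOn (fun u : ℝ≥0 => h u) (Set.Icc r.toNNReal s.toNNReal) :=
    hh.comp NNReal.continuous_coe.continuousOn fun u hu => hmem u hu hu.1
  have hval : ∀ ω, Continuous (fun t => B t ω) → ∀ u : ℝ≥0,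
      ofFun (fun t => B t ω) (u : ℝ) = (B u ω : EReal) := fun ω hω u => by
    rw [ofFun_apply hω, Real.toNNReal_coe]
  have hmem' : ∀ u ∈ Set.Icc r s, u.toNNReal ∈ Set.Icc r.toNNReal s.toNNReal := fun u hu =>
    ⟨Real.toNNReal_le_toNNReal hu.1, Real.toNNReal_le_toNNReal hu.2⟩
  constructor
  · rw [Measure.map_apply_of_aemeasurable (aemeasurable_ofFun hB) (show MeasurableSet
      {p : WebPath | (∃ u ∈ Set.Icc r s, p u = (h u : EReal)) ∧
        ∀ u ∈ Set.Icc r s, (h u : EReal) ≤ p u} from hm1.inter hm2)]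
    refine measure_mono_null_ae ?_ (measure_touch_eq_zero hB hr' hcn)
    filter_upwards [hB.cont] with ω hω
    rintro ⟨⟨u, hu, h1⟩, h2⟩
    refine ⟨⟨u.toNNReal, hmem' u hu, ?_⟩, fun v hv => ?_⟩
    · rw [ofFun_apply hω] at h1
      rw [Real.coe_toNNReal _ (hr.le.trans hu.1)]
      exact_mod_cast h1
    · have := h2 v (hmem v hv hv.1)
      rw [hval ω hω] at this
      exact_mod_cast this
  · rw [Measure.map_apply_of_aemeasurable (aemeasurable_ofFun hB) (show MeasurableSet
      {p : WebPath | (∃ u ∈ Set.Icc r s, p u = (h u : EReal)) ∧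
        ∀ u ∈ Set.Icc r s, p u ≤ (h u : EReal)} from hm1.inter hm3)]
    refine measure_mono_null_ae ?_ (measure_touch_eq_zero hB.neg hr' hcn.neg)
    filter_upwards [hB.cont] with ω hω
    rintro ⟨⟨u, hu, h1⟩, h2⟩
    refine ⟨⟨u.toNNReal, hmem' u hu, ?_⟩, fun v hv => ?_⟩
    · rw [ofFun_apply hω] at h1
      simp only [Pi.neg_apply, neg_inj]
      rw [Real.coe_toNNReal _ (hr.le.trans hu.1)]
      exact_mod_cast h1
    · have := h2 v (hmem v hv hv.1)
      rw [hval ω hω] at this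
      simp only [Pi.neg_apply, neg_le_neg_iff]
      exact_mod_cast this

end IsBrownianPathLaw

end Law

/-! ### The law of coalescing Brownian motions -/

section Coalescing

variable {m : ℕ}

/-- The paths `ω j` launched from the points `y j`. -/
def launchAll (y : Fin m → ℝ × ℝ) (ω : Fin m → WebPath) (n : ℕ) : WebPath :=
  if h : n < m then launch (y ⟨n, h⟩) (ω ⟨n, h⟩) else default

lemma launchAll_coe (y : Fin m → ℝ × ℝ) (ω : Fin m → WebPath) (j : Fin m) :
    launchAll y ω j = launch (y j) (ω j) := by
  rw [launchAll, dif_pos j.2]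

lemma launchAll_start (y : Fin m → ℝ × ℝ) (ω : Fin m → WebPath) (n : ℕ) :
    ∃ r : ℝ, (launchAll y ω n).start = r := by
  unfold launchAll
  split_ifs with h
  · exact ⟨_, rfl⟩
  · exact ⟨0, rfl⟩

lemma launchAll_start_ne_bot (y : Fin m → ℝ × ℝ) (ω : Fin m → WebPath) (n : ℕ) :
    (launchAll y ω n).start ≠ ⊥ := by
  obtain ⟨r, hr⟩ := launchAll_start y ω n
  rw [hr]
  exact EReal.coe_ne_bot r

lemma measurable_launchAll (y : Fin m → ℝ × ℝ) : Measurable (launchAll y) := by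
  refine measurable_pi_lambda _ fun n => ?_
  unfold launchAll
  split_ifs with h
  · exact (measurable_launch _).comp (measurable_pi_apply _)
  · exact measurable_const

/-- The coalescing paths obtained from the paths `ω j` launched from the points `y j`. -/
def coalMap (y : Fin m → ℝ × ℝ) (ω : Fin m → WebPath) (j : Fin m) : WebPath :=
  coal (launchAll y ω) j

lemma measurable_coalMap (y : Fin m → ℝ × ℝ) : Measurable (coalMap y) :=
  measurable_pi_lambda _ fun j => (measurable_coal j).comp (measurable_launchAll y)

/-- The law of the coalescing paths when the `ω j` are independent with law `β`. -/
def coalLaw (β : Measure WebPath) (y : Fin m → ℝ × ℝ) : Measure (Fin m → WebPath) :=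
  (Measure.pi fun _ => β).map (coalMap y)

lemma isProbabilityMeasure_coalLaw {β : Measure WebPath} [IsProbabilityMeasure β]
    (y : Fin m → ℝ × ℝ) : IsProbabilityMeasure (coalLaw β y) :=
  Measure.isProbabilityMeasure_map (measurable_coalMap y).aemeasurable

/-- The relation `IsCoalescingBrownianLaw` thus has at most one solution, the image under `coalMap`
of independent Brownian paths. -/
theorem IsCoalescingBrownianLaw.eq_coalLaw {β : Measure WebPath} (hβ : IsBrownianPathLaw β)
    {y : Fin m → ℝ × ℝ} {ν : Measure (Fin m → WebPath)} (h : IsCoalescingBrownianLaw y ν) :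
    ν = coalLaw β y := by
  obtain ⟨Ω, _, P, _, B, Z, hB, hind, hco, hlaw⟩ := h
  rw [coalLaw, ← hβ.map_pi_eq hB hind, ← hlaw.map_eq,
    AEMeasurable.map_map_of_aemeasurable (measurable_coalMap y).aemeasurable
      (aemeasurable_pi_lambda _ fun j => aemeasurable_ofFun (hB j))]
  refine Measure.map_congr ?_
  filter_upwards [hco, ae_all_iff.mpr fun j => (hB j).cont] with ω hω hc
  funext j
  refine IsCoalescence.eq_coal (launchAll_start_ne_bot _ _) (fun j => ?_) (fun j t _ => ?_) hω j
  · rw [launchAll_coe, launch_start]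
  · rw [launchAll_coe, launch_ofFun (hc j)]

/-- One realization from any points `y₀` supplies `m` independent Brownian motions, and these can be
launched from any other points. -/
theorem IsCoalescingBrownianLaw.isCoalescingBrownianLaw_coalLaw {β : Measure WebPath}
    (hβ : IsBrownianPathLaw β) {y₀ : Fin m → ℝ × ℝ} {ν : Measure (Fin m → WebPath)}
    (h : IsCoalescingBrownianLaw y₀ ν) (y : Fin m → ℝ × ℝ) :
    IsCoalescingBrownianLaw y (coalLaw β y) := by
  obtain ⟨Ω, _, P, _, B, Z, hB, hind, -, -⟩ := h
  have hm : AEMeasurable (fun ω (j : Fin m) => ofFun fun t => B j t ω) P :=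
    aemeasurable_pi_lambda _ fun j => aemeasurable_ofFun (hB j)
  refine ⟨Ω, _, P, ‹_›, B, fun ω => coalMap y fun j => ofFun fun t => B j t ω, hB, hind, ?_, ?_⟩
  · filter_upwards [ae_all_iff.mpr fun j => (hB j).cont] with ω hc
    refine isCoalescence_coal (launchAll_start_ne_bot _ _) (fun j => ?_) fun j t _ => ?_
    · rw [launchAll_coe, launch_start]
    · rw [launchAll_coe, launch_ofFun (hc j)]
  · refine ⟨(measurable_coalMap y).comp_aemeasurable hm, ?_⟩
    rw [coalLaw, ← hβ.map_pi_eq hB hind,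
      AEMeasurable.map_map_of_aemeasurable (measurable_coalMap y).aemeasurable hm]
    rfl

lemma coalMap_single (y : Fin 1 → ℝ × ℝ) (ω : Fin 1 → WebPath) :
    coalMap y ω 0 = launch (y 0) (ω 0) :=
  (coal_zero _).trans (launchAll_coe y ω 0)

/-! ### Continuity in the starting points -/

/-- Fubini in a single coordinate: path `j` is random while all the others are frozen. -/
lemma pi_null_of_slice_null {X : Type*} [MeasurableSpace X] {β : Measure X} [SigmaFinite β]
    {A : Set (Fin m → X)} (hA : MeasurableSet A) (j : Fin m)
    (h : ∀ x, β {p | Function.update x j p ∈ A} = 0) : (Measure.pi fun _ : Fin m => β) A = 0 := by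
  have h1 := lintegral_le_of_lmarginal_le (μ := fun _ : Fin m => β) {j}
    (f := A.indicator 1) (g := 0) (measurable_one.indicator hA) measurable_zero ?_
  · rw [lintegral_indicator_one hA] at h1
    simpa using h1
  · intro x
    rw [lmarginal_singleton, lmarginal_singleton]
    have : (fun p => A.indicator (1 : (Fin m → X) → ℝ≥0∞) (Function.update x j p)) =
        Set.indicator {p | Function.update x j p ∈ A} 1 := by
      funext p
      by_cases hp : Function.update x j p ∈ A <;> simp [Set.indicator, hp]
    have hm : MeasurableSet {p | Function.update x j p ∈ A} := hA.preimage (measurable_update x)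
    beta_reduce
    rw [this, lintegral_indicator_one hm, h x]
    exact zero_le

/-- Coalesced paths with labels below `j` do not involve `ω j`, so for the Brownian path `j` they
act as fixed obstacles. -/
lemma coal_launchAll_update (y : Fin m → ℝ × ℝ) (ω : Fin m → WebPath) {i : ℕ} {j : Fin m}
    (hij : i < j) (p : WebPath) :
    coal (launchAll y (Function.update ω j p)) i = coal (launchAll y ω) i := by
  refine coal_congr fun k hk => ?_
  unfold launchAll
  split_ifs with h
  · rw [Function.update_of_ne]
    rintro rfl
    simp at hij
    omega
  · rfl

lemma add_coe_eq_coe_iff {p : EReal} {x c : ℝ} :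
    p + (x : EReal) = c ↔ p = ((c - x : ℝ) : EReal) := by
  induction p with
  | bot => simp [-EReal.coe_sub]
  | top => simp [-EReal.coe_sub]
  | coe p => norm_cast; constructor <;> intro h <;> linarith

lemma coe_le_add_coe_iff {p : EReal} {x c : ℝ} :
    (c : EReal) ≤ p + (x : EReal) ↔ ((c - x : ℝ) : EReal) ≤ p := by
  induction p with
  | bot => simp [-EReal.coe_sub]
  | top => simp [-EReal.coe_sub]
  | coe p => norm_cast; constructor <;> intro h <;> linarith

lemma add_coe_le_coe_iff {p : EReal} {x c : ℝ} :
    p + (x : EReal) ≤ c ↔ p ≤ ((c - x : ℝ) : EReal) := by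
  induction p with
  | bot => simp [-EReal.coe_sub]
  | top => simp [-EReal.coe_sub]
  | coe p => norm_cast; constructor <;> intro h <;> linarith

lemma measurableSet_touch (r s : ℝ) :
    MeasurableSet {z : WebPath × WebPath | (∀ u ∈ Set.Icc r s, z.2 u ∈ ({⊥, ⊤}ᶜ : Set EReal)) ∧
      (∃ u ∈ Set.Icc r s, z.1 u = z.2 u) ∧
      ((∀ u ∈ Set.Icc r s, z.2 u ≤ z.1 u) ∨ ∀ u ∈ Set.Icc r s, z.1 u ≤ z.2 u)} := by
  have hc1 : Continuous fun z : ℝ × (WebPath × WebPath) => z.2.1 z.1 :=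
    continuous_eval₂.comp (by fun_prop : Continuous fun z : ℝ × (WebPath × WebPath) => (z.2.1, z.1))
  have hc2 : Continuous fun z : ℝ × (WebPath × WebPath) => z.2.2 z.1 :=
    continuous_eval₂.comp (by fun_prop : Continuous fun z : ℝ × (WebPath × WebPath) => (z.2.2, z.1))
  have h1 : MeasurableSet {z : WebPath × WebPath |
      ∀ u ∈ Set.Icc r s, z.2 u ∈ ({⊥, ⊤}ᶜ : Set EReal)} := by
    refine (IsOpen.measurableSet ?_)
    exact (isOpen_forall_eval_mem (Set.toFinite _).isClosed.isOpen_compl r s).preimage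
      continuous_snd
  have h2 : MeasurableSet {z : WebPath × WebPath | ∃ u ∈ Set.Icc r s, z.1 u = z.2 u} :=
    (isClosed_exists_mem (isClosed_eq hc1 hc2) r s).measurableSet
  have h3 : MeasurableSet {z : WebPath × WebPath | ∀ u ∈ Set.Icc r s, z.2 u ≤ z.1 u} := by
    simp only [Set.ofPred_forall]
    exact (isClosed_biInter fun u _ => isClosed_le ((continuous_eval u).comp continuous_snd)
      ((continuous_eval u).comp continuous_fst)).measurableSet
  have h4 : MeasurableSet {z : WebPath × WebPath | ∀ u ∈ Set.Icc r s, z.1 u ≤ z.2 u} := by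
    simp only [Set.ofPred_forall]
    exact (isClosed_biInter fun u _ => isClosed_le ((continuous_eval u).comp continuous_fst)
      ((continuous_eval u).comp continuous_snd)).measurableSet
  exact h1.inter (h2.inter (h3.union h4))

variable {β : Measure WebPath}

/-- Where `q` is finite it becomes, after shifting time and space to the launching point, a
deterministic real boundary for a standard Brownian path. -/
lemma IsBrownianPathLaw.measure_launch_touch (hβ : IsBrownianPathLaw β) {y : ℝ × ℝ} {r s : ℝ}
    (hr : y.2 < r) (q : WebPath) :
    β {p | (∀ u ∈ Set.Icc r s, q u ∈ ({⊥, ⊤}ᶜ : Set EReal)) ∧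
      (∃ u ∈ Set.Icc r s, launch y p u = q u) ∧
      ((∀ u ∈ Set.Icc r s, q u ≤ launch y p u) ∨ ∀ u ∈ Set.Icc r s, launch y p u ≤ q u)} = 0 := by
  by_cases hq : ∀ u ∈ Set.Icc r s, q u ∈ ({⊥, ⊤}ᶜ : Set EReal)
  swap
  · refine measure_mono_null (fun p hp => hq hp.1) measure_empty
  set h : ℝ → ℝ := fun v => (q (v + y.2)).toReal - y.1 with hh
  have hmaps : ∀ v ∈ Set.Icc (r - y.2) (s - y.2), v + y.2 ∈ Set.Icc r s := fun v hv =>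
    ⟨by linarith [hv.1], by linarith [hv.2]⟩
  have hcont : ContinuousOn h (Set.Icc (r - y.2) (s - y.2)) := by
    refine ContinuousOn.sub ?_ continuousOn_const
    refine EReal.continuousOn_toReal.comp (q.toMap.continuous.comp
      (continuous_add_const y.2)).continuousOn fun v hv => hq _ (hmaps v hv)
  have hqr : ∀ u ∈ Set.Icc r s, q u = ((q u).toReal : EReal) := by
    intro u hu
    have := hq u hu
    simp only [Set.mem_compl_iff, Set.mem_insert_iff, Set.mem_singleton_iff, not_or] at this
    exact (EReal.coe_toReal this.2 this.1).symm
  have hval : ∀ u ∈ Set.Icc r s, h (u - y.2) = (q u).toReal - y.1 := fun u _ => by simp [hh]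
  have hl : ∀ (p : WebPath), ∀ u ∈ Set.Icc r s, launch y p u = p (u - y.2) + (y.1 : EReal) := by
    intro p u hu
    rw [launch_apply, max_eq_left (by linarith [hu.1])]
  obtain ⟨h1, h2⟩ := hβ.measure_touch (r := r - y.2) (s := s - y.2) (by linarith) hcont
  refine measure_mono_null ?_ (measure_union_null h1 h2)
  rintro p ⟨-, ⟨u, hu, hpu⟩, hor⟩
  have hu' : u - y.2 ∈ Set.Icc (r - y.2) (s - y.2) := ⟨by linarith [hu.1], by linarith [hu.2]⟩
  have hmeet : ∃ v ∈ Set.Icc (r - y.2) (s - y.2), p v = (h v : EReal) := by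
    refine ⟨u - y.2, hu', ?_⟩
    rw [hl p u hu, hqr u hu] at hpu
    rw [hval u hu]
    exact add_coe_eq_coe_iff.mp hpu
  rcases hor with hor | hor
  · refine Or.inl ⟨hmeet, fun v hv => ?_⟩
    have := hor _ (hmaps v hv)
    rw [hl p _ (hmaps v hv), hqr _ (hmaps v hv), coe_le_add_coe_iff] at this
    simpa [hh] using this
  · refine Or.inr ⟨hmeet, fun v hv => ?_⟩
    have := hor _ (hmaps v hv)
    rw [hl p _ (hmaps v hv), hqr _ (hmaps v hv), add_coe_le_coe_iff] at this
    simpa [hh] using this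

lemma IsBrownianPathLaw.ae_not_touch (hβ : IsBrownianPathLaw β) (y : Fin m → ℝ × ℝ) {i : ℕ}
    {j : Fin m} (hij : i < j) {r s : ℝ} (hr : (y j).2 < r) :
    ∀ᵐ ω ∂(Measure.pi fun _ : Fin m => β),
      ¬ ((∀ u ∈ Set.Icc r s, coal (launchAll y ω) i u ∈ ({⊥, ⊤}ᶜ : Set EReal)) ∧
      (∃ u ∈ Set.Icc r s, launch (y j) (ω j) u = coal (launchAll y ω) i u) ∧
      ((∀ u ∈ Set.Icc r s, coal (launchAll y ω) i u ≤ launch (y j) (ω j) u) ∨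
        ∀ u ∈ Set.Icc r s, launch (y j) (ω j) u ≤ coal (launchAll y ω) i u)) := by
  have := hβ.isProbabilityMeasure
  rw [ae_iff]
  simp only [not_not]
  refine pi_null_of_slice_null ?_ j fun ω => ?_
  · have hm : Measurable fun ω : Fin m → WebPath => (launch (y j) (ω j), coal (launchAll y ω) i) :=
      ((measurable_launch _).comp (measurable_pi_apply j)).prodMk
        ((measurable_coal i).comp (measurable_launchAll y))
    exact hm (measurableSet_touch r s)
  · simp only [Set.mem_ofPred_eq, coal_launchAll_update y ω hij, Function.update_self]
    exact hβ.measure_launch_touch hr _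

lemma launch_isFinite {p : WebPath} (hp : p.IsFinite) (y : ℝ × ℝ) : (launch y p).IsFinite := by
  intro t
  obtain ⟨h1, h2⟩ := hp (max (t - y.2) 0)
  rw [launch_apply]
  lift p (max (t - y.2) 0) to ℝ using ⟨h1, h2⟩ with a
  rw [← EReal.coe_add]
  exact ⟨EReal.coe_ne_top _, EReal.coe_ne_bot _⟩

lemma launch_at_start {p : WebPath} (hp : p (0 : ℝ) = 0) (y : ℝ × ℝ) {t : ℝ} (ht : t ≤ y.2) :
    launch y p t = (y.1 : EReal) := by
  rw [launch_apply, max_eq_right (by linarith), hp, zero_add]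

lemma IsBrownianPathLaw.measure_launch_eval_eq (hβ : IsBrownianPathLaw β) {y : ℝ × ℝ} {t : ℝ}
    (ht : y.2 < t) (x : ℝ) : β {p | launch y p t = (x : EReal)} = 0 := by
  have : {p : WebPath | launch y p t = (x : EReal)} =
      {p | p (t - y.2) = ((x - y.1 : ℝ) : EReal)} := by
    ext p
    simp only [Set.mem_ofPred_eq]
    rw [launch_apply, max_eq_left (by linarith), add_coe_eq_coe_iff]
  rw [this]
  exact hβ.measure_eval_eq (by linarith) _

/-- Two kinds of null events are discarded: some launched path runs through the starting point of
another, or a launched path touches a lower coalesced path from one side throughout a rational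
interval. The first exclusion puts the meeting strictly after both starting times; the second, for a
rational interval around the meeting and inside the allowed time, forces strict inequalities both
ways. -/
theorem IsBrownianPathLaw.ae_transversal (hβ : IsBrownianPathLaw β) (y : Fin m → ℝ × ℝ) :
    ∀ᵐ ω ∂(Measure.pi fun _ : Fin m => β), (∀ j, (ω j) (0 : ℝ) = 0) ∧
      ∀ j i : Fin m, i < j → y i ≠ y j →
        Transversal (launch (y j) (ω j)) (coal (launchAll y ω) i) := by
  have := hβ.isProbabilityMeasure
  have hbasic : ∀ᵐ ω ∂(Measure.pi fun _ : Fin m => β),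
      ∀ j : Fin m, (ω j).start = 0 ∧ (ω j) (0 : ℝ) = 0 ∧ (ω j).IsFinite :=
    ae_all_iff.mpr fun j =>
      (Measure.tendsto_eval_ae_ae (μ := fun _ : Fin m => β) (i := j)).eventually hβ.ae_basic
  have hhit : ∀ᵐ ω ∂(Measure.pi fun _ : Fin m => β), ∀ l k : Fin m, (y l).2 < (y k).2 →
      launch (y l) (ω l) (y k).2 ≠ ((y k).1 : EReal) := by
    refine ae_all_iff.mpr fun l => ae_all_iff.mpr fun k => ?_
    by_cases hlk : (y l).2 < (y k).2
    · have h : ∀ᵐ p ∂β, launch (y l) p (y k).2 ≠ ((y k).1 : EReal) := by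
        rw [ae_iff]
        simp only [ne_eq, not_not]
        exact hβ.measure_launch_eval_eq hlk _
      filter_upwards [(Measure.tendsto_eval_ae_ae (i := l)).eventually h] with ω hω _ using hω
    · simp [hlk]
  have htouch : ∀ᵐ ω ∂(Measure.pi fun _ : Fin m => β), ∀ (j : Fin m) (i : Fin m), i < j →
      ∀ r s : ℚ, (y j).2 < r →
      ¬ ((∀ u ∈ Set.Icc (r : ℝ) s, coal (launchAll y ω) i u ∈ ({⊥, ⊤}ᶜ : Set EReal)) ∧
      (∃ u ∈ Set.Icc (r : ℝ) s, launch (y j) (ω j) u = coal (launchAll y ω) i u) ∧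
      ((∀ u ∈ Set.Icc (r : ℝ) s, coal (launchAll y ω) i u ≤ launch (y j) (ω j) u) ∨
        ∀ u ∈ Set.Icc (r : ℝ) s, launch (y j) (ω j) u ≤ coal (launchAll y ω) i u)) := by
    refine ae_all_iff.mpr fun j => ae_all_iff.mpr fun i => ?_
    by_cases hij : i < j
    · have : ∀ r s : ℚ, ∀ᵐ ω ∂(Measure.pi fun _ : Fin m => β), (y j).2 < r →
          ¬ ((∀ u ∈ Set.Icc (r : ℝ) s, coal (launchAll y ω) i u ∈ ({⊥, ⊤}ᶜ : Set EReal)) ∧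
          (∃ u ∈ Set.Icc (r : ℝ) s, launch (y j) (ω j) u = coal (launchAll y ω) i u) ∧
          ((∀ u ∈ Set.Icc (r : ℝ) s, coal (launchAll y ω) i u ≤ launch (y j) (ω j) u) ∨
          ∀ u ∈ Set.Icc (r : ℝ) s, launch (y j) (ω j) u ≤ coal (launchAll y ω) i u)) := by
        intro r s
        by_cases hr : (y j).2 < r
        · filter_upwards [hβ.ae_not_touch y (show (i : ℕ) < j from hij) (s := s) hr] with ω hω _
            using hω
        · simp [hr]
      filter_upwards [ae_all_iff.mpr fun r => ae_all_iff.mpr fun s => this r s] with ω hω _ using hω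
    · simp [hij]
  filter_upwards [hbasic, hhit, htouch] with ω hb hh ht
  refine ⟨fun j => (hb j).2.1, fun j i hij hne τ hτ hfirst t hτt => ?_⟩
  set q := coal (launchAll y ω) i with hq
  have hqs : q.start = ((y i).2 : EReal) := by rw [hq, coal_start, launchAll_coe, launch_start]
  have h1 : (y j).2 ≤ τ := by have := hτ.1; rw [launch_start] at this; exact_mod_cast this
  have h2 : (y i).2 ≤ τ := by have := hτ.2.1; rw [hqs] at this; exact_mod_cast this
  have hq0 : q (y i).2 = ((y i).1 : EReal) := by
    rw [hq, coal_of_le_start (by rw [launchAll_coe, launch_start]), launchAll_coe,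
      launch_at_start (hb i).2.1 _ le_rfl]
  have hqval : ∀ u : ℝ, (y i).2 < u → ∃ l : Fin m, (y l).2 < u ∧ q u = launch (y l) (ω l) u := by
    intro u hu
    obtain ⟨l, hl, hl1, hl2⟩ := exists_coal_eq (launchAll y ω) i (t := u)
      (by rw [launchAll_coe, launch_start]; exact_mod_cast hu)
    have hlm : l < m := hl.trans_lt i.2
    have hcoe := launchAll_coe y ω ⟨l, hlm⟩
    simp only at hcoe
    rw [hcoe] at hl1 hl2
    rw [launch_start] at hl1
    exact ⟨⟨l, hlm⟩, by exact_mod_cast hl1, hl2⟩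
  have hlt1 : (y j).2 < τ := by
    rcases h1.lt_or_eq with h | h
    · exact h
    exfalso
    have he : q τ = ((y j).1 : EReal) := by
      rw [← hτ.2.2, launch_at_start (hb j).2.1 _ h.ge]
    rcases h2.lt_or_eq with h' | h'
    · obtain ⟨l, hl1, hl2⟩ := hqval τ h'
      rw [hl2, ← h] at he
      exact hh l j (h ▸ hl1) he
    · rw [← h', hq0] at he
      exact hne (Prod.ext (by exact_mod_cast he) (h'.trans h.symm))
  -- A meeting at the starting time of `y i` would make the later part of the path launched from `y
  -- j` run through `y i`.
  have hlt2 : (y i).2 < τ := by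
    rcases h2.lt_or_eq with h | h
    · exact h
    exfalso
    have he := hτ.2.2
    rw [← h, hq0] at he
    exact hh j i (h ▸ hlt1) he
  obtain ⟨r, hr1, hr2⟩ := exists_rat_btwn (max_lt hlt1 hlt2)
  obtain ⟨s, hs1, hs2⟩ := exists_rat_btwn hτt
  have hrj : (y j).2 < r := (le_max_left _ _).trans_lt hr1
  have hri : (y i).2 < r := (le_max_right _ _).trans_lt hr1
  have hno := ht j i hij r s hrj
  have hfin : ∀ u ∈ Set.Icc (r : ℝ) s, q u ∈ ({⊥, ⊤}ᶜ : Set EReal) := by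
    intro u hu
    obtain ⟨l, -, hl2⟩ := hqval u (hri.trans_le hu.1)
    have := launch_isFinite (hb l).2.2 (y l) u
    rw [hl2]
    simp [this.1, this.2]
  have hno' : ¬ ((∀ u ∈ Set.Icc (r : ℝ) s, q u ≤ launch (y j) (ω j) u) ∨
      ∀ u ∈ Set.Icc (r : ℝ) s, launch (y j) (ω j) u ≤ q u) := fun h =>
    hno ⟨hfin, ⟨τ, ⟨hr2.le, hs1.le⟩, hτ.2.2⟩, h⟩
  push Not at hno'
  obtain ⟨⟨a, ha, ha'⟩, b, hb, hb'⟩ := hno'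
  refine ⟨a, b, ?_, ?_, ?_, ?_, ha.2.trans_lt hs2, hb.2.trans_lt hs2, ha', hb'⟩
  · rw [launch_start]; exact_mod_cast hrj.trans_le ha.1
  · rw [hqs]; exact_mod_cast hri.trans_le ha.1
  · rw [launch_start]; exact_mod_cast hrj.trans_le hb.1
  · rw [hqs]; exact_mod_cast hri.trans_le hb.1

/-- Points that coincide in the limit must coincide along the sequence, because transversality is
available only for distinct starting points; coinciding ones are handled by their immediate meeting.
-/
theorem IsBrownianPathLaw.ae_tendsto_coalMap (hβ : IsBrownianPathLaw β) {yn : ℕ → Fin m → ℝ × ℝ}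
    {y : Fin m → ℝ × ℝ} (hy : ∀ j, Tendsto (fun n => yn n j) atTop (𝓝 (y j)))
    (heq : ∀ i j, y i = y j → ∀ n, yn n i = yn n j) :
    ∀ᵐ ω ∂(Measure.pi fun _ : Fin m => β),
      Tendsto (fun n => coalMap (yn n) ω) atTop (𝓝 (coalMap y ω)) := by
  filter_upwards [hβ.ae_transversal y] with ω hω
  rw [tendsto_pi_nhds]
  have h := tendsto_coal (m := m) (l := atTop) (wn := fun n => launchAll (yn n) ω)
    (w := launchAll y ω) (launchAll_start_ne_bot _ _) (fun n => launchAll_start _ _) ?_ ?_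
  · exact fun j => h j j.2
  · intro j hj
    unfold launchAll
    simp only [hj, dif_pos]
    exact (continuous_launch.tendsto (y ⟨j, hj⟩, ω ⟨j, hj⟩)).comp
      ((hy ⟨j, hj⟩).prodMk_nhds tendsto_const_nhds)
  · intro j hj i hij
    have e := fun y : Fin m → ℝ × ℝ => launchAll_coe y ω ⟨j, hj⟩
    have e' := fun y : Fin m → ℝ × ℝ => launchAll_coe y ω ⟨i, hij.trans hj⟩
    simp only at e e'
    by_cases hne : y ⟨i, hij.trans hj⟩ = y ⟨j, hj⟩
    · refine Or.inl (Eventually.of_forall fun n => ?_)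
      have hn := heq _ _ hne n
      rw [e, e', hn]
      refine ⟨rfl, fun t ht => ?_⟩
      rw [launch_start] at ht
      have ht' : t = (yn n ⟨j, hj⟩).2 := by exact_mod_cast ht.symm
      rw [launch_at_start (hω.1 _) _ ht'.le, launch_at_start (hω.1 _) _ ht'.le]
    · refine Or.inr ?_
      rw [e]
      exact hω.2 ⟨j, hj⟩ ⟨i, hij.trans hj⟩ hij hne

theorem IsBrownianPathLaw.tendsto_integral_coalLaw (hβ : IsBrownianPathLaw β)
    {yn : ℕ → Fin m → ℝ × ℝ} {y : Fin m → ℝ × ℝ}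
    (hy : ∀ j, Tendsto (fun n => yn n j) atTop (𝓝 (y j)))
    (heq : ∀ i j, y i = y j → ∀ n, yn n i = yn n j)
    (f : BoundedContinuousFunction (Fin m → WebPath) ℝ) :
    Tendsto (fun n => ∫ z, f z ∂(coalLaw β (yn n))) atTop (𝓝 (∫ z, f z ∂(coalLaw β y))) := by
  have := hβ.isProbabilityMeasure
  have hmap : ∀ y : Fin m → ℝ × ℝ, ∫ z, f z ∂(coalLaw β y) =
      ∫ ω, f (coalMap y ω) ∂(Measure.pi fun _ : Fin m => β) := fun y =>
    integral_map (measurable_coalMap y).aemeasurable f.continuous.aestronglyMeasurable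
  simp only [hmap]
  refine tendsto_integral_of_dominated_convergence (fun _ => ‖f‖) (fun n => ?_)
    (integrable_const _) (fun n => Eventually.of_forall fun ω => f.norm_coe_le_norm _) ?_
  · exact (f.continuous.measurable.comp (measurable_coalMap _)).aestronglyMeasurable
  · filter_upwards [hβ.ae_tendsto_coalMap hy heq] with ω hω
    exact (f.continuous.tendsto _).comp hω

end Coalescing

/-! ### Events in the space of compact sets of paths -/

lemma WebPath.exists_gt_lt {p q : WebPath} {s : ℝ} (h : p s < q s) : ∃ s' > s, p s' < q s' := by
  have ho : IsOpen {u : ℝ | p u < q u} := isOpen_lt p.toMap.continuous q.toMap.continuous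
  have h1 : ∀ᶠ u in 𝓝[>] s, p u < q u := mem_nhdsWithin_of_mem_nhds (ho.mem_nhds h)
  obtain ⟨u, hu1, hu2⟩ := (h1.and self_mem_nhdsWithin).exists
  exact ⟨u, hu2, hu1⟩

/-- By continuity the two times can be moved slightly later, strictly past both starting times. All
conditions are then open, so crossing is open and noncrossing is preserved by limits. -/
lemma WebPath.crosses_iff {p q : WebPath} : p.Crosses q ↔ ∃ s t : ℝ, p.start < s ∧ q.start < s ∧
    p.start < t ∧ q.start < t ∧ p s < q s ∧ q t < p t := by
  constructor
  · rintro ⟨s, t, hs, ht, h1, h2⟩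
    obtain ⟨s', hs', h1'⟩ := exists_gt_lt h1
    obtain ⟨t', ht', h2'⟩ := exists_gt_lt h2
    have hs'' : (s : EReal) < s' := by exact_mod_cast hs'
    have ht'' : (t : EReal) < t' := by exact_mod_cast ht'
    rw [max_le_iff] at hs ht
    exact ⟨s', t', hs.1.trans_lt hs'', hs.2.trans_lt hs'', ht.1.trans_lt ht'',
      ht.2.trans_lt ht'', h1', h2'⟩
  · rintro ⟨s, t, h1, h2, h3, h4, h5, h6⟩
    exact ⟨s, t, max_le h1.le h2.le, max_le h3.le h4.le, h5, h6⟩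

lemma WebPath.isOpen_crosses : IsOpen {z : WebPath × WebPath | z.1.Crosses z.2} := by
  simp only [crosses_iff, Set.ofPred_exists]
  refine isOpen_iUnion fun s => isOpen_iUnion fun t => ?_
  have e1 := continuous_start.comp (continuous_fst (X := WebPath) (Y := WebPath))
  have e2 := continuous_start.comp (continuous_snd (X := WebPath) (Y := WebPath))
  have e3 := fun s => (continuous_eval s).comp (continuous_fst (X := WebPath) (Y := WebPath))
  have e4 := fun s => (continuous_eval s).comp (continuous_snd (X := WebPath) (Y := WebPath))
  exact (isOpen_lt e1 continuous_const).inter ((isOpen_lt e2 continuous_const).inter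
    ((isOpen_lt e1 continuous_const).inter ((isOpen_lt e2 continuous_const).inter
    ((isOpen_lt (e3 s) (e4 s)).inter (isOpen_lt (e4 t) (e3 t))))))

/-- The sets `K` that contain all the paths of some tuple in `F`. -/
def hitSet {m : ℕ} (F : Set (Fin m → WebPath)) : Set PathSets := {K | ∃ z ∈ F, ∀ j, z j ∈ K}

lemma hitSet_mono {m : ℕ} {F G : Set (Fin m → WebPath)} (h : F ⊆ G) : hitSet F ⊆ hitSet G :=
  fun _ ⟨z, hz, hK⟩ => ⟨z, h hz, hK⟩

lemma isOpen_hitSet {m : ℕ} {U : Set (Fin m → WebPath)} (hU : IsOpen U) : IsOpen (hitSet U) := by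
  rw [isOpen_iff_forall_mem_open]
  rintro K ⟨z, hz, hK⟩
  obtain ⟨V, hV, hVU⟩ := isOpen_pi_iff'.mp hU z hz
  refine ⟨⋂ j, {K : PathSets | ((K : Set WebPath) ∩ V j).Nonempty}, ?_,
    isOpen_iInter_of_finite fun j => NonemptyCompacts.isOpen_inter_nonempty_of_isOpen (hV j).1, ?_⟩
  · intro L hL
    simp only [Set.mem_iInter] at hL
    choose w hw using hL
    exact ⟨w, hVU fun j _ => (hw j).2, fun j => (hw j).1⟩
  · simp only [Set.mem_iInter]
    exact fun j => ⟨z j, hK j, (hV j).2⟩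

/-- If no tuple from the compact set `K` lies in `F`, a whole thickening of the set of such tuples
avoids `F`, and this thickening contains the tuples of every compact set near `K`. -/
lemma isClosed_hitSet {m : ℕ} {F : Set (Fin m → WebPath)} (hF : IsClosed F) :
    IsClosed (hitSet F) := by
  rw [← isOpen_compl_iff, isOpen_iff_forall_mem_open]
  intro K hK
  have hKc : IsCompact (Set.univ.pi fun _ : Fin m => (K : Set WebPath)) :=
    isCompact_univ_pi fun _ => K.isCompact
  have hsub : (Set.univ.pi fun _ : Fin m => (K : Set WebPath)) ⊆ Fᶜ := fun z hz hzF =>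
    hK ⟨z, hzF, fun j => hz j trivial⟩
  obtain ⟨δ, hδ, hδF⟩ := hKc.exists_thickening_subset_open hF.isOpen_compl hsub
  refine ⟨{L : PathSets | (L : Set WebPath) ⊆ Metric.thickening δ (K : Set WebPath)}, ?_,
    NonemptyCompacts.isOpen_subsets_of_isOpen Metric.isOpen_thickening,
    Metric.self_subset_thickening hδ _⟩
  rintro L hL ⟨z, hzF, hz⟩
  refine hδF ?_ hzF
  have h : ∀ j, ∃ w ∈ (K : Set WebPath), dist (z j) w < δ := fun j =>
    Metric.mem_thickening_iff.mp (hL (hz j))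
  choose w hwK hw using h
  exact Metric.mem_thickening_iff.mpr ⟨w, fun j _ => hwK j, (dist_pi_lt_iff hδ).mpr hw⟩

lemma isClosed_noncrossing : IsClosed {K : PathSets | Noncrossing K} := by
  have h : {K : PathSets | Noncrossing K} =
      (hitSet {z : Fin 2 → WebPath | (z 0).Crosses (z 1)})ᶜ := by
    ext K
    constructor
    · rintro hK ⟨z, hz, hzK⟩
      exact hK _ (hzK 0) _ (hzK 1) hz
    · intro hK p hp q hq hc
      refine hK ⟨![p, q], hc, fun j => ?_⟩
      fin_cases j
      · exact hp
      · exact hq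
  rw [h]
  refine (isOpen_hitSet ?_).isClosed_compl
  have hc : Continuous fun z : Fin 2 → WebPath => (z 0, z 1) :=
    (continuous_apply 0).prodMk (continuous_apply 1)
  exact isOpen_crosses.preimage hc

/-- Some `k + 1` paths of `K`, started before time `t₀` and in `(a, b)` at time `t₀`, are at
different real positions at time `t₀ + t`. -/
def spreadEvent (k : ℕ) (t₀ t a b : ℝ) : Set PathSets :=
  hitSet {z : Fin (k + 1) → WebPath | ∀ j, (z j).start < t₀ ∧
    z j t₀ ∈ Set.Ioo (a : EReal) b ∧ z j (t₀ + t) ∈ Set.Ioo (⊥ : EReal) ⊤ ∧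
    ∀ i, i ≠ j → z i (t₀ + t) ≠ z j (t₀ + t)}

lemma isOpen_spreadEvent (k : ℕ) (t₀ t a b : ℝ) : IsOpen (spreadEvent k t₀ t a b) := by
  refine isOpen_hitSet ?_
  have e := fun (j : Fin (k + 1)) (s : ℝ) =>
    (continuous_eval s).comp (continuous_apply (A := fun _ : Fin (k + 1) => WebPath) j)
  rw [Set.ofPred_forall]
  refine isOpen_iInter_of_finite fun j => ?_
  refine (isOpen_lt (continuous_start.comp (continuous_apply j)) continuous_const).inter
    ((isOpen_Ioo.preimage (e j t₀)).inter ((isOpen_Ioo.preimage (e j (t₀ + t))).inter ?_))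
  change IsOpen {z : Fin (k + 1) → WebPath | ∀ i, i ≠ j → z i (t₀ + t) ≠ z j (t₀ + t)}
  simp only [Set.ofPred_forall]
  exact isOpen_iInter_of_finite fun i => isOpen_iInter_of_finite fun _ =>
    isOpen_ne_fun (e i (t₀ + t)) (e j (t₀ + t))

/-- `spreadEvent` replaces the events of (B₁) and (B₂) by smaller ones with strict inequalities,
which are open and therefore pass to weak limits. -/
lemma spreadEvent_subset (k : ℕ) {t₀ t a b : ℝ} (ht : 0 < t) {K : PathSets}
    (hK : K ∈ spreadEvent k t₀ t a b) : (k : ℕ∞) ≤ etaHat K t₀ t a b := by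
  obtain ⟨z, hz, hzK⟩ := hK
  have hreal : ∀ j, ∃ x : ℝ, z j (t₀ + t) = (x : EReal) := fun j => by
    obtain ⟨h1, h2⟩ := (hz j).2.2.1
    exact ⟨_, (EReal.coe_toReal h2.ne h1.ne').symm⟩
  choose x hx using hreal
  have hinj : Function.Injective x := fun i j hij => by
    by_contra hne
    exact (hz j).2.2.2 i hne (by rw [hx, hx, hij])
  have hmem : Set.range x ⊆ {x : ℝ | ∃ p ∈ K, (∃ x₀ ∈ Set.Icc a b, p.Touches (x₀, t₀)) ∧
      p.Touches (x, t₀ + t)} := by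
    rintro _ ⟨j, rfl⟩
    obtain ⟨h1, h2, -, -⟩ := hz j
    have hv : z j t₀ = ((z j t₀).toReal : EReal) :=
      (EReal.coe_toReal (h2.2.trans (EReal.coe_lt_top b)).ne
        ((EReal.bot_lt_coe a).trans h2.1).ne').symm
    rw [hv] at h2
    refine ⟨z j, hzK j, ⟨(z j t₀).toReal, ⟨by exact_mod_cast h2.1.le, by exact_mod_cast h2.2.le⟩,
      h1.le, hv⟩, ?_, hx j⟩
    refine h1.le.trans ?_
    norm_cast
    linarith
  have hcard : ((k + 1 : ℕ) : ℕ∞) ≤ eta K t₀ t a b := by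
    have h := Set.encard_le_encard hmem
    rwa [← Set.image_univ, hinj.encard_image, Set.encard_univ, ENat.card_eq_coe_fintype_card,
      Fintype.card_fin] at h
  rw [etaHat]
  refine ENat.le_sub_of_add_le_right (by simp) ?_
  exact_mod_cast hcard

/-- The laws `μ n` are those of noncrossing sets that contain approximations of coalescing
Brownian motions from the points of `D`. -/
structure IsWebApproximation (β : Measure WebPath) (D : Set (ℝ × ℝ))
    (μ : ℕ → Measure PathSets) : Prop where
  isProbabilityMeasure : ∀ n, IsProbabilityMeasure (μ n)
  noncrossing : ∀ n, ∀ᵐ K ∂(μ n), Noncrossing K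
  coalescing : ∀ (m : ℕ) (y : Fin m → ℝ × ℝ), (∀ j, y j ∈ D) → ∀ U, IsOpen U →
    coalLaw β y U ≤ liminf (fun n => μ n (hitSet U)) atTop

lemma map_coalLaw_single (β : Measure WebPath) [IsProbabilityMeasure β] (y : Fin 1 → ℝ × ℝ) :
    (coalLaw β y).map (fun z => z 0) = β.map (launch (y 0)) := by
  rw [coalLaw, Measure.map_map (measurable_pi_apply 0) (measurable_coalMap y)]
  have h : (fun z : Fin 1 → WebPath => z 0) ∘ coalMap y = launch (y 0) ∘ fun ω => ω 0 := by
    funext ω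
    exact coalMap_single y ω
  rw [h, ← Measure.map_map (measurable_launch _) (measurable_pi_apply 0)]
  congr 1
  exact (measurePreserving_eval (fun _ : Fin 1 => β) 0).map_eq

lemma hitSet_single (U : Set WebPath) :
    hitSet {z : Fin 1 → WebPath | z 0 ∈ U} = {K : PathSets | ((K : Set WebPath) ∩ U).Nonempty} := by
  ext K
  constructor
  · rintro ⟨z, hz, hK⟩
    exact ⟨z 0, hK 0, hz⟩
  · rintro ⟨p, hp, hU⟩
    exact ⟨fun _ => p, hU, fun _ => hp⟩

namespace IsWebApproximation

variable {β : Measure WebPath} {D : Set (ℝ × ℝ)} {μ : ℕ → Measure PathSets}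

lemma le_liminf (h : IsWebApproximation β D μ) [IsProbabilityMeasure β] {y : ℝ × ℝ} (hy : y ∈ D)
    {U : Set WebPath} (hU : IsOpen U) :
    β (launch y ⁻¹' U) ≤ liminf (fun n => μ n {K : PathSets | ((K : Set WebPath) ∩ U).Nonempty}) atTop := by
  have h1 := h.coalescing 1 (fun _ => y) (fun _ => hy) {z | z 0 ∈ U}
    (hU.preimage (continuous_apply 0))
  rw [hitSet_single] at h1
  refine le_trans (le_of_eq ?_) h1
  have h2 := map_coalLaw_single β fun _ : Fin 1 => y
  rw [← Measure.map_apply (measurable_launch y) hU.measurableSet, ← h2,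
    Measure.map_apply (measurable_pi_apply 0) hU.measurableSet]
  rfl

lemma eventually_miss_lt (h : IsWebApproximation β D μ) [IsProbabilityMeasure β] {y : ℝ × ℝ}
    (hy : y ∈ D) {U : Set WebPath} (hU : IsOpen U) {e : ℝ≥0∞} (he : β (launch y ⁻¹' Uᶜ) < e) :
    ∀ᶠ n in atTop, μ n {K : PathSets | ¬ ((K : Set WebPath) ∩ U).Nonempty} < e := by
  have hp := h.isProbabilityMeasure
  -- For `e > 1` there is nothing to prove; below, `1 - e` is a truncated subtraction that needs `e
  -- ≤ 1`.
  rcases lt_or_ge 1 e with h1 | h1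
  · exact Eventually.of_forall fun n => prob_le_one.trans_lt h1
  have hmU : MeasurableSet (launch y ⁻¹' U) := measurable_launch y hU.measurableSet
  have hlt : 1 - e < β (launch y ⁻¹' U) := by
    rw [ENNReal.sub_lt_iff_lt_right (ne_top_of_le_ne_top ENNReal.one_ne_top h1) h1]
    have h2 := prob_add_prob_compl (μ := β) hmU
    rw [← h2]
    exact ENNReal.add_lt_add_left (measure_ne_top _ _) he
  have h3 := eventually_lt_of_lt_liminf (hlt.trans_le (h.le_liminf hy hU))
  filter_upwards [h3] with n hn
  have hmK : MeasurableSet {K : PathSets | ((K : Set WebPath) ∩ U).Nonempty} :=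
    (NonemptyCompacts.isOpen_inter_nonempty_of_isOpen hU).measurableSet
  have h4 : μ n {K : PathSets | ¬ ((K : Set WebPath) ∩ U).Nonempty} =
      1 - μ n {K : PathSets | ((K : Set WebPath) ∩ U).Nonempty} := prob_compl_eq_one_sub hmK
  rw [h4]
  refine ENNReal.sub_lt_of_lt_add prob_le_one ?_
  rw [ENNReal.sub_lt_iff_lt_right (ne_top_of_le_ne_top ENNReal.one_ne_top h1) h1] at hn
  rwa [add_comm]

end IsWebApproximation

/-! ### Tightness -/

/-- The paths whose oscillation over `[-N, N]` at scale `δ` is not small. -/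
def wiggleSet (N : ℕ) (δ : ℝ) : Set WebPath :=
  {p | ∃ s ∈ Set.Icc (-(N : ℝ)) N, ∃ t ∈ Set.Icc (-(N : ℝ)) N, |s - t| ≤ δ ∧
    (1 : ℝ) / (N + 1) < |etanh (p s) - etanh (p t)|}

lemma isOpen_wiggleSet (N : ℕ) (δ : ℝ) : IsOpen (wiggleSet N δ) := by
  rw [isOpen_iff_mem_nhds]
  rintro p ⟨s, hs, t, ht, hst, h⟩
  have hc : Continuous fun p : WebPath => |etanh (p s) - etanh (p t)| :=
    ((etanh_continuous.comp (continuous_eval s)).sub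
      (etanh_continuous.comp (continuous_eval t))).abs
  filter_upwards [(isOpen_lt continuous_const hc).mem_nhds h] with q hq
  exact ⟨s, hs, t, ht, hst, hq⟩

lemma wiggleSet_mono (N : ℕ) {δ δ' : ℝ} (h : δ ≤ δ') : wiggleSet N δ ⊆ wiggleSet N δ' := by
  rintro p ⟨s, hs, t, ht, hst, h'⟩
  exact ⟨s, hs, t, ht, hst.trans h, h'⟩

lemma measurableSet_hit_wiggleSet (N : ℕ) (δ : ℝ) :
    MeasurableSet {K : PathSets | ((K : Set WebPath) ∩ wiggleSet N δ).Nonempty} :=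
  (NonemptyCompacts.isOpen_inter_nonempty_of_isOpen (isOpen_wiggleSet N δ)).measurableSet

lemma exists_forall_notMem_wiggleSet (K : PathSets) (N : ℕ) :
    ∃ δ > 0, ∀ p ∈ K, p ∉ wiggleSet N δ := by
  have hc : Continuous fun z : WebPath × ℝ => etanh (z.1 z.2) :=
    etanh_continuous.comp continuous_eval₂
  have hcp : IsCompact ((K : Set WebPath) ×ˢ Set.Icc (-(N : ℝ)) N) :=
    K.isCompact.prod isCompact_Icc
  have hu := hcp.uniformContinuousOn_of_continuous hc.continuousOn
  obtain ⟨δ, hδ, h⟩ := Metric.uniformContinuousOn_iff.mp hu (1 / (N + 1)) (by positivity)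
  refine ⟨δ / 2, by positivity, ?_⟩
  rintro p hp ⟨s, hs, t, ht, hst, hgap⟩
  have := h (p, s) ⟨hp, hs⟩ (p, t) ⟨hp, ht⟩ (by
    rw [Prod.dist_eq, dist_self, Real.dist_eq]
    exact max_lt hδ (by linarith))
  rw [Real.dist_eq] at this
  exact lt_asymm this hgap

/-- The paths of one compact set are equicontinuous, so for a single law the bad events decrease to
the empty set. This handles the finitely many indices that an asymptotic bound leaves out. -/
lemma eventually_measure_wiggleSet_lt (μ : Measure PathSets) [IsProbabilityMeasure μ] (N : ℕ)
    {e : ℝ≥0∞} (he : 0 < e) :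
    ∀ᶠ δ in 𝓝[>] (0 : ℝ), μ {K : PathSets | ((K : Set WebPath) ∩ wiggleSet N δ).Nonempty} < e := by
  set A : ℕ → Set PathSets := fun k =>
    {K : PathSets | ((K : Set WebPath) ∩ wiggleSet N (1 / ((k : ℝ) + 1))).Nonempty} with hA
  have hanti : Antitone A := by
    rintro k l hkl K ⟨p, hp, hpw⟩
    exact ⟨p, hp, wiggleSet_mono N (one_div_le_one_div_of_le (by positivity) (by gcongr)) hpw⟩
  have hempty : ⋂ k, A k = ∅ := by
    rw [Set.eq_empty_iff_forall_notMem]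
    intro K hK
    obtain ⟨δ, hδ, h⟩ := exists_forall_notMem_wiggleSet K N
    obtain ⟨k, hk⟩ := exists_nat_one_div_lt hδ
    obtain ⟨p, hp, hpw⟩ := Set.mem_iInter.mp hK k
    exact h p hp (wiggleSet_mono N hk.le hpw)
  have hlim := tendsto_measure_iInter_atTop (μ := μ) (s := A)
    (fun k => (measurableSet_hit_wiggleSet N _).nullMeasurableSet) hanti ⟨0, measure_ne_top _ _⟩
  rw [hempty, measure_empty] at hlim
  obtain ⟨k, hk⟩ := (hlim.eventually_lt_const he).exists
  filter_upwards [Ioo_mem_nhdsGT (show (0 : ℝ) < 1 / ((k : ℝ) + 1) by positivity)] with δ hδ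
  refine lt_of_le_of_lt (measure_mono ?_) hk
  rintro K ⟨p, hp, hpw⟩
  exact ⟨p, hp, wiggleSet_mono N hδ.2.le hpw⟩

/-- The paths that go from one side of `[b, c]` to the other within a time `δ` in `[-N, N]`. -/
def fastSet (b c : ℝ) (N : ℕ) (δ : ℝ) : Set WebPath :=
  {p | ∃ s ∈ Set.Icc (-(N : ℝ)) N, ∃ t ∈ Set.Icc (-(N : ℝ)) N, s < t ∧ t ≤ s + δ ∧
    ((p s < b ∧ c < p t) ∨ (c < p s ∧ p t < b))}

/-- The paths that stay in `(b, c)` over `[T, T + 2δ]`. -/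
def tubeSet (b c T δ : ℝ) : Set WebPath :=
  {q | q.start < T ∧ ∀ u ∈ Set.Icc T (T + 2 * δ), q u ∈ Set.Ioo (b : EReal) c}

lemma isOpen_tubeSet (b c T δ : ℝ) : IsOpen (tubeSet b c T δ) :=
  (isOpen_lt continuous_start continuous_const).inter (isOpen_forall_eval_mem isOpen_Ioo _ _)

/-- Take the slot with `T ≤ s < T + δ`. Then `t ≤ s + δ < T + 2δ`, so a path in the tube lies
strictly between `b` and `c` during the whole passage of `p` and would be crossed by it. -/
lemma exists_tubeSet_miss {K : PathSets} (hK : Noncrossing K) {b c : ℝ} {N : ℕ} {δ : ℝ}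
    (hδ : 0 < δ) (h : ((K : Set WebPath) ∩ fastSet b c N δ).Nonempty) :
    ∃ j ∈ Finset.range (⌊2 * N / δ⌋₊ + 1),
      ¬ ((K : Set WebPath) ∩ tubeSet b c (-N + j * δ) δ).Nonempty := by
  obtain ⟨p, hp, s, hs, t, ht, hst, htd, hor⟩ := h
  -- Crossing only counts times after both starts. If `s` precedes the start of `p`, then `p` has
  -- the same value at its starting time, which replaces `s`.
  have hbc : p s ≠ p t → ∃ s', s ≤ s' ∧ s' < t ∧ p.start ≤ s' ∧ p s' = p s := by
    intro hne
    rcases le_or_gt p.start s with h | h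
    · exact ⟨s, le_rfl, hst, h, rfl⟩
    · have h2 : p.start < t := by
        by_contra hc
        exact hne (p.const_before s t h.le (not_lt.mp hc))
      lift p.start to ℝ using ⟨(h2.trans (EReal.coe_lt_top t)).ne,
        ((EReal.bot_lt_coe s).trans h).ne'⟩ with σ hσ
      exact ⟨σ, by exact_mod_cast h.le, by exact_mod_cast h2, le_rfl,
        p.const_before σ s (by rw [hσ]) (by rw [← hσ]; exact h.le)⟩
  refine ⟨⌊(s + N) / δ⌋₊, ?_, ?_⟩
  · rw [Finset.mem_range, Nat.lt_succ_iff]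
    refine Nat.floor_le_floor ?_
    gcongr
    linarith [hs.2]
  rintro ⟨q, hq, hqs, hqu⟩
  have hnn : 0 ≤ (s + N) / δ := div_nonneg (by linarith [hs.1]) hδ.le
  have h1 : (⌊(s + N) / δ⌋₊ : ℝ) * δ ≤ s + N := by
    rw [← le_div_iff₀ hδ]
    exact Nat.floor_le hnn
  have h2 : s + N < (⌊(s + N) / δ⌋₊ + 1 : ℝ) * δ := by
    rw [← div_lt_iff₀ hδ]
    exact Nat.lt_floor_add_one _
  set T : ℝ := -N + ⌊(s + N) / δ⌋₊ * δ with hT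
  have hTs : T ≤ s := by linarith
  have hsT : s < T + δ := by linarith
  have hmem : ∀ u, s ≤ u → u ≤ t → q u ∈ Set.Ioo (b : EReal) c := fun u h h' =>
    hqu u ⟨by linarith, by linarith⟩
  have hb_lt_c : (b : EReal) < c := (hmem s le_rfl hst.le).1.trans (hmem s le_rfl hst.le).2
  have hne : p s ≠ p t := by
    rcases hor with ⟨a1, a2⟩ | ⟨a1, a2⟩
    · exact (a1.trans (hb_lt_c.trans a2)).ne
    · exact (a2.trans (hb_lt_c.trans a1)).ne'
  obtain ⟨s', hss', hs't, hps', hval⟩ := hbc hne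
  have hqs' : q.start ≤ s' := hqs.le.trans (by exact_mod_cast hTs.trans hss')
  have hle : (s' : EReal) ≤ t := by exact_mod_cast hs't.le
  rcases hor with ⟨a1, a2⟩ | ⟨a1, a2⟩
  · refine hK p hp q hq ⟨s', t, max_le hps' hqs', max_le (hps'.trans hle) (hqs'.trans hle), ?_, ?_⟩
    · rw [hval]
      exact a1.trans (hmem s' hss' hs't.le).1
    · exact (hmem t hst.le le_rfl).2.trans a2
  · refine hK q hq p hp ⟨s', t, max_le hqs' hps', max_le (hqs'.trans hle) (hps'.trans hle), ?_, ?_⟩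
    · rw [hval]
      exact (hmem s' hss' hs't.le).2.trans a1
    · exact a2.trans (hmem t hst.le le_rfl).1

/-- A path started in the middle half of `[b, c]`, at most `δ` before `T`, leaves the tube before `T
+ 2δ` only if it moves by `(c - b) / 4` within time `3δ`. -/
lemma IsBrownianPathLaw.measure_launch_tubeSet_compl_le {β : Measure WebPath}
    (hβ : IsBrownianPathLaw β) {b c T δ : ℝ} (hbc : b < c) (hδ : 0 < δ) {y : ℝ × ℝ}
    (hy1 : y.1 ∈ Set.Ioo (b + (c - b) / 4) (c - (c - b) / 4)) (hy2 : y.2 ∈ Set.Ioo (T - δ) T) :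
    β (launch y ⁻¹' (tubeSet b c T δ)ᶜ) ≤
      4 * ENNReal.ofReal (Real.exp (-((c - b) / 4 / 2) ^ 2 / (2 * (3 * δ)))) := by
  refine le_trans (measure_mono ?_) (hβ.measure_exit_le (δ := 3 * δ) (a := (c - b) / 4)
    (by positivity) (by linarith))
  intro p hp
  by_contra hcon
  apply hp
  refine ⟨by rw [launch_start]; exact_mod_cast hy2.2, fun u hu => ?_⟩
  have hv : u - y.2 ∈ Set.Icc 0 (3 * δ) := ⟨by linarith [hu.1, hy2.2], by linarith [hu.2, hy2.1]⟩
  have hin : p (u - y.2) ∈ Set.Ioo ((-((c - b) / 4) : ℝ) : EReal) ((c - b) / 4 : ℝ) := by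
    by_contra hnot
    exact hcon ⟨_, hv, hnot⟩
  rw [launch_apply, max_eq_left hv.1]
  lift p (u - y.2) to ℝ using ⟨(hin.2.trans (EReal.coe_lt_top _)).ne,
    ((EReal.bot_lt_coe _).trans hin.1).ne'⟩ with r
  rw [Set.mem_Ioo, EReal.coe_lt_coe_iff, EReal.coe_lt_coe_iff] at hin
  rw [← EReal.coe_add, Set.mem_Ioo, EReal.coe_lt_coe_iff, EReal.coe_lt_coe_iff]
  exact ⟨by linarith [hy1.1, hin.1], by linarith [hy1.2, hin.2]⟩

/-- The number of slots grows like `1 / δ`, and the failure probability in each of them decays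
exponentially in `1 / δ`. -/
lemma tendsto_div_add_mul_exp_neg_div (A κ : ℝ) (hκ : 0 < κ) :
    Tendsto (fun δ : ℝ => (A / δ + 1) * (5 * Real.exp (-(κ / δ)))) (𝓝[>] 0) (𝓝 0) := by
  have h1 : Tendsto (fun x : ℝ => κ * x) atTop atTop := tendsto_id.const_mul_atTop hκ
  have h2 := (Real.tendsto_pow_mul_exp_neg_atTop_nhds_zero 1).comp h1
  have h3 := (Real.tendsto_pow_mul_exp_neg_atTop_nhds_zero 0).comp h1
  have h4 : Tendsto (fun x : ℝ => (A * x + 1) * (5 * Real.exp (-(κ * x)))) atTop (𝓝 0) := by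
    have h5 := (h2.const_mul (5 * A / κ)).add (h3.const_mul 5)
    simp only [mul_zero, add_zero] at h5
    refine h5.congr fun x => ?_
    simp only [Function.comp_apply, pow_one, pow_zero, one_mul]
    field_simp
  exact h4.comp tendsto_inv_nhdsGT_zero

/-- The pairs with `etanh` gap at least `η` form a compact subset of `EReal × EReal`, covered by the
open conditions `x < b`, `c < y`. Oscillations measured in the compactified line, also near
infinity, are thus detected by finitely many real intervals. -/
lemma exists_finset_separating {η : ℝ} (hη : 0 < η) : ∃ F : Finset (ℝ × ℝ),
    (∀ i ∈ F, i.1 < i.2) ∧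
    ∀ x y : EReal, η ≤ etanh y - etanh x → ∃ i ∈ F, x < (i.1 : EReal) ∧ (i.2 : EReal) < y := by
  have hcpt : IsCompact {z : EReal × EReal | η ≤ etanh z.2 - etanh z.1} :=
    (isClosed_le continuous_const ((etanh_continuous.comp continuous_snd).sub
      (etanh_continuous.comp continuous_fst))).isCompact
  have hcov : {z : EReal × EReal | η ≤ etanh z.2 - etanh z.1} ⊆
      ⋃ i : {i : ℝ × ℝ // i.1 < i.2},
        {z : EReal × EReal | z.1 < (i.1.1 : EReal) ∧ (i.1.2 : EReal) < z.2} := by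
    rintro ⟨x, y⟩ hxy
    have hxy' : η ≤ etanh y - etanh x := hxy
    have hlt : x < y := etanh_strictMono.lt_iff_lt.mp (by linarith)
    obtain ⟨b, hb1, hb2⟩ := EReal.lt_iff_exists_real_btwn.mp hlt
    obtain ⟨c, hc1, hc2⟩ := EReal.lt_iff_exists_real_btwn.mp hb2
    exact Set.mem_iUnion.mpr ⟨⟨(b, c), by exact_mod_cast hc1⟩, hb1, hc2⟩
  obtain ⟨F, hF⟩ := hcpt.elim_finite_subcover _
    (fun i => (isOpen_lt continuous_fst continuous_const).inter
      (isOpen_lt continuous_const continuous_snd)) hcov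
  classical
  refine ⟨F.image Subtype.val, ?_, fun x y hxy => ?_⟩
  · simp only [Finset.mem_image]
    rintro _ ⟨i, -, rfl⟩
    exact i.2
  · obtain ⟨i, hi⟩ := Set.mem_iUnion.mp (hF (show (x, y) ∈ _ from hxy))
    obtain ⟨hiF, h1, h2⟩ := Set.mem_iUnion.mp hi
    exact ⟨i, Finset.mem_image_of_mem _ hiF, h1, h2⟩

lemma exists_finset_wiggleSet_subset (N : ℕ) : ∃ F : Finset (ℝ × ℝ), (∀ i ∈ F, i.1 < i.2) ∧
    ∀ δ, wiggleSet N δ ⊆ ⋃ i ∈ F, fastSet i.1 i.2 N δ := by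
  obtain ⟨F, hF, h⟩ := exists_finset_separating (η := 1 / ((N : ℝ) + 1)) (by positivity)
  refine ⟨F, hF, fun δ p hp => ?_⟩
  have key : ∀ s ∈ Set.Icc (-(N : ℝ)) N, ∀ t ∈ Set.Icc (-(N : ℝ)) N, |s - t| ≤ δ →
      1 / ((N : ℝ) + 1) < etanh (p t) - etanh (p s) → p ∈ ⋃ i ∈ F, fastSet i.1 i.2 N δ := by
    intro s hs t ht hst hgap
    obtain ⟨i, hi, h1, h2⟩ := h _ _ hgap.le
    simp only [Set.mem_iUnion]
    refine ⟨i, hi, ?_⟩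
    rw [abs_le] at hst
    have hne : s ≠ t := by
      rintro rfl
      have : (0 : ℝ) < 1 / ((N : ℝ) + 1) := by positivity
      linarith
    rcases lt_or_gt_of_ne hne with hlt | hlt
    · exact ⟨s, hs, t, ht, hlt, by linarith [hst.1], Or.inl ⟨h1, h2⟩⟩
    · exact ⟨t, ht, s, hs, hlt, by linarith [hst.2], Or.inr ⟨h2, h1⟩⟩
  obtain ⟨s, hs, t, ht, hst, hgap⟩ := hp
  rcases lt_abs.mp hgap with hg | hg
  · exact key t ht s hs (by rwa [abs_sub_comm]) hg
  · exact key s hs t ht hst (by linarith)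

namespace IsWebApproximation

variable {β : Measure WebPath} {D : Set (ℝ × ℝ)} {μ : ℕ → Measure PathSets}

lemma eventually_fastSet_le (h : IsWebApproximation β D μ) (hβ : IsBrownianPathLaw β)
    (hD : Dense D) {b c : ℝ} (hbc : b < c) (N : ℕ) {e : ℝ≥0∞} (he : 0 < e) :
    ∀ᶠ δ in 𝓝[>] (0 : ℝ), ∀ᶠ n in atTop,
      μ n {K : PathSets | ((K : Set WebPath) ∩ fastSet b c N δ).Nonempty} ≤ e := by
  have := hβ.isProbabilityMeasure
  set κ : ℝ := ((c - b) / 4 / 2) ^ 2 / 6 with hκ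
  have hκ0 : 0 < κ := by
    have : 0 < (c - b) / 4 / 2 := by linarith
    positivity
  have hlim := ENNReal.tendsto_ofReal (tendsto_div_add_mul_exp_neg_div (2 * N) κ hκ0)
  rw [ENNReal.ofReal_zero] at hlim
  filter_upwards [hlim.eventually_lt_const he, self_mem_nhdsWithin] with δ hδe hδ
  have hδ : 0 < δ := hδ
  have hexp : Real.exp (-((c - b) / 4 / 2) ^ 2 / (2 * (3 * δ))) = Real.exp (-(κ / δ)) := by
    congr 1
    rw [hκ]
    field_simp
    ring
  -- The Brownian bound has the constant `4`; the slack up to `5` gives the strict inequality needed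
  -- to pass from the limit to large `n`.
  have hev : ∀ j ∈ Finset.range (⌊2 * N / δ⌋₊ + 1), ∀ᶠ n in atTop,
      μ n {K : PathSets | ¬ ((K : Set WebPath) ∩ tubeSet b c (-N + j * δ) δ).Nonempty} <
        5 * ENNReal.ofReal (Real.exp (-(κ / δ))) := by
    intro j _
    obtain ⟨y, hyD, hy1, hy2⟩ := hD.exists_mem_open
      (U := Set.Ioo (b + (c - b) / 4) (c - (c - b) / 4) ×ˢ
        Set.Ioo (-N + j * δ - δ) (-N + j * δ)) (isOpen_Ioo.prod isOpen_Ioo)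
      ⟨((b + c) / 2, -N + j * δ - δ / 2), ⟨by linarith, by linarith⟩, by linarith, by linarith⟩
    refine h.eventually_miss_lt hyD (isOpen_tubeSet _ _ _ _) ?_
    refine (hβ.measure_launch_tubeSet_compl_le hbc hδ hy1 hy2).trans_lt ?_
    rw [hexp]
    have h0 : ENNReal.ofReal (Real.exp (-(κ / δ))) ≠ 0 := by simpa using Real.exp_pos _
    exact ENNReal.mul_lt_mul_left h0 ENNReal.ofReal_ne_top (by norm_num)
  have hev' := (Finset.eventually_all _).mpr hev
  filter_upwards [hev'] with n hn
  have hsub : μ n {K : PathSets | ((K : Set WebPath) ∩ fastSet b c N δ).Nonempty} ≤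
      μ n (⋃ j ∈ Finset.range (⌊2 * N / δ⌋₊ + 1),
        {K : PathSets | ¬ ((K : Set WebPath) ∩ tubeSet b c (-N + j * δ) δ).Nonempty}) := by
    refine measure_mono_ae ?_
    filter_upwards [h.noncrossing n] with K hK hKf
    obtain ⟨j, hj, hjK⟩ := exists_tubeSet_miss hK hδ hKf
    exact Set.mem_biUnion (Finset.mem_coe.mpr hj) hjK
  refine hsub.trans ((measure_biUnion_finset_le _ _).trans
    ((Finset.sum_le_sum fun j hj => (hn j hj).le).trans (le_trans ?_ hδe.le)))
  rw [Finset.sum_const, Finset.card_range, nsmul_eq_mul, ENNReal.ofReal_mul (by positivity),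
    ENNReal.ofReal_mul (by norm_num)]
  refine mul_le_mul' ?_ (le_of_eq (by norm_num))
  rw [← ENNReal.ofReal_natCast]
  refine ENNReal.ofReal_le_ofReal ?_
  push_cast
  have := Nat.floor_le (show 0 ≤ 2 * (N : ℝ) / δ by positivity)
  linarith

lemma eventually_wiggleSet_le (h : IsWebApproximation β D μ) (hβ : IsBrownianPathLaw β)
    (hD : Dense D) (N : ℕ) {e : ℝ≥0∞} (he : 0 < e) :
    ∀ᶠ δ in 𝓝[>] (0 : ℝ), ∀ᶠ n in atTop,
      μ n {K : PathSets | ((K : Set WebPath) ∩ wiggleSet N δ).Nonempty} ≤ e := by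
  obtain ⟨F, hF, hsub⟩ := exists_finset_wiggleSet_subset N
  have he' : 0 < e / (F.card + 1 : ℕ) := ENNReal.div_pos he.ne' (ENNReal.natCast_ne_top _)
  have hev := (Finset.eventually_all F).mpr fun i hi =>
    h.eventually_fastSet_le hβ hD (hF i hi) N he'
  filter_upwards [hev] with δ hδ
  filter_upwards [(Finset.eventually_all F).mpr hδ] with n hn
  calc μ n {K : PathSets | ((K : Set WebPath) ∩ wiggleSet N δ).Nonempty}
      ≤ μ n (⋃ i ∈ F, {K : PathSets | ((K : Set WebPath) ∩ fastSet i.1 i.2 N δ).Nonempty}) := by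
        refine measure_mono ?_
        rintro K ⟨p, hp, hpw⟩
        have := hsub δ hpw
        simp only [Set.mem_iUnion] at this ⊢
        obtain ⟨i, hi, hpi⟩ := this
        exact ⟨i, hi, p, hp, hpi⟩
    _ ≤ ∑ i ∈ F, e / (F.card + 1 : ℕ) :=
        (measure_biUnion_finset_le _ _).trans (Finset.sum_le_sum hn)
    _ ≤ (F.card + 1 : ℕ) * (e / (F.card + 1 : ℕ)) := by
        rw [Finset.sum_const, nsmul_eq_mul]
        gcongr
        omega
    _ = e := ENNReal.mul_div_cancel (by simp) (ENNReal.natCast_ne_top _)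

lemma exists_forall_wiggleSet_le (h : IsWebApproximation β D μ) (hβ : IsBrownianPathLaw β)
    (hD : Dense D) (N : ℕ) {e : ℝ≥0∞} (he : 0 < e) :
    ∃ δ > 0, ∀ n, μ n {K : PathSets | ((K : Set WebPath) ∩ wiggleSet N δ).Nonempty} ≤ e := by
  have hp := h.isProbabilityMeasure
  obtain ⟨δ₁, hδ₁, hδ₁0⟩ :=
    ((h.eventually_wiggleSet_le hβ hD N he).and self_mem_nhdsWithin).exists
  obtain ⟨n₀, hn₀⟩ := eventually_atTop.mp hδ₁
  have hfin := (Finset.eventually_all (Finset.range n₀)).mpr fun n _ =>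
    eventually_measure_wiggleSet_lt (μ n) N he
  obtain ⟨δ₂, hδ₂, hδ₂0⟩ := (hfin.and self_mem_nhdsWithin).exists
  refine ⟨min δ₁ δ₂, lt_min hδ₁0 hδ₂0, fun n => ?_⟩
  rcases lt_or_ge n n₀ with hn | hn
  · refine (measure_mono ?_).trans (hδ₂ n (Finset.mem_range.mpr hn)).le
    rintro K ⟨p, hp, hpw⟩
    exact ⟨p, hp, wiggleSet_mono N (min_le_right _ _) hpw⟩
  · refine (measure_mono ?_).trans (hn₀ n hn)
    rintro K ⟨p, hp, hpw⟩
    exact ⟨p, hp, wiggleSet_mono N (min_le_left _ _) hpw⟩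

/-- At each scale `N` the modulus is chosen to fail with probability at most `e' N`, with a summable
sequence `e'`; outside the union of the failures all paths lie in one compact `modulusSet`. -/
theorem isTightMeasureSet (h : IsWebApproximation β D μ) (hβ : IsBrownianPathLaw β)
    (hD : Dense D) : IsTightMeasureSet (Set.range μ) := by
  rw [isTightMeasureSet_iff_exists_isCompact_measure_compl_le]
  intro e he
  obtain ⟨e', he'0, he'⟩ := ENNReal.exists_pos_sum_of_countable' he.ne' ℕ
  choose δ hδ hδμ using fun N => h.exists_forall_wiggleSet_le hβ hD N (he'0 N)
  refine ⟨{K : PathSets | (K : Set WebPath) ⊆ modulusSet δ},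
    NonemptyCompacts.isCompact_subsets_of_isCompact (isCompact_modulusSet hδ), ?_⟩
  rintro _ ⟨n, rfl⟩
  calc μ n {K : PathSets | (K : Set WebPath) ⊆ modulusSet δ}ᶜ
      ≤ μ n (⋃ N, {K : PathSets | ((K : Set WebPath) ∩ wiggleSet N (δ N)).Nonempty}) := by
        refine measure_mono fun K hK => ?_
        obtain ⟨p, hp, hpn⟩ := Set.not_subset.mp hK
        simp only [modulusSet, Set.mem_ofPred_eq, not_forall, not_le] at hpn
        obtain ⟨N, s, hs, t, ht, hst, hgap⟩ := hpn
        exact Set.mem_iUnion.mpr ⟨N, p, hp, s, hs, t, ht, hst, hgap⟩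
    _ ≤ ∑' N, e' N := (measure_iUnion_le _).trans (ENNReal.tsum_le_tsum fun N => hδμ N n)
    _ ≤ e := he'.le

end IsWebApproximation

/-! ### Properties of the limiting laws -/

/-- The properties of limits of web approximations from which the Brownian web is identified. -/
structure IsWebLimit (β : Measure WebPath) (D : Set (ℝ × ℝ)) (μ : Measure PathSets) : Prop where
  noncrossing : ∀ᵐ K ∂μ, Noncrossing K
  coalescing : ∀ (m : ℕ) (y : Fin m → ℝ × ℝ), (∀ j, y j ∈ D) → ∀ F, IsClosed F →
    coalLaw β y F ≤ μ (hitSet F)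
  spread_one : ∀ t : ℝ, 0 < t → Tendsto (fun ε : ℝ => ⨆ (a : ℝ) (t₀ : ℝ),
    μ (spreadEvent 1 t₀ t a (a + ε))) (𝓝[>] 0) (𝓝 0)
  spread_two : ∀ t : ℝ, 0 < t → Tendsto (fun ε : ℝ => (ENNReal.ofReal ε)⁻¹ * ⨆ (a : ℝ) (t₀ : ℝ),
    μ (spreadEvent 2 t₀ t a (a + ε))) (𝓝[>] 0) (𝓝 0)

/-- Tuples of the compact set `K` have positive distance from a closed set that they avoid. -/
lemma iInter_hitSet_cthickening {m : ℕ} {F : Set (Fin m → WebPath)} (hF : IsClosed F) :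
    ⋂ k : ℕ, hitSet (Metric.cthickening (1 / ((k : ℝ) + 1)) F) = hitSet F := by
  refine Set.Subset.antisymm (fun K hK => ?_) (Set.subset_iInter fun k =>
    hitSet_mono (Metric.self_subset_cthickening F))
  by_contra hcon
  have hdisj : Disjoint (Set.univ.pi fun _ : Fin m => (K : Set WebPath)) F :=
    Set.disjoint_left.mpr fun z hz hzF => hcon ⟨z, hzF, fun j => hz j trivial⟩
  obtain ⟨δ, hδ, hd⟩ := hdisj.exists_cthickenings (isCompact_univ_pi fun _ => K.isCompact) hF
  obtain ⟨k, hk⟩ := exists_nat_one_div_lt hδ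
  obtain ⟨z, hz, hzK⟩ := Set.mem_iInter.mp hK k
  exact Set.disjoint_left.mp hd (Metric.self_subset_cthickening _ fun j _ => hzK j)
    (Metric.cthickening_mono hk.le F hz)

/-- The portmanteau theorem in both directions: open sets bound the spread events, closed sets keep
noncrossing and the presence of coalescing tuples. -/
theorem IsWebApproximation.isWebLimit {β : Measure WebPath} {D : Set (ℝ × ℝ)}
    {μ : ℕ → ProbabilityMeasure PathSets}
    (h : IsWebApproximation β D fun n => (μ n : Measure PathSets))
    (h₁ : ∀ t : ℝ, 0 < t → Tendsto (fun ε : ℝ => limsup (fun n => ⨆ (a : ℝ) (t₀ : ℝ),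
      (μ n : Measure PathSets) (spreadEvent 1 t₀ t a (a + ε))) atTop) (𝓝[>] 0) (𝓝 0))
    (h₂ : ∀ t : ℝ, 0 < t → Tendsto (fun ε : ℝ => (ENNReal.ofReal ε)⁻¹ *
      limsup (fun n => ⨆ (a : ℝ) (t₀ : ℝ),
      (μ n : Measure PathSets) (spreadEvent 2 t₀ t a (a + ε))) atTop) (𝓝[>] 0) (𝓝 0))
    {l : Filter ℕ} [l.NeBot] (hl : l ≤ atTop) {ν : ProbabilityMeasure PathSets}
    (hν : Tendsto μ l (𝓝 ν)) : IsWebLimit β D (ν : Measure PathSets) := by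
  have hclosed : ∀ F : Set PathSets, IsClosed F →
      limsup (fun n => (μ n : Measure PathSets) F) l ≤ (ν : Measure PathSets) F := fun F hF =>
    ProbabilityMeasure.limsup_measure_closed_le_of_tendsto hν hF
  have hopen : ∀ (k : ℕ) (t ε : ℝ), (⨆ (a : ℝ) (t₀ : ℝ),
      (ν : Measure PathSets) (spreadEvent k t₀ t a (a + ε))) ≤
      limsup (fun n => ⨆ (a : ℝ) (t₀ : ℝ),
        (μ n : Measure PathSets) (spreadEvent k t₀ t a (a + ε))) atTop := by
    intro k t ε
    refine iSup₂_le fun a t₀ => ?_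
    calc (ν : Measure PathSets) (spreadEvent k t₀ t a (a + ε))
        ≤ liminf (fun n => (μ n : Measure PathSets) (spreadEvent k t₀ t a (a + ε))) l :=
          ProbabilityMeasure.le_liminf_measure_open_of_tendsto hν (isOpen_spreadEvent _ _ _ _ _)
      _ ≤ limsup (fun n => (μ n : Measure PathSets) (spreadEvent k t₀ t a (a + ε))) l :=
          liminf_le_limsup
      _ ≤ limsup (fun n => (μ n : Measure PathSets) (spreadEvent k t₀ t a (a + ε))) atTop :=
          limsup_le_limsup_of_le hl
      _ ≤ _ := limsup_le_limsup (Eventually.of_forall fun n => le_iSup₂_of_le a t₀ le_rfl)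
  refine ⟨?_, fun m y hy F hF => ?_, fun t ht => ?_, fun t ht => ?_⟩
  · have h1 : limsup (fun n => (μ n : Measure PathSets) {K | Noncrossing K}) l = 1 := by
      have : (fun n => (μ n : Measure PathSets) {K | Noncrossing K}) = fun _ => 1 := by
        funext n
        exact (mem_ae_iff_prob_eq_one isClosed_noncrossing.measurableSet).mp (h.noncrossing n)
      rw [this, limsup_const]
    have h2 := hclosed _ isClosed_noncrossing
    rw [h1] at h2
    exact (mem_ae_iff_prob_eq_one isClosed_noncrossing.measurableSet).mpr
      (le_antisymm prob_le_one h2)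
  -- The approximations have a lower bound on open sets, the limit an upper bound on closed ones. So
  -- `F` is fattened to an open thickening, then to a closed one, and the thickness is sent to `0`.
  · have hk : ∀ k : ℕ, coalLaw β y F ≤
        (ν : Measure PathSets) (hitSet (Metric.cthickening (1 / ((k : ℝ) + 1)) F)) := by
      intro k
      have hpos : (0 : ℝ) < 1 / ((k : ℝ) + 1) := by positivity
      calc coalLaw β y F ≤ coalLaw β y (Metric.thickening (1 / ((k : ℝ) + 1)) F) :=
            measure_mono (Metric.self_subset_thickening hpos F)
        _ ≤ liminf (fun n => (μ n : Measure PathSets)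
              (hitSet (Metric.thickening (1 / ((k : ℝ) + 1)) F))) atTop :=
            h.coalescing m y hy _ Metric.isOpen_thickening
        _ ≤ liminf (fun n => (μ n : Measure PathSets)
              (hitSet (Metric.thickening (1 / ((k : ℝ) + 1)) F))) l :=
            liminf_le_liminf_of_le hl
        _ ≤ limsup (fun n => (μ n : Measure PathSets)
              (hitSet (Metric.thickening (1 / ((k : ℝ) + 1)) F))) l := liminf_le_limsup
        _ ≤ limsup (fun n => (μ n : Measure PathSets)
              (hitSet (Metric.cthickening (1 / ((k : ℝ) + 1)) F))) l :=
            limsup_le_limsup (Eventually.of_forall fun n =>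
              measure_mono (hitSet_mono (Metric.thickening_subset_cthickening _ _)))
        _ ≤ _ := hclosed _ (isClosed_hitSet Metric.isClosed_cthickening)
    have hlim := tendsto_measure_iInter_atTop (μ := (ν : Measure PathSets))
      (s := fun k : ℕ => hitSet (Metric.cthickening (1 / ((k : ℝ) + 1)) F))
      (fun k => (isClosed_hitSet Metric.isClosed_cthickening).measurableSet.nullMeasurableSet)
      (fun k l hkl => hitSet_mono (Metric.cthickening_mono
        (one_div_le_one_div_of_le (by positivity) (by gcongr)) F)) ⟨0, measure_ne_top _ _⟩
    rw [iInter_hitSet_cthickening hF] at hlim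
    exact ge_of_tendsto' hlim hk
  · exact tendsto_of_tendsto_of_tendsto_of_le_of_le tendsto_const_nhds (h₁ t ht)
      (fun _ => zero_le) fun ε => hopen 1 t ε
  · exact tendsto_of_tendsto_of_tendsto_of_le_of_le tendsto_const_nhds (h₂ t ht)
      (fun _ => zero_le) fun ε => mul_le_mul_right (hopen 2 t ε) _

/-! ### Noncrossing sets of paths with paths from a dense set of points -/

lemma WebPath.startsAt_of_tendsto {ι : Type*} {l : Filter ι} [l.NeBot] {P : ι → WebPath}
    {q : WebPath} {y : ι → ℝ × ℝ} {y₀ : ℝ × ℝ} (hP : Tendsto P l (𝓝 q)) (hy : Tendsto y l (𝓝 y₀))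
    (h : ∀ k, (P k).StartsAt (y k)) : q.StartsAt y₀ := by
  have h2 : Tendsto (fun k => (y k).2) l (𝓝 y₀.2) := (continuous_snd.tendsto y₀).comp hy
  have h1 : Tendsto (fun k => (y k).1) l (𝓝 y₀.1) := (continuous_fst.tendsto y₀).comp hy
  constructor
  · refine tendsto_nhds_unique ((continuous_start.tendsto q).comp hP) ?_
    refine ((continuous_coe_real_ereal.tendsto y₀.2).comp h2).congr fun k => ?_
    exact (h k).1.symm
  · refine tendsto_nhds_unique
      ((continuous_eval₂.tendsto (q, y₀.2)).comp (hP.prodMk_nhds h2)) ?_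
    refine ((continuous_coe_real_ereal.tendsto y₀.1).comp h1).congr fun k => ?_
    exact (h k).2.symm

lemma WebPath.eq_of_startsAt {p q : WebPath} {y : ℝ × ℝ} (hp : p.StartsAt y) (hq : q.StartsAt y)
    (h : ∀ t : ℝ, y.2 < t → p t = q t) : p = q := by
  refine eq_of_start_eq (hp.1.trans hq.1.symm) fun t => ?_
  rcases lt_or_ge y.2 t with ht | ht
  · exact h t ht
  · have ht' : (t : EReal) ≤ y.2 := by exact_mod_cast ht
    rw [p.const_before t y.2 (hp.1 ▸ ht') hp.1.ge, q.const_before t y.2 (hq.1 ▸ ht') hq.1.ge, hp.2,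
      hq.2]

/-- A noncrossing set of paths that contains paths from the points of `D` and, among these, paths
arbitrarily far out over long time intervals. -/
structure IsRichWeb (D : Set (ℝ × ℝ)) (K : PathSets) : Prop where
  noncrossing : Noncrossing K
  exists_path : ∀ y ∈ D, ∃ p ∈ K, p.StartsAt y
  escape_top : ∀ k : ℕ, ∃ y ∈ D, y.2 < -k ∧ ∃ p ∈ K, p.StartsAt y ∧
    ∀ u ∈ Set.Icc (-(k : ℝ)) k, ((k : ℝ) : EReal) ≤ p u ∧ p u < ⊤
  escape_bot : ∀ k : ℕ, ∃ y ∈ D, y.2 < -k ∧ ∃ p ∈ K, p.StartsAt y ∧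
    ∀ u ∈ Set.Icc (-(k : ℝ)) k, ⊥ < p u ∧ p u ≤ ((-(k : ℝ) : ℝ) : EReal)

/-- The paths of `K` from points of `D`. -/
def pathsFrom (D : Set (ℝ × ℝ)) (K : PathSets) : Set WebPath :=
  {p | p ∈ K ∧ ∃ y ∈ D, p.StartsAt y}

lemma mem_closure_of_subseq {K : PathSets} {D : Set (ℝ × ℝ)} {p : WebPath} {P : ℕ → WebPath}
    (hP : ∀ k, P k ∈ pathsFrom D K)
    (h : ∀ q ∈ K, ∀ φ : ℕ → ℕ, StrictMono φ → Tendsto (P ∘ φ) atTop (𝓝 q) → q = p) :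
    p ∈ closure (pathsFrom D K) := by
  obtain ⟨q, hq, φ, hφ, hlim⟩ := K.isCompact.tendsto_subseq fun k => (hP k).1
  rw [← h q hq φ hφ hlim]
  exact mem_closure_of_tendsto hlim (Eventually.of_forall fun k => hP (φ k))

lemma exists_seq_dense {D : Set (ℝ × ℝ)} (hD : Dense D) (y : ℝ × ℝ) :
    ∃ u : ℕ → ℝ × ℝ, (∀ k, u k ∈ D) ∧ Tendsto u atTop (𝓝 y) :=
  mem_closure_iff_seq_limit.mp (hD y)

namespace IsRichWeb

variable {D : Set (ℝ × ℝ)} {K : PathSets}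

lemma exists_startsAt (h : IsRichWeb D K) (hD : Dense D) (y : ℝ × ℝ) :
    ∃ p ∈ K, p.StartsAt y := by
  obtain ⟨u, huD, hu⟩ := exists_seq_dense hD y
  choose P hPK hP using fun k => h.exists_path (u k) (huD k)
  obtain ⟨q, hq, φ, hφ, hlim⟩ := K.isCompact.tendsto_subseq hPK
  exact ⟨q, hq, startsAt_of_tendsto hlim (hu.comp hφ.tendsto_atTop) fun k => hP _⟩

/-- Points of `D` tending to `(x, t₀)` from strictly earlier times have paths that accumulate, by
compactness of `K`, at a path from `(x, t₀)`; at time `t₀` some of them are therefore within `ε` of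
`x`. -/
lemma exists_near (h : IsRichWeb D K) (hD : Dense D) (x t₀ : ℝ) {ε e : ℝ} (hε : 0 < ε)
    (he : 0 < e) : ∃ y ∈ D, y.2 ∈ Set.Ioo (t₀ - e) t₀ ∧ ∃ p ∈ K, p.StartsAt y ∧
      p t₀ ∈ Set.Ioo ((x - ε : ℝ) : EReal) ((x + ε : ℝ) : EReal) := by
  have hseq : ∀ k : ℕ, ∃ y ∈ D, y.1 ∈ Set.Ioo (x - 1 / ((k : ℝ) + 1)) (x + 1 / ((k : ℝ) + 1)) ∧
      y.2 ∈ Set.Ioo (t₀ - min e (1 / ((k : ℝ) + 1))) t₀ := by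
    intro k
    have hk : (0 : ℝ) < 1 / ((k : ℝ) + 1) := by positivity
    have hm : 0 < min e (1 / ((k : ℝ) + 1)) := lt_min he hk
    obtain ⟨y, hyD, hy1, hy2⟩ := hD.exists_mem_open
      (U := Set.Ioo (x - 1 / ((k : ℝ) + 1)) (x + 1 / ((k : ℝ) + 1)) ×ˢ
        Set.Ioo (t₀ - min e (1 / ((k : ℝ) + 1))) t₀) (isOpen_Ioo.prod isOpen_Ioo)
      ⟨(x, t₀ - min e (1 / ((k : ℝ) + 1)) / 2), ⟨by linarith, by linarith⟩, by linarith,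
        by linarith⟩
    exact ⟨y, hyD, hy1, hy2⟩
  choose y hyD hy1 hy2 using hseq
  have hinv : Tendsto (fun k : ℕ => 1 / ((k : ℝ) + 1)) atTop (𝓝 0) :=
    tendsto_one_div_add_atTop_nhds_zero_nat
  have hlim : Tendsto y atTop (𝓝 (x, t₀)) := by
    rw [Prod.tendsto_iff]
    constructor
    · refine tendsto_of_tendsto_of_tendsto_of_le_of_le (g := fun k : ℕ => x - 1 / ((k : ℝ) + 1))
        (h := fun k : ℕ => x + 1 / ((k : ℝ) + 1)) ?_ ?_ (fun k => (hy1 k).1.le)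
        (fun k => (hy1 k).2.le)
      · simpa using hinv.const_sub x
      · simpa using hinv.const_add x
    · refine tendsto_of_tendsto_of_tendsto_of_le_of_le (g := fun k : ℕ => t₀ - 1 / ((k : ℝ) + 1))
        (h := fun k : ℕ => t₀) ?_ tendsto_const_nhds (fun k => ?_) (fun k => (hy2 k).2.le)
      · simpa using hinv.const_sub t₀
      · have := min_le_right e (1 / ((k : ℝ) + 1))
        have := (hy2 k).1
        simp only
        linarith
  choose P hPK hP using fun k => h.exists_path (y k) (hyD k)
  obtain ⟨q, hq, φ, hφ, hPq⟩ := K.isCompact.tendsto_subseq hPK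
  have hqs := startsAt_of_tendsto hPq (hlim.comp hφ.tendsto_atTop) fun k => hP _
  have hval : Tendsto (fun k => P (φ k) t₀) atTop (𝓝 (x : EReal)) := by
    have := ((continuous_eval t₀).tendsto q).comp hPq
    rwa [show q t₀ = (x : EReal) from hqs.2] at this
  have hev := hval.eventually (Ioo_mem_nhds
    (show ((x - ε : ℝ) : EReal) < x by exact_mod_cast (by linarith : x - ε < x))
    (show (x : EReal) < ((x + ε : ℝ) : EReal) by exact_mod_cast (by linarith : x < x + ε)))
  obtain ⟨k, hk⟩ := hev.exists
  refine ⟨y (φ k), hyD _, ⟨?_, (hy2 _).2⟩, P (φ k), hPK _, hP _, hk⟩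
  have := (hy2 (φ k)).1
  have := min_le_left e (1 / ((φ k : ℝ) + 1))
  linarith

lemma exists_real_near_natCast (x : EReal) (hx : x < ⊤) (s t : ℝ) :
    ∃ k : ℕ, x < ((k : ℝ) : EReal) ∧ s ∈ Set.Icc (-(k : ℝ)) k ∧ t ∈ Set.Icc (-(k : ℝ)) k := by
  obtain ⟨r, hr, -⟩ := EReal.lt_iff_exists_real_btwn.mp hx
  obtain ⟨k, hk⟩ := exists_nat_gt (max r (max |s| |t|))
  refine ⟨k, hr.trans ?_, abs_le.mp ?_, abs_le.mp ?_⟩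
  · exact_mod_cast (le_max_left _ _).trans_lt hk
  · exact ((le_max_left _ _).trans (le_max_right _ _)).trans hk.le
  · exact ((le_max_right _ _).trans (le_max_right _ _)).trans hk.le

/-- A path that is at `+∞` at one time and lower at another would cross a finite path that stays far
to the right over a time interval containing both times. -/
lemma eq_top (h : IsRichWeb D K) {p : WebPath} (hp : p ∈ K) {s t : ℝ} (hs : p.start ≤ s)
    (hps : p s = ⊤) (ht : p.start ≤ t) : p t = ⊤ := by
  by_contra hne
  obtain ⟨k, hk, hsk, htk⟩ := exists_real_near_natCast (p t) (lt_top_iff_ne_top.mpr hne) s t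
  obtain ⟨y, -, hyk, q, hq, hqs, hqk⟩ := h.escape_top k
  have hqstart : ∀ u ∈ Set.Icc (-(k : ℝ)) k, q.start ≤ (u : EReal) := fun u hu => by
    rw [hqs.1]
    exact_mod_cast hyk.le.trans hu.1
  exact h.noncrossing q hq p hp ⟨s, t, max_le (hqstart s hsk) hs, max_le (hqstart t htk) ht,
    by rw [hps]; exact (hqk s hsk).2, hk.trans_le (hqk t htk).1⟩

lemma eq_bot (h : IsRichWeb D K) {p : WebPath} (hp : p ∈ K) {s t : ℝ} (hs : p.start ≤ s)
    (hps : p s = ⊥) (ht : p.start ≤ t) : p t = ⊥ := by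
  by_contra hne
  have hlt : -(p t) < ⊤ := by
    rw [lt_top_iff_ne_top]
    simpa using hne
  obtain ⟨k, hk, hsk, htk⟩ := exists_real_near_natCast _ hlt s t
  obtain ⟨y, -, hyk, q, hq, hqs, hqk⟩ := h.escape_bot k
  have hqstart : ∀ u ∈ Set.Icc (-(k : ℝ)) k, q.start ≤ (u : EReal) := fun u hu => by
    rw [hqs.1]
    exact_mod_cast hyk.le.trans hu.1
  refine h.noncrossing p hp q hq ⟨s, t, max_le hs (hqstart s hsk), max_le ht (hqstart t htk),
    by rw [hps]; exact (hqk s hsk).1, (hqk t htk).2.trans_lt ?_⟩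
  rw [EReal.coe_neg]
  exact EReal.neg_lt_comm.mp hk

lemma ne_top_bot (h : IsRichWeb D K) {p : WebPath} (hp : p ∈ K) {s t x : ℝ} (hs : p.start ≤ s)
    (hps : p s = (x : EReal)) (ht : p.start ≤ t) : p t ≠ ⊤ ∧ p t ≠ ⊥ := by
  constructor
  · intro hc
    have := h.eq_top hp ht hc hs
    rw [hps] at this
    exact EReal.coe_ne_top x this
  · intro hc
    have := h.eq_bot hp ht hc hs
    rw [hps] at this
    exact EReal.coe_ne_bot x this

lemma le_of_lt (h : Noncrossing K) {p q : WebPath} (hp : p ∈ K) (hq : q ∈ K) {s t : ℝ}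
    (hps : p.start ≤ s) (hqs : q.start ≤ s) (hlt : p s < q s) (hst : s ≤ t) : p t ≤ q t := by
  by_contra hc
  have hst' : (s : EReal) ≤ t := by exact_mod_cast hst
  exact h p hp q hq ⟨s, t, max_le hps hqs, max_le (hps.trans hst') (hqs.trans hst'), hlt,
    not_le.mp hc⟩

end IsRichWeb

/-! ### Thin coalescing webs: paths follow paths from `D` -/

/-- Paths of `K` from `D` coalesce when they meet. -/
def CoalescesOn (D : Set (ℝ × ℝ)) (K : PathSets) : Prop :=
  ∀ p ∈ pathsFrom D K, ∀ q ∈ pathsFrom D K, Sticky p q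

/-- At rational times, no three paths of `K` through nearby points stay apart. -/
def IsThin (K : PathSets) : Prop :=
  ∀ t₀ t : ℚ, 0 < t → ∀ x : ℝ, ∃ ε > 0, K ∉ spreadEvent 2 t₀ t (x - ε) (x + ε)

/-- As long as `A` and `B` are apart, the two closed sets `p = A` and `p = B` are disjoint and
cannot share an interval; once `A` and `B` have met, the choice no longer matters. -/
lemma WebPath.eqOn_of_forall_eq_or {p A B : WebPath} {s₀ : ℝ}
    (hAB : ∀ s t : ℝ, s₀ ≤ s → A s = B s → s ≤ t → A t = B t)
    (h : ∀ s, s₀ ≤ s → p s = A s ∨ p s = B s) :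
    (∀ s, s₀ ≤ s → p s = A s) ∨ ∀ s, s₀ ≤ s → p s = B s := by
  have key : ∀ (A B : WebPath), (∀ s t : ℝ, s₀ ≤ s → A s = B s → s ≤ t → A t = B t) →
      (∀ s, s₀ ≤ s → p s = A s ∨ p s = B s) → p s₀ = A s₀ → ∀ s, s₀ ≤ s → p s = A s := by
    intro A B hAB h h0 s₁ hs₁
    by_contra hne
    have hB1 := (h s₁ hs₁).resolve_left hne
    have hdis : ∀ s ∈ Set.Icc s₀ s₁, A s ≠ B s := fun s hs hc =>
      hne (hB1.trans (hAB s s₁ hs.1 hc hs.2).symm)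
    have hcA : IsClosed {s : ℝ | p s = A s} := isClosed_eq p.toMap.continuous A.toMap.continuous
    have hcB : IsClosed {s : ℝ | p s = B s} := isClosed_eq p.toMap.continuous B.toMap.continuous
    have := isPreconnected_closed_iff.mp (isPreconnected_Icc (a := s₀) (b := s₁)) _ _ hcA hcB
      (fun s hs => h s hs.1) ⟨s₀, ⟨le_rfl, hs₁⟩, h0⟩ ⟨s₁, ⟨hs₁, le_rfl⟩, hB1⟩
    obtain ⟨s, hs, h1, h2⟩ := this
    exact hdis s hs (h1.symm.trans h2)
  rcases h s₀ le_rfl with h0 | h0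
  · exact Or.inl (key A B hAB h h0)
  · exact Or.inr (key B A (fun s t hs he hst => (hAB s t hs he.symm hst).symm)
      (fun s hs => (h s hs).symm) h0)

lemma IsThin.eq_or_eq_or_eq {K : PathSets} (hK : IsThin K) {t₀ t : ℚ} (ht : 0 < t) (x : ℝ) :
    ∃ ε > 0, ∀ p ∈ K, ∀ q ∈ K, ∀ r ∈ K, (∀ s ∈ ({p, q, r} : Set WebPath), s.start < (t₀ : ℝ) ∧
      s t₀ ∈ Set.Ioo ((x - ε : ℝ) : EReal) ((x + ε : ℝ) : EReal) ∧
      s (t₀ + t) ∈ Set.Ioo (⊥ : EReal) ⊤) →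
      p (t₀ + t) = q (t₀ + t) ∨ q (t₀ + t) = r (t₀ + t) ∨ p (t₀ + t) = r (t₀ + t) := by
  obtain ⟨ε, hε, hno⟩ := hK t₀ t ht x
  refine ⟨ε, hε, fun p hp q hq r hr hall => ?_⟩
  by_contra hcon
  push Not at hcon
  obtain ⟨h1, h2, h3⟩ := hcon
  refine hno ⟨![p, q, r], fun j => ?_, fun j => ?_⟩
  · have hj : ![p, q, r] j ∈ ({p, q, r} : Set WebPath) := by fin_cases j <;> simp
    refine ⟨(hall _ hj).1, (hall _ hj).2.1, (hall _ hj).2.2, fun i hij => ?_⟩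
    fin_cases i <;> fin_cases j <;>
      first
      | exact absurd rfl hij
      | exact h1
      | exact h2
      | exact h3
      | exact h1.symm
      | exact h2.symm
      | exact h3.symm
  · fin_cases j
    · exact hp
    · exact hq
    · exact hr

namespace IsRichWeb

variable {D : Set (ℝ × ℝ)} {K : PathSets}

/-- A path of a thin coalescing web eventually follows a path from `D`. -/
theorem exists_eqOn (h : IsRichWeb D K) (hD : Dense D) (hco : CoalescesOn D K) (hthin : IsThin K)
    {p : WebPath} (hp : p ∈ K) {t₀ δ : ℚ} (hδ : 0 < δ) (hstart : p.start < (t₀ : ℝ)) {x : ℝ}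
    (hx : p t₀ = (x : EReal)) {e : ℝ} (he : 0 < e) :
    ∃ y ∈ D, y.2 ∈ Set.Ioo ((t₀ : ℝ) - e) t₀ ∧ ∃ q ∈ K, q.StartsAt y ∧
      ∀ s : ℝ, t₀ + δ ≤ s → p s = q s := by
  -- paths from `D` on both sides of `p`, at distance less than `ε` from it at time `t₀`
  have hside : ∀ ε : ℝ, 0 < ε →
      (∃ y ∈ D, y.2 ∈ Set.Ioo ((t₀ : ℝ) - e) t₀ ∧ ∃ q ∈ K, q.StartsAt y ∧
        q t₀ ∈ Set.Ioo ((x - ε : ℝ) : EReal) (x : ℝ)) ∧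
      (∃ y ∈ D, y.2 ∈ Set.Ioo ((t₀ : ℝ) - e) t₀ ∧ ∃ q ∈ K, q.StartsAt y ∧
        q t₀ ∈ Set.Ioo ((x : ℝ) : EReal) ((x + ε : ℝ) : EReal)) := by
    intro ε hε
    obtain ⟨y, hy, hye, q, hq, hqy, hqt⟩ := h.exists_near hD (x - ε / 2) t₀ (half_pos hε) he
    obtain ⟨y', hy', hye', q', hq', hqy', hqt'⟩ := h.exists_near hD (x + ε / 2) t₀ (half_pos hε) he
    refine ⟨⟨y, hy, hye, q, hq, hqy, ?_⟩, ⟨y', hy', hye', q', hq', hqy', ?_⟩⟩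
    · convert hqt using 3 <;> ring
    · convert hqt' using 3 <;> ring
  have hfin : ∀ q ∈ K, ∀ a b : ℝ, q.start < (t₀ : ℝ) → q t₀ ∈ Set.Ioo (a : EReal) b →
      ∀ s : ℝ, t₀ ≤ s → q s ∈ Set.Ioo (⊥ : EReal) ⊤ := by
    intro q hq a b hqs hab s hs
    have hs' : ((t₀ : ℝ) : EReal) ≤ s := by exact_mod_cast hs
    obtain ⟨h3, h4⟩ := h.ne_top_bot hq hqs.le
      (EReal.coe_toReal (hab.2.trans (EReal.coe_lt_top _)).ne
        ((EReal.bot_lt_coe _).trans hab.1).ne').symm (hqs.le.trans hs')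
    exact ⟨bot_lt_iff_ne_bot.mpr h4, lt_top_iff_ne_top.mpr h3⟩
  have hst : ∀ (q : WebPath) (y : ℝ × ℝ), q.StartsAt y → y.2 ∈ Set.Ioo ((t₀ : ℝ) - e) t₀ →
      q.start < (t₀ : ℝ) := fun q y hq hy => by
    rw [hq.1]
    exact_mod_cast hy.2
  -- three paths near `x` at time `t₀` take at most two values at time `t₀ + t`
  have htri : ∀ t : ℚ, 0 < t → ∃ ε > 0, ∀ q₁ ∈ K, ∀ q₂ ∈ K, ∀ q₃ ∈ K,
      (∀ q ∈ ({q₁, q₂, q₃} : Set WebPath), q.start < (t₀ : ℝ) ∧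
        q t₀ ∈ Set.Ioo ((x - ε : ℝ) : EReal) ((x + ε : ℝ) : EReal)) →
      q₁ (t₀ + t) = q₂ (t₀ + t) ∨ q₂ (t₀ + t) = q₃ (t₀ + t) ∨ q₁ (t₀ + t) = q₃ (t₀ + t) := by
    intro t ht
    obtain ⟨ε, hε, H⟩ := hthin.eq_or_eq_or_eq (t₀ := t₀) ht x
    refine ⟨ε, hε, fun q₁ h1 q₂ h2 q₃ h3 hall => H q₁ h1 q₂ h2 q₃ h3 fun q hq => ?_⟩
    have hqK : q ∈ K := by
      rcases hq with rfl | rfl | rfl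
      · exact h1
      · exact h2
      · exact h3
    have ht' : (0 : ℝ) < t := by exact_mod_cast ht
    exact ⟨(hall q hq).1, (hall q hq).2, hfin q hqK _ _ (hall q hq).1 (hall q hq).2 _ (by linarith)⟩
  have hIoo : ∀ ε ε' : ℝ, 0 < ε → ε ≤ ε' → ∀ z : EReal,
      (z ∈ Set.Ioo ((x - ε : ℝ) : EReal) (x : ℝ) ∨ z = (x : ℝ) ∨
        z ∈ Set.Ioo ((x : ℝ) : EReal) ((x + ε : ℝ) : EReal)) →
      z ∈ Set.Ioo ((x - ε' : ℝ) : EReal) ((x + ε' : ℝ) : EReal) := by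
    intro ε ε' hε hεε' z hz
    have e1 : ((x - ε' : ℝ) : EReal) ≤ ((x - ε : ℝ) : EReal) := by
      exact_mod_cast (by linarith : x - ε' ≤ x - ε)
    have e2 : ((x - ε : ℝ) : EReal) < (x : ℝ) := by exact_mod_cast (by linarith : x - ε < x)
    have e3 : ((x : ℝ) : EReal) < ((x + ε : ℝ) : EReal) := by
      exact_mod_cast (by linarith : x < x + ε)
    have e4 : ((x + ε : ℝ) : EReal) ≤ ((x + ε' : ℝ) : EReal) := by
      exact_mod_cast (by linarith : x + ε ≤ x + ε')
    rcases hz with hz | rfl | hz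
    · exact ⟨e1.trans_lt hz.1, hz.2.trans (e3.trans_le e4)⟩
    · exact ⟨e1.trans_lt e2, e3.trans_le e4⟩
    · exact ⟨(e1.trans_lt e2).trans hz.1, hz.2.trans_le e4⟩
  have hle : ∀ q ∈ K, q.start < (t₀ : ℝ) → ∀ s : ℝ, t₀ ≤ s →
      (q t₀ < (x : ℝ) → q s ≤ p s) ∧ ((x : EReal) < q t₀ → p s ≤ q s) := by
    intro q hq hqs s hs
    refine ⟨fun hlt => ?_, fun hlt => ?_⟩
    · exact le_of_lt h.noncrossing hq hp hqs.le hstart.le (by rw [hx]; exact hlt) hs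
    · exact le_of_lt h.noncrossing hp hq hstart.le hqs.le (by rw [hx]; exact hlt) hs
  have hδ' : (0 : ℝ) < δ := by exact_mod_cast hδ
  obtain ⟨ε₀, hε₀, htri₀⟩ := htri δ hδ
  have hstick : ∀ q ∈ pathsFrom D K, ∀ q' ∈ pathsFrom D K, q.start < (t₀ : ℝ) →
      q'.start < (t₀ : ℝ) → ∀ s t : ℝ, (t₀ : ℝ) ≤ s → q s = q' s → s ≤ t → q t = q' t := by
    intro q hq q' hq' h1 h2 s t hs heq hst
    have hs' : ((t₀ : ℝ) : EReal) ≤ s := by exact_mod_cast hs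
    exact hco q hq q' hq' s ⟨h1.le.trans hs', h2.le.trans hs', heq⟩ t hst
  -- If a left and a right neighbour agree at time `t₀ + δ`, they agree from then on and `p`, which
  -- lies between them, is squeezed.
  by_cases hmeet : ∃ yA ∈ D, yA.2 ∈ Set.Ioo ((t₀ : ℝ) - e) t₀ ∧ ∃ A ∈ K, A.StartsAt yA ∧
      A t₀ ∈ Set.Ioo ((x - ε₀ : ℝ) : EReal) (x : ℝ) ∧
      ∃ yB ∈ D, yB.2 ∈ Set.Ioo ((t₀ : ℝ) - e) t₀ ∧ ∃ B ∈ K, B.StartsAt yB ∧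
      B t₀ ∈ Set.Ioo ((x : ℝ) : EReal) ((x + ε₀ : ℝ) : EReal) ∧ A (t₀ + δ) = B (t₀ + δ)
  · obtain ⟨yA, hyA, hyAe, A, hA, hAs, hAx, yB, hyB, hyBe, B, hB, hBs, hBx, heq⟩ := hmeet
    refine ⟨yA, hyA, hyAe, A, hA, hAs, fun s hs => ?_⟩
    have hs₀ : (t₀ : ℝ) ≤ s := by linarith
    have hAB := hstick A ⟨hA, yA, hyA, hAs⟩ B ⟨hB, yB, hyB, hBs⟩ (hst _ _ hAs hyAe)
      (hst _ _ hBs hyBe) _ s (by linarith) heq hs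
    refine le_antisymm ?_ ((hle A hA (hst _ _ hAs hyAe) s hs₀).1 hAx.2)
    rw [hAB]
    exact (hle B hB (hst _ _ hBs hyBe) s hs₀).2 hBx.1
  push Not at hmeet
  obtain ⟨⟨yA, hyA, hyAe, A, hA, hAs, hAx⟩, ⟨yB, hyB, hyBe, B, hB, hBs, hBx⟩⟩ := hside ε₀ hε₀
  have hAB := hmeet yA hyA hyAe A hA hAs hAx yB hyB hyBe B hB hBs hBx
  -- Otherwise one pair `A`, `B` is fixed. For each later time a closer pair `A'`, `B'` is chosen,
  -- near enough for thinness at that time; it is shown to have joined `A` and `B`.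
  have hrat : ∀ t : ℚ, δ ≤ t → p (t₀ + t) = A (t₀ + t) ∨ p (t₀ + t) = B (t₀ + t) := by
    intro t ht
    obtain ⟨ε₁, hε₁, htri₁⟩ := htri t (hδ.trans_le ht)
    have hε : 0 < min ε₀ ε₁ := lt_min hε₀ hε₁
    obtain ⟨⟨yA', hyA', hyAe', A', hA', hAs', hAx'⟩, ⟨yB', hyB', hyBe', B', hB', hBs', hBx'⟩⟩ :=
      hside _ hε
    have ht' : (δ : ℝ) ≤ t := by exact_mod_cast ht
    have hAx0 : A' t₀ ∈ Set.Ioo ((x - ε₀ : ℝ) : EReal) (x : ℝ) :=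
      ⟨lt_of_le_of_lt (by exact_mod_cast (by linarith [min_le_left ε₀ ε₁] :
        x - ε₀ ≤ x - min ε₀ ε₁)) hAx'.1, hAx'.2⟩
    have hBx0 : B' t₀ ∈ Set.Ioo ((x : ℝ) : EReal) ((x + ε₀ : ℝ) : EReal) :=
      ⟨hBx'.1, lt_of_lt_of_le hBx'.2 (by exact_mod_cast (by linarith [min_le_left ε₀ ε₁] :
        x + min ε₀ ε₁ ≤ x + ε₀))⟩
    -- At time `t₀ + δ` the paths `A`, `A'`, `B` take at most two values, and no left neighbour
    -- agrees with a right one, so `A'` agrees with `A`.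
    have hAA : A' (t₀ + t) = A (t₀ + t) := by
      have h1 := htri₀ A hA A' hA' B hB fun q hq => by
        rcases hq with rfl | rfl | rfl
        · exact ⟨hst _ _ hAs hyAe, hIoo _ _ hε₀ le_rfl _ (Or.inl hAx)⟩
        · exact ⟨hst _ _ hAs' hyAe', hIoo _ _ hε₀ le_rfl _ (Or.inl hAx0)⟩
        · exact ⟨hst _ _ hBs hyBe, hIoo _ _ hε₀ le_rfl _ (Or.inr (Or.inr hBx))⟩
      have h2 : A' (t₀ + δ) = A (t₀ + δ) := by
        rcases h1 with h1 | h1 | h1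
        · exact h1.symm
        · exact absurd h1 (hmeet yA' hyA' hyAe' A' hA' hAs' hAx0 yB hyB hyBe B hB hBs hBx)
        · exact absurd h1 hAB
      exact hstick A' ⟨hA', yA', hyA', hAs'⟩ A ⟨hA, yA, hyA, hAs⟩ (hst _ _ hAs' hyAe')
        (hst _ _ hAs hyAe) _ _ (by linarith) h2 (by linarith)
    have hBB : B' (t₀ + t) = B (t₀ + t) := by
      have h1 := htri₀ A hA B' hB' B hB fun q hq => by
        rcases hq with rfl | rfl | rfl
        · exact ⟨hst _ _ hAs hyAe, hIoo _ _ hε₀ le_rfl _ (Or.inl hAx)⟩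
        · exact ⟨hst _ _ hBs' hyBe', hIoo _ _ hε₀ le_rfl _ (Or.inr (Or.inr hBx0))⟩
        · exact ⟨hst _ _ hBs hyBe, hIoo _ _ hε₀ le_rfl _ (Or.inr (Or.inr hBx))⟩
      have h2 : B' (t₀ + δ) = B (t₀ + δ) := by
        rcases h1 with h1 | h1 | h1
        · exact absurd h1 (hmeet yA hyA hyAe A hA hAs hAx yB' hyB' hyBe' B' hB' hBs' hBx0)
        · exact h1
        · exact absurd h1 hAB
      exact hstick B' ⟨hB', yB', hyB', hBs'⟩ B ⟨hB, yB, hyB, hBs⟩ (hst _ _ hBs' hyBe')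
        (hst _ _ hBs hyBe) _ _ (by linarith) h2 (by linarith)
    have h3 := htri₁ A' hA' p hp B' hB' fun q hq => by
      rcases hq with rfl | rfl | rfl
      · exact ⟨hst _ _ hAs' hyAe', hIoo _ _ hε (min_le_right _ _) _ (Or.inl hAx')⟩
      · exact ⟨hstart, hIoo _ _ hε (min_le_right _ _) _ (Or.inr (Or.inl hx))⟩
      · exact ⟨hst _ _ hBs' hyBe', hIoo _ _ hε (min_le_right _ _) _ (Or.inr (Or.inr hBx'))⟩
    rcases h3 with h3 | h3 | h3
    · exact Or.inl (h3.symm.trans hAA)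
    · exact Or.inr (h3.trans hBB)
    -- `A'` and `B'` agree at this time, and `p` lies between them.
    · refine Or.inl (le_antisymm ?_ ?_)
      · rw [← hAA, h3]
        exact (hle B' hB' (hst _ _ hBs' hyBe') _ (by linarith)).2 hBx'.1
      · exact (hle A hA (hst _ _ hAs hyAe) _ (by linarith)).1 hAx.2
  have hall : ∀ s : ℝ, t₀ + δ ≤ s → p s = A s ∨ p s = B s := by
    intro s hs
    by_contra hcon
    have ho : IsOpen {s : ℝ | ¬ (p s = A s ∨ p s = B s)} :=
      ((isClosed_eq p.toMap.continuous A.toMap.continuous).union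
        (isClosed_eq p.toMap.continuous B.toMap.continuous)).isOpen_compl
    obtain ⟨ε, hε, hball⟩ := Metric.isOpen_iff.mp ho s hcon
    obtain ⟨r, hr1, hr2⟩ := exists_rat_btwn (show s < s + ε by linarith)
    refine hball (show (r : ℝ) ∈ Metric.ball s ε from ?_) ?_
    · rw [Metric.mem_ball, Real.dist_eq, abs_of_pos (by linarith)]
      linarith
    · have h1 := hrat (r - t₀) (by
        have : (t₀ : ℝ) + δ ≤ r := by linarith
        have : t₀ + δ ≤ r := by exact_mod_cast this
        linarith)
      have e : (t₀ : ℝ) + ((r - t₀ : ℚ) : ℝ) = r := by push_cast; ring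
      rwa [e] at h1
  rcases eqOn_of_forall_eq_or (fun s t hs heq hst' => hstick A ⟨hA, yA, hyA, hAs⟩ B
    ⟨hB, yB, hyB, hBs⟩ (hst _ _ hAs hyAe) (hst _ _ hBs hyBe) s t (by linarith) heq hst') hall
    with H | H
  · exact ⟨yA, hyA, hyAe, A, hA, hAs, H⟩
  · exact ⟨yB, hyB, hyBe, B, hB, hBs, H⟩

end IsRichWeb

/-! ### The web as the closure of its paths from `D` -/

lemma WebPath.eq_of_forall_gt {p q : WebPath} (hs : p.start = q.start) (hne : p.start ≠ ⊤)
    (h : ∀ t : ℝ, p.start < t → p t = q t) : p = q := by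
  refine eq_of_start_eq hs fun t => ?_
  rcases lt_or_ge p.start t with ht | ht
  · exact h t ht
  obtain ⟨σ, hσ⟩ : ∃ σ : ℝ, p.start = σ :=
    ⟨p.start.toReal, (EReal.coe_toReal hne (((EReal.bot_lt_coe t).trans_le ht).ne')).symm⟩
  have hσeq : p σ = q σ := by
    have hcl : IsClosed {t : ℝ | p t = q t} := isClosed_eq p.toMap.continuous q.toMap.continuous
    have hsub : Set.Ioi σ ⊆ {t : ℝ | p t = q t} := fun t ht => h t (by
      rw [hσ]
      exact_mod_cast ht)
    have := hcl.closure_subset_iff.mpr hsub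
    rw [closure_Ioi] at this
    exact this (Set.mem_Ici.mpr le_rfl)
  rw [p.const_before t σ ht hσ.ge, q.const_before t σ (hs ▸ ht) (hs ▸ hσ.ge), hσeq]

lemma denseRange_coe_ereal : DenseRange ((↑) : ℝ → EReal) := by
  refine dense_of_exists_between fun {a b} hab => ?_
  obtain ⟨r, h1, h2⟩ := EReal.lt_iff_exists_real_btwn.mp hab
  exact ⟨r, ⟨r, rfl⟩, h1, h2⟩

lemma exists_seq_dense_ereal {D : Set (ℝ × ℝ)} (hD : Dense D) (c τ : EReal) :
    ∃ u : ℕ → ℝ × ℝ, (∀ k, u k ∈ D) ∧ Tendsto (fun k => ((u k).1 : EReal)) atTop (𝓝 c) ∧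
      Tendsto (fun k => ((u k).2 : EReal)) atTop (𝓝 τ) := by
  have hdr : DenseRange (Prod.map ((↑) : ℝ → EReal) ((↑) : ℝ → EReal)) :=
    denseRange_coe_ereal.prodMap denseRange_coe_ereal
  have hd := hdr.dense_image (continuous_coe_real_ereal.prodMap continuous_coe_real_ereal) hD
  obtain ⟨v, hv, hlim⟩ := mem_closure_iff_seq_limit.mp (hd (c, τ))
  choose u huD hu using hv
  refine ⟨u, huD, ((continuous_fst.tendsto _).comp hlim).congr fun k => ?_,
    ((continuous_snd.tendsto _).comp hlim).congr fun k => ?_⟩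
  · rw [Function.comp_apply, ← hu k]
    rfl
  · rw [Function.comp_apply, ← hu k]
    rfl

lemma exists_seq_rat_gt {τ : EReal} (hτ : τ < ⊤) : ∃ t : ℕ → ℚ, (∀ k, τ < ((t k : ℝ) : EReal)) ∧
    Tendsto (fun k => ((t k : ℝ) : EReal)) atTop (𝓝 τ) := by
  obtain ⟨u, hu, hmem, hlim⟩ := exists_seq_strictAnti_tendsto' hτ
  choose t ht1 ht2 using fun k => EReal.exists_rat_btwn_of_lt (hu (Nat.lt_succ_self k))
  exact ⟨t, fun k => (hmem _).1.trans (ht1 k), tendsto_of_tendsto_of_tendsto_of_le_of_le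
    ((tendsto_add_atTop_iff_nat 1).mpr hlim) hlim (fun k => (ht1 k).le) fun k => (ht2 k).le⟩

lemma tendsto_coe_add_of_tendsto {u v : ℕ → ℝ} {τ : EReal}
    (hu : Tendsto (fun k => (u k : EReal)) atTop (𝓝 τ)) (hv : Tendsto v atTop (𝓝 0)) :
    Tendsto (fun k => ((u k + v k : ℝ) : EReal)) atTop (𝓝 τ) := by
  have h := (continuous_add_coe.tendsto (τ, 0)).comp (hu.prodMk_nhds hv)
  simp only [EReal.coe_zero, add_zero] at h
  exact h.congr fun k => by simp

namespace IsRichWeb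

variable {D : Set (ℝ × ℝ)} {K : PathSets}

/-- Choose points of `D` that tend to `(c, p.start)` in the compactified plane. A limit of paths of
`K` from these points starts at time `p.start` and equals `c` before it; the hypothesis says that
this identifies `p`. -/
lemma mem_closure_of_limit (h : IsRichWeb D K) (hD : Dense D) {p : WebPath} (c : EReal)
    (hp : ∀ q ∈ K, q.start = p.start → (∀ t : ℝ, (t : EReal) < p.start → q t = c) → q = p) :
    p ∈ closure (pathsFrom D K) := by
  obtain ⟨u, huD, hu1, hu2⟩ := exists_seq_dense_ereal hD c p.start
  choose P hPK hP using fun k => h.exists_path (u k) (huD k)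
  refine mem_closure_of_subseq (P := P) (fun k => ⟨hPK k, u k, huD k, hP k⟩)
    fun q hq φ hφ hlim => ?_
  refine hp q hq ?_ fun t ht => ?_
  · refine tendsto_nhds_unique ((continuous_start.tendsto q).comp hlim) ?_
    exact (hu2.comp hφ.tendsto_atTop).congr fun k => ((hP (φ k)).1).symm
  · refine tendsto_nhds_unique (((continuous_eval t).tendsto q).comp hlim) ?_
    refine (hu1.comp hφ.tendsto_atTop).congr' ?_
    filter_upwards [(hu2.comp hφ.tendsto_atTop).eventually_const_lt ht] with k hk
    have hk' : (t : EReal) ≤ (P (φ k)).start := by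
      rw [(hP (φ k)).1]
      exact hk.le
    change _ = P (φ k) t
    rw [(P (φ k)).const_before t _ hk' (hP (φ k)).1.ge, (hP (φ k)).2]
    rfl

/-- For a path from time `-∞` the approximations are the escaping paths. For a finite starting time,
a limit of paths from points tending to `+∞` in space is at `+∞` when it starts and can never come
back. -/
lemma mem_closure_top (h : IsRichWeb D K) (hD : Dense D) {p : WebPath} (hs : p.start ≠ ⊤)
    (hp : ∀ t : ℝ, p t = ⊤) : p ∈ closure (pathsFrom D K) := by
  by_cases hb : p.start = ⊥
  · choose y hyD hyk P hPK hP hPk using h.escape_top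
    refine mem_closure_of_subseq (P := P) (fun k => ⟨hPK k, y k, hyD k, hP k⟩)
      fun q hq φ hφ hlim => ?_
    have hnat : Tendsto (fun k => (φ k : ℝ)) atTop atTop :=
      tendsto_natCast_atTop_atTop.comp hφ.tendsto_atTop
    refine eq_of_start_eq ?_ fun t => ?_
    · rw [hb]
      refine tendsto_nhds_unique ((continuous_start.tendsto q).comp hlim) ?_
      have h1 : Tendsto (fun k => (y (φ k)).2) atTop atBot :=
        tendsto_atBot_mono (fun k => (hyk (φ k)).le) (tendsto_neg_atTop_atBot.comp hnat)
      exact (EReal.tendsto_coe_atBot.comp h1).congr fun k => ((hP (φ k)).1).symm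
    · rw [hp]
      refine tendsto_nhds_unique (((continuous_eval t).tendsto q).comp hlim) ?_
      refine tendsto_nhds_top_mono (EReal.tendsto_coe_atTop.comp hnat) ?_
      filter_upwards [hnat.eventually_ge_atTop |t|] with k hk
      exact (hPk (φ k) t (abs_le.mp hk)).1
  · obtain ⟨σ, hσ⟩ : ∃ σ : ℝ, p.start = σ := ⟨p.start.toReal, (EReal.coe_toReal hs hb).symm⟩
    refine h.mem_closure_of_limit hD ⊤ fun q hq hqs hqt => ?_
    refine eq_of_start_eq hqs fun t => ?_
    rw [hp]
    rcases lt_or_ge (t : EReal) p.start with ht | ht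
    · exact hqt t ht
    · have h1 : q (σ - 1) = ⊤ := hqt _ (by rw [hσ]; exact_mod_cast (by linarith : σ - 1 < σ))
      have h2 : q σ = ⊤ := by
        rw [← h1]
        refine q.const_before _ _ (by rw [hqs, hσ]) ?_
        rw [hqs, hσ]
        exact_mod_cast (by linarith : σ - 1 ≤ σ)
      exact h.eq_top hq (by rw [hqs, hσ]) h2 (hqs ▸ ht)

lemma mem_closure_bot (h : IsRichWeb D K) (hD : Dense D) {p : WebPath} (hs : p.start ≠ ⊤)
    (hp : ∀ t : ℝ, p t = ⊥) : p ∈ closure (pathsFrom D K) := by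
  by_cases hb : p.start = ⊥
  · choose y hyD hyk P hPK hP hPk using h.escape_bot
    refine mem_closure_of_subseq (P := P) (fun k => ⟨hPK k, y k, hyD k, hP k⟩)
      fun q hq φ hφ hlim => ?_
    have hnat : Tendsto (fun k => (φ k : ℝ)) atTop atTop :=
      tendsto_natCast_atTop_atTop.comp hφ.tendsto_atTop
    refine eq_of_start_eq ?_ fun t => ?_
    · rw [hb]
      refine tendsto_nhds_unique ((continuous_start.tendsto q).comp hlim) ?_
      have h1 : Tendsto (fun k => (y (φ k)).2) atTop atBot :=
        tendsto_atBot_mono (fun k => (hyk (φ k)).le) (tendsto_neg_atTop_atBot.comp hnat)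
      exact (EReal.tendsto_coe_atBot.comp h1).congr fun k => ((hP (φ k)).1).symm
    · rw [hp]
      refine tendsto_nhds_unique (((continuous_eval t).tendsto q).comp hlim) ?_
      refine tendsto_nhds_bot_mono
        (EReal.tendsto_coe_atBot.comp (tendsto_neg_atTop_atBot.comp hnat)) ?_
      filter_upwards [hnat.eventually_ge_atTop |t|] with k hk
      exact (hPk (φ k) t (abs_le.mp hk)).2
  · obtain ⟨σ, hσ⟩ : ∃ σ : ℝ, p.start = σ := ⟨p.start.toReal, (EReal.coe_toReal hs hb).symm⟩
    refine h.mem_closure_of_limit hD ⊥ fun q hq hqs hqt => ?_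
    refine eq_of_start_eq hqs fun t => ?_
    rw [hp]
    rcases lt_or_ge (t : EReal) p.start with ht | ht
    · exact hqt t ht
    · have h1 : q (σ - 1) = ⊥ := hqt _ (by rw [hσ]; exact_mod_cast (by linarith : σ - 1 < σ))
      have h2 : q σ = ⊥ := by
        rw [← h1]
        refine q.const_before _ _ (by rw [hqs, hσ]) ?_
        rw [hqs, hσ]
        exact_mod_cast (by linarith : σ - 1 ≤ σ)
      exact h.eq_bot hq (by rw [hqs, hσ]) h2 (hqs ▸ ht)

/-- Apply `exists_eqOn` at rational times decreasing to `p.start`, with margins tending to `0`: a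
limit of the resulting paths has the starting time of `p` and agrees with `p` at all later times. -/
lemma mem_closure_real (h : IsRichWeb D K) (hD : Dense D) (hco : CoalescesOn D K)
    (hthin : IsThin K) {p : WebPath} (hpK : p ∈ K) (hs : p.start ≠ ⊤)
    (hp : ∀ t : ℝ, p.start ≤ t → p t ≠ ⊤ ∧ p t ≠ ⊥) : p ∈ closure (pathsFrom D K) := by
  obtain ⟨t, ht, htlim⟩ := exists_seq_rat_gt (lt_top_iff_ne_top.mpr hs)
  have hex : ∀ k : ℕ, ∃ y ∈ D, y.2 ∈ Set.Ioo ((t k : ℝ) - 1 / ((k : ℝ) + 1)) (t k) ∧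
      ∃ q ∈ K, q.StartsAt y ∧ ∀ s : ℝ, t k + 1 / ((k : ℝ) + 1) ≤ s → p s = q s := by
    intro k
    obtain ⟨h1, h2⟩ := hp (t k) (ht k).le
    have := h.exists_eqOn hD hco hthin hpK (t₀ := t k) (δ := 1 / ((k : ℚ) + 1)) (by positivity)
      (ht k) (EReal.coe_toReal h1 h2).symm (e := 1 / ((k : ℝ) + 1)) (by positivity)
    push_cast at this
    exact this
  choose y hyD hy P hPK hP hPp using hex
  refine mem_closure_of_subseq (P := P) (fun k => ⟨hPK k, y k, hyD k, hP k⟩)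
    fun q hq φ hφ hlim => ?_
  have hinv : Tendsto (fun k : ℕ => 1 / ((k : ℝ) + 1)) atTop (𝓝 0) :=
    tendsto_one_div_add_atTop_nhds_zero_nat
  have hlow : Tendsto (fun k => (((t k : ℝ) - 1 / ((k : ℝ) + 1) : ℝ) : EReal)) atTop
      (𝓝 p.start) := by
    have hneg : Tendsto (fun k : ℕ => -(1 / ((k : ℝ) + 1))) atTop (𝓝 0) := by
      simpa only [neg_zero] using hinv.neg
    exact (tendsto_coe_add_of_tendsto htlim hneg).congr fun k => by rw [← sub_eq_add_neg]
  have hup := tendsto_coe_add_of_tendsto htlim hinv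
  have hstart : q.start = p.start := by
    refine tendsto_nhds_unique ((continuous_start.tendsto q).comp hlim) ?_
    have h1 : Tendsto (fun k => ((y k).2 : EReal)) atTop (𝓝 p.start) :=
      tendsto_of_tendsto_of_tendsto_of_le_of_le hlow htlim
        (fun k => EReal.coe_le_coe_iff.mpr (hy k).1.le)
        (fun k => EReal.coe_le_coe_iff.mpr (hy k).2.le)
    exact (h1.comp hφ.tendsto_atTop).congr fun k => ((hP (φ k)).1).symm
  refine (eq_of_forall_gt hstart.symm hs fun s hs' => ?_).symm
  refine tendsto_nhds_unique ?_ (((continuous_eval s).tendsto q).comp hlim)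
  refine tendsto_const_nhds.congr' ?_
  filter_upwards [(hup.comp hφ.tendsto_atTop).eventually_lt_const hs'] with k hk
  exact hPp (φ k) s (EReal.coe_le_coe_iff.mp hk.le)

theorem eq_closure (h : IsRichWeb D K) (hD : Dense D) (hco : CoalescesOn D K)
    (hthin : IsThin K) : (K : Set WebPath) = closure (pathsFrom D K) := by
  refine Set.Subset.antisymm (fun p hp => ?_)
    (closure_minimal (fun p hp => hp.1) K.isCompact.isClosed)
  -- A path starting at `+∞` is a constant and is approximated by paths that start later and later
  -- near that constant.
  by_cases hs : p.start = ⊤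
  · refine h.mem_closure_of_limit hD (p (0 : ℝ)) fun q hq hqs hqt => ?_
    refine eq_of_start_eq hqs fun t => ?_
    rw [hqt t (hs ▸ EReal.coe_lt_top t)]
    exact p.const_before _ _ (by rw [hs]; exact le_top) (by rw [hs]; exact le_top)
  have hext : ∀ c : EReal, (∀ t : ℝ, p.start ≤ t → p t = c) → ∀ t : ℝ, p t = c := by
    intro c hc t
    rcases le_or_gt p.start t with ht | ht
    · exact hc t ht
    · obtain ⟨σ, hσ⟩ : ∃ σ : ℝ, p.start = σ := ⟨p.start.toReal,
        (EReal.coe_toReal hs (((EReal.bot_lt_coe t).trans ht).ne')).symm⟩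
      rw [p.const_before t σ ht.le hσ.ge]
      exact hc σ hσ.le
  by_cases htop : ∃ s : ℝ, p.start ≤ s ∧ p s = ⊤
  · obtain ⟨s, hs1, hs2⟩ := htop
    exact h.mem_closure_top hD hs (hext ⊤ fun t ht => h.eq_top hp hs1 hs2 ht)
  by_cases hbot : ∃ s : ℝ, p.start ≤ s ∧ p s = ⊥
  · obtain ⟨s, hs1, hs2⟩ := hbot
    exact h.mem_closure_bot hD hs (hext ⊥ fun t ht => h.eq_bot hp hs1 hs2 ht)
  push Not at htop hbot
  exact h.mem_closure_real hD hco hthin hp hs fun t ht => ⟨htop t ht, hbot t ht⟩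

end IsRichWeb

/-! ### Measurable selection and almost sure richness of limits -/

/-- If `K` has a unique path from `y`, then paths of `K` from points near `y` are close to it. -/
lemma tendsto_of_unique {K : PathSets} {y : ℝ × ℝ} {p : WebPath}
    (huniq : ∀ q ∈ K, q.StartsAt y → q = p) {P : ℕ → WebPath} {u : ℕ → ℝ × ℝ}
    (hu : Tendsto u atTop (𝓝 y)) (hPK : ∀ k, P k ∈ K) (hP : ∀ k, (P k).StartsAt (u k)) :
    Tendsto P atTop (𝓝 p) := by
  refine tendsto_of_subseq_tendsto fun ns hns => ?_
  obtain ⟨q, hq, φ, hφ, hlim⟩ := K.isCompact.tendsto_subseq fun k => hPK (ns k)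
  have hqy := startsAt_of_tendsto hlim ((hu.comp hns).comp hφ.tendsto_atTop) fun k => hP _
  rw [huniq q hq hqy] at hlim
  exact ⟨φ, hlim⟩

lemma WebPath.isClosed_startsAt (y : ℝ × ℝ) : IsClosed {p : WebPath | p.StartsAt y} :=
  (isClosed_eq continuous_start continuous_const).inter
    (isClosed_eq (continuous_eval y.2) continuous_const)

lemma spreadEvent_mono (k : ℕ) (t₀ t : ℝ) {a b a' b' : ℝ} (ha : a' ≤ a) (hb : b ≤ b') :
    spreadEvent k t₀ t a b ⊆ spreadEvent k t₀ t a' b' := by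
  refine hitSet_mono fun z hz j => ?_
  obtain ⟨h1, h2, h3, h4⟩ := hz j
  exact ⟨h1, ⟨lt_of_le_of_lt (EReal.coe_le_coe_iff.mpr ha) h2.1,
    lt_of_lt_of_le h2.2 (EReal.coe_le_coe_iff.mpr hb)⟩, h3, h4⟩

lemma IsBrownianPathLaw.ae_launch_startsAt {β : Measure WebPath} (hβ : IsBrownianPathLaw β)
    (y : ℝ × ℝ) : ∀ᵐ p ∂β, (launch y p).StartsAt y := by
  filter_upwards [hβ.ae_basic] with p hp
  exact ⟨launch_start y p, launch_at_start hp.2.1 y le_rfl⟩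

lemma coalMap_startsAt {m : ℕ} {y : Fin m → ℝ × ℝ} {ω : Fin m → WebPath}
    (hω : ∀ j, (ω j) (0 : ℝ) = 0) (j : Fin m) : (coalMap y ω j).StartsAt (y j) := by
  have hs : (launchAll y ω j).start = ((y j).2 : EReal) := by rw [launchAll_coe, launch_start]
  refine ⟨by rw [coalMap, coal_start, hs], ?_⟩
  rw [coalMap, coal_of_le_start hs.ge, launchAll_coe, launch_at_start (hω j) _ le_rfl]

lemma IsBrownianPathLaw.ae_coalLaw_startsAt {β : Measure WebPath} (hβ : IsBrownianPathLaw β)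
    {m : ℕ} (y : Fin m → ℝ × ℝ) : ∀ᵐ z ∂(coalLaw β y), ∀ j, (z j).StartsAt (y j) := by
  have := hβ.isProbabilityMeasure
  have hm : MeasurableSet {z : Fin m → WebPath | ∀ j, (z j).StartsAt (y j)} := by
    rw [Set.ofPred_forall]
    exact (isClosed_iInter fun j => (isClosed_startsAt (y j)).preimage
      (continuous_apply j)).measurableSet
  rw [coalLaw, ae_map_iff (measurable_coalMap y).aemeasurable hm]
  filter_upwards [hβ.ae_transversal y] with ω hω j
  exact coalMap_startsAt hω.1 j

lemma IsBrownianPathLaw.ae_coalLaw_sticky {β : Measure WebPath} (hβ : IsBrownianPathLaw β)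
    (y : Fin 2 → ℝ × ℝ) : ∀ᵐ z ∂(coalLaw β y), Sticky (z 0) (z 1) := by
  have := hβ.isProbabilityMeasure
  have hm : MeasurableSet {z : Fin 2 → WebPath | Sticky (z 0) (z 1)} := by
    have hc : Measurable fun z : Fin 2 → WebPath => (z 0, z 1) :=
      (measurable_pi_apply 0).prodMk (measurable_pi_apply 1)
    exact hc measurableSet_sticky
  rw [coalLaw, ae_map_iff (measurable_coalMap y).aemeasurable hm]
  exact Eventually.of_forall fun ω => coal_sticky (launchAll_start_ne_bot y ω) 0 1

/-- A path of `K` from `y`, when there is one. -/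
def pathFrom (y : ℝ × ℝ) (K : PathSets) : WebPath := by
  classical exact if h : ∃ p ∈ K, p.StartsAt y then h.choose else default

lemma pathFrom_spec {y : ℝ × ℝ} {K : PathSets} (h : ∃ p ∈ K, p.StartsAt y) :
    pathFrom y K ∈ K ∧ (pathFrom y K).StartsAt y := by
  rw [pathFrom, dif_pos h]
  exact h.choose_spec

/-- By uniqueness the arbitrary choice is immaterial: the selected path lies in a closed set `C`
exactly when `K` meets `C ∩ {p | p.StartsAt y}`, up to a null set, and that is a closed condition on
`K`. -/
lemma aemeasurable_pathFrom {μ : Measure PathSets} {y : ℝ × ℝ}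
    (h : ∀ᵐ K ∂μ, ∃! p : WebPath, p ∈ K ∧ p.StartsAt y) : AEMeasurable (pathFrom y) μ := by
  refine NullMeasurable.aemeasurable ?_
  refine measurable_of_isClosed (δ := NullMeasurableSpace PathSets μ) fun C hC => ?_
  have hcl : IsClosed {K : PathSets | ((K : Set WebPath) ∩ (C ∩ {p | p.StartsAt y})).Nonempty} :=
    NonemptyCompacts.isClosed_inter_nonempty_of_isClosed (hC.inter (isClosed_startsAt y))
  have hn : NullMeasurableSet
      {K : PathSets | ((K : Set WebPath) ∩ (C ∩ {p | p.StartsAt y})).Nonempty} μ :=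
    hcl.measurableSet.nullMeasurableSet
  refine hn.congr ?_
  filter_upwards [h] with K hK
  obtain ⟨p, hp, hup⟩ := hK
  have hs := pathFrom_spec ⟨p, hp⟩
  refine propext ⟨?_, fun hKC => ⟨pathFrom y K, hs.1, hKC, hs.2⟩⟩
  rintro ⟨q, hqK, hqC, hqy⟩
  change pathFrom y K ∈ C
  rw [hup _ hs, ← hup q ⟨hqK, hqy⟩]
  exact hqC

/-- Open sets are increasing unions of closed ones, so the inequality holds for them too; for
probability measures, complements reverse it. -/
lemma eq_of_forall_isClosed_le {X : Type*} [PseudoEMetricSpace X] [MeasurableSpace X]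
    [BorelSpace X] {μ ν : Measure X} [IsProbabilityMeasure μ] [IsProbabilityMeasure ν]
    (h : ∀ F, IsClosed F → μ F ≤ ν F) : μ = ν := by
  have hle : ∀ U, IsOpen U → μ U ≤ ν U := by
    intro U hU
    obtain ⟨F, hFc, hFU, hF, hmono⟩ := hU.exists_iUnion_isClosed
    rw [← hF, hmono.measure_iUnion, hmono.measure_iUnion]
    exact iSup_mono fun n => h (F n) (hFc n)
  have hopen : ∀ U, IsOpen U → μ U = ν U := by
    intro U hU
    refine le_antisymm (hle U hU) ?_
    have h1 := h Uᶜ hU.isClosed_compl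
    rw [prob_compl_eq_one_sub hU.measurableSet, prob_compl_eq_one_sub hU.measurableSet] at h1
    exact (ENNReal.sub_le_sub_iff_left prob_le_one ENNReal.one_ne_top).mp h1
  exact ext_of_generate_finite _ (BorelSpace.measurable_eq (α := X)) isPiSystem_isOpen
    (fun U hU => hopen U hU) (by simp)

namespace IsWebLimit

variable {β : Measure WebPath} {D : Set (ℝ × ℝ)} {μ : Measure PathSets}

/-- A path launched from `y` starts at `y` almost surely, so this condition can be added to the
closed set at no cost. -/
lemma measure_miss_le [IsProbabilityMeasure μ] (h : IsWebLimit β D μ) (hβ : IsBrownianPathLaw β)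
    {y : ℝ × ℝ} (hy : y ∈ D) {F : Set WebPath} (hF : IsClosed F) :
    μ {K : PathSets | ¬ ((K : Set WebPath) ∩ (F ∩ {p | p.StartsAt y})).Nonempty} ≤
      β (launch y ⁻¹' Fᶜ) := by
  have := hβ.isProbabilityMeasure
  have hcl : IsClosed (F ∩ {p : WebPath | p.StartsAt y}) := hF.inter (isClosed_startsAt y)
  have h1 := h.coalescing 1 (fun _ => y) (fun _ => hy)
    {z | z 0 ∈ F ∩ {p : WebPath | p.StartsAt y}} (hcl.preimage (continuous_apply 0))
  rw [hitSet_single] at h1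
  have h2 : coalLaw β (fun _ : Fin 1 => y) {z | z 0 ∈ F ∩ {p : WebPath | p.StartsAt y}} =
      β (launch y ⁻¹' F) := by
    have h3 := map_coalLaw_single β fun _ : Fin 1 => y
    have h4 : coalLaw β (fun _ : Fin 1 => y) {z | z 0 ∈ F ∩ {p : WebPath | p.StartsAt y}} =
        β (launch y ⁻¹' (F ∩ {p : WebPath | p.StartsAt y})) := by
      rw [← Measure.map_apply (measurable_launch y) hcl.measurableSet, ← h3,
        Measure.map_apply (measurable_pi_apply 0) hcl.measurableSet]
      rfl
    rw [h4]
    refine measure_congr ?_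
    filter_upwards [hβ.ae_launch_startsAt y] with p hp
    exact propext ⟨fun hpF => hpF.1, fun hpF => ⟨hpF, hp⟩⟩
  rw [h2] at h1
  have hm : MeasurableSet
      {K : PathSets | ((K : Set WebPath) ∩ (F ∩ {p | p.StartsAt y})).Nonempty} :=
    (NonemptyCompacts.isClosed_inter_nonempty_of_isClosed hcl).measurableSet
  have h5 : μ {K : PathSets | ¬ ((K : Set WebPath) ∩ (F ∩ {p | p.StartsAt y})).Nonempty} =
      1 - μ {K : PathSets | ((K : Set WebPath) ∩ (F ∩ {p | p.StartsAt y})).Nonempty} :=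
    prob_compl_eq_one_sub hm
  rw [h5, Set.preimage_compl, prob_compl_eq_one_sub (measurable_launch y hF.measurableSet)]
  exact tsub_le_tsub_left h1 1

lemma ae_exists_path [IsProbabilityMeasure μ] (h : IsWebLimit β D μ) (hβ : IsBrownianPathLaw β)
    {y : ℝ × ℝ} (hy : y ∈ D) : ∀ᵐ K ∂μ, ∃ p ∈ K, p.StartsAt y := by
  have h1 := h.measure_miss_le hβ hy isClosed_univ
  rw [Set.compl_univ, Set.preimage_empty, measure_empty] at h1
  have h2 : ∀ᵐ K : PathSets ∂μ, ((K : Set WebPath) ∩ (Set.univ ∩ {p | p.StartsAt y})).Nonempty :=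
    le_antisymm h1 zero_le
  filter_upwards [h2] with K hK
  obtain ⟨p, hp, -, hpy⟩ := hK
  exact ⟨p, hp, hpy⟩

lemma exists_measure_tube_miss_le [IsProbabilityMeasure μ] (h : IsWebLimit β D μ)
    (hβ : IsBrownianPathLaw β) (hD : Dense D) {b c T δ : ℝ} (hbc : b < c) (hδ : 0 < δ) :
    ∃ y ∈ D, y.2 < T ∧ μ {K : PathSets | ¬ ((K : Set WebPath) ∩
      ({p | ∀ u ∈ Set.Icc T (T + 2 * δ), p u ∈ Set.Icc (b : EReal) c} ∩
        {p | p.StartsAt y})).Nonempty} ≤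
      4 * ENNReal.ofReal (Real.exp (-((c - b) / 4 / 2) ^ 2 / (2 * (3 * δ)))) := by
  obtain ⟨y, hyD, hy1, hy2⟩ := hD.exists_mem_open
    (U := Set.Ioo (b + (c - b) / 4) (c - (c - b) / 4) ×ˢ Set.Ioo (T - δ) T)
    (isOpen_Ioo.prod isOpen_Ioo)
    ⟨((b + c) / 2, T - δ / 2), ⟨by linarith, by linarith⟩, by linarith, by linarith⟩
  refine ⟨y, hyD, hy2.2, ?_⟩
  refine (h.measure_miss_le hβ hyD (isClosed_forall_eval_mem isClosed_Icc _)).trans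
    (le_trans (measure_mono ?_) (hβ.measure_launch_tubeSet_compl_le hbc hδ hy1 hy2))
  exact Set.preimage_mono (Set.compl_subset_compl.mpr fun p hp u hu =>
    Set.Ioo_subset_Icc_self (hp.2 u hu))

lemma tendsto_exit_bound {δ : ℝ} (hδ : 0 < δ) : Tendsto (fun A : ℕ =>
    4 * ENNReal.ofReal (Real.exp (-(((A : ℝ) + 1) / 4 / 2) ^ 2 / (2 * (3 * δ))))) atTop (𝓝 0) := by
  have h1 : Tendsto (fun A : ℕ => (((A : ℝ) + 1) / 4 / 2) ^ 2 / (2 * (3 * δ))) atTop atTop := by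
    refine Tendsto.atTop_div_const (by positivity) ?_
    refine (tendsto_pow_atTop two_ne_zero).comp ?_
    refine Tendsto.atTop_div_const (by norm_num) (Tendsto.atTop_div_const (by norm_num) ?_)
    exact tendsto_atTop_add_const_right _ _ tendsto_natCast_atTop_atTop
  have h2 := ENNReal.tendsto_ofReal (Real.tendsto_exp_neg_atTop_nhds_zero.comp h1)
  have h3 := ENNReal.Tendsto.const_mul (a := 4) h2 (Or.inr (by norm_num))
  simpa [neg_div] using h3

/-- Tubes from `k` to `k + A + 1` over a fixed time span grow wider with `A`, so a Brownian path
started in the middle leaves them with probability tending to `0`. -/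
lemma ae_escape_top [IsProbabilityMeasure μ] (h : IsWebLimit β D μ) (hβ : IsBrownianPathLaw β)
    (hD : Dense D) (k : ℕ) : ∀ᵐ K ∂μ, ∃ y ∈ D, y.2 < -k ∧ ∃ p ∈ K, p.StartsAt y ∧
    ∀ u ∈ Set.Icc (-(k : ℝ)) k, ((k : ℝ) : EReal) ≤ p u ∧ p u < ⊤ := by
  rw [ae_iff]
  refine le_antisymm (ge_of_tendsto' (tendsto_exit_bound (δ := k + 1) (by positivity))
    fun A => ?_) zero_le
  -- With `T = -k` and `δ = k + 1` the tube lasts until `k + 2`, which covers `[-k, k]`.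
  obtain ⟨y, hyD, hyT, hy⟩ := h.exists_measure_tube_miss_le hβ hD (b := k) (c := k + (A + 1))
    (T := -k) (δ := k + 1) (by linarith [A.cast_nonneg (α := ℝ)]) (by positivity)
  rw [add_sub_cancel_left] at hy
  refine le_trans (measure_mono ?_) hy
  rintro K hK ⟨p, hp, hpF, hpy⟩
  refine hK ⟨y, hyD, hyT, p, hp, hpy, fun u hu => ?_⟩
  have := hpF u ⟨hu.1, by linarith [hu.2]⟩
  exact ⟨this.1, this.2.trans_lt (EReal.coe_lt_top _)⟩

lemma ae_escape_bot [IsProbabilityMeasure μ] (h : IsWebLimit β D μ) (hβ : IsBrownianPathLaw β)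
    (hD : Dense D) (k : ℕ) : ∀ᵐ K ∂μ, ∃ y ∈ D, y.2 < -k ∧ ∃ p ∈ K, p.StartsAt y ∧
    ∀ u ∈ Set.Icc (-(k : ℝ)) k, ⊥ < p u ∧ p u ≤ ((-(k : ℝ) : ℝ) : EReal) := by
  rw [ae_iff]
  refine le_antisymm (ge_of_tendsto' (tendsto_exit_bound (δ := k + 1) (by positivity))
    fun A => ?_) zero_le
  obtain ⟨y, hyD, hyT, hy⟩ := h.exists_measure_tube_miss_le hβ hD (b := -k - (A + 1)) (c := -k)
    (T := -k) (δ := k + 1) (by linarith [A.cast_nonneg (α := ℝ)]) (by positivity)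
  rw [sub_sub_cancel] at hy
  refine le_trans (measure_mono ?_) hy
  rintro K hK ⟨p, hp, hpF, hpy⟩
  refine hK ⟨y, hyD, hyT, p, hp, hpy, fun u hu => ?_⟩
  have := hpF u ⟨hu.1, by linarith [hu.2]⟩
  exact ⟨(EReal.bot_lt_coe _).trans_le this.1, this.2⟩

theorem ae_isRichWeb [IsProbabilityMeasure μ] (h : IsWebLimit β D μ) (hβ : IsBrownianPathLaw β)
    (hDc : D.Countable) (hD : Dense D) : ∀ᵐ K ∂μ, IsRichWeb D K := by
  filter_upwards [h.noncrossing, (ae_ball_iff hDc).mpr fun y hy => h.ae_exists_path hβ hy,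
    ae_all_iff.mpr (h.ae_escape_top hβ hD), ae_all_iff.mpr (h.ae_escape_bot hβ hD)]
    with K h1 h2 h3 h4
  exact ⟨h1, h2, h3, h4⟩

/-! ### Uniqueness of the path from a given point -/

/-- Two paths from `y` that differ at time `y.2 + t` are, slightly after `y.2`, both within `ε / 2`
of `y.1`, and they still differ a time `t` later. Shifting the reference time is needed because
`spreadEvent` asks for paths started strictly before it. The bound inherited from (B₁) vanishes as
`ε → 0`. -/
lemma ae_unique_at [IsProbabilityMeasure μ] (h : IsWebLimit β D μ) (hβ : IsBrownianPathLaw β)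
    (hDc : D.Countable) (hD : Dense D) (y : ℝ × ℝ) {t : ℝ} (ht : 0 < t) :
    ∀ᵐ K ∂μ, ∀ p ∈ K, ∀ q ∈ K, p.StartsAt y → q.StartsAt y → p (y.2 + t) = q (y.2 + t) := by
  rw [ae_iff]
  have hbound : ∀ ε : ℝ, 0 < ε → μ {K : PathSets | ¬ ∀ p ∈ K, ∀ q ∈ K, p.StartsAt y →
      q.StartsAt y → p (y.2 + t) = q (y.2 + t)} ≤
      ⨆ (a : ℝ) (t₀ : ℝ), μ (spreadEvent 1 t₀ t a (a + ε)) := by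
    intro ε hε
    -- The spread event occurs for all large `k`. The union over `k₀` is increasing and each `A k₀`
    -- lies in a single spread event, so no probabilities are added.
    set A : ℕ → Set PathSets := fun k₀ => ⋂ k ≥ k₀,
      spreadEvent 1 (y.2 + 1 / ((k : ℝ) + 1)) t (y.1 - ε / 2) (y.1 - ε / 2 + ε) with hA
    have hmono : Monotone A := fun k l hkl => Set.biInter_subset_biInter_left
      fun j hj => le_trans hkl hj
    have hsub : μ {K : PathSets | ¬ ∀ p ∈ K, ∀ q ∈ K, p.StartsAt y →
        q.StartsAt y → p (y.2 + t) = q (y.2 + t)} ≤ μ (⋃ k, A k) := by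
      refine measure_mono_ae ?_
      filter_upwards [h.ae_isRichWeb hβ hDc hD] with K hK hne
      have hne : ¬ ∀ p ∈ K, ∀ q ∈ K, p.StartsAt y →
        q.StartsAt y → p (y.2 + t) = q (y.2 + t) := hne
      push Not at hne
      obtain ⟨p, hp, q, hq, hpy, hqy, hpq⟩ := hne
      have hinv : Tendsto (fun k : ℕ => 1 / ((k : ℝ) + 1)) atTop (𝓝 0) :=
        tendsto_one_div_add_atTop_nhds_zero_nat
      have hnear : ∀ r : WebPath, r.StartsAt y → ∀ᶠ k : ℕ in atTop,
          r (y.2 + 1 / ((k : ℝ) + 1)) ∈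
            Set.Ioo ((y.1 - ε / 2 : ℝ) : EReal) ((y.1 - ε / 2 + ε : ℝ) : EReal) := by
        intro r hr
        have h1 : Tendsto (fun k : ℕ => r (y.2 + 1 / ((k : ℝ) + 1))) atTop (𝓝 (y.1 : EReal)) := by
          rw [← hr.2]
          refine (r.toMap.continuous.tendsto y.2).comp ?_
          simpa using hinv.const_add y.2
        refine h1.eventually (Ioo_mem_nhds ?_ ?_)
        · exact_mod_cast (by linarith : y.1 - ε / 2 < y.1)
        · exact_mod_cast (by linarith : y.1 < y.1 - ε / 2 + ε)
      have hdiff : ∀ᶠ k : ℕ in atTop,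
          p (y.2 + 1 / ((k : ℝ) + 1) + t) ≠ q (y.2 + 1 / ((k : ℝ) + 1) + t) := by
        have ho : IsOpen {s : ℝ | p s ≠ q s} :=
          isOpen_ne_fun p.toMap.continuous q.toMap.continuous
        have h1 : Tendsto (fun k : ℕ => y.2 + 1 / ((k : ℝ) + 1) + t) atTop (𝓝 (y.2 + t)) := by
          simpa using (hinv.const_add y.2).add_const t
        exact h1.eventually (ho.mem_nhds hpq)
      have hfin : ∀ r ∈ K, r.StartsAt y → ∀ s : ℝ, y.2 ≤ s → r s ∈ Set.Ioo (⊥ : EReal) ⊤ := by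
        intro r hr hry s hs
        obtain ⟨h1, h2⟩ := hK.ne_top_bot hr hry.1.le hry.2
          (t := s) (by rw [hry.1]; exact_mod_cast hs)
        exact ⟨bot_lt_iff_ne_bot.mpr h2, lt_top_iff_ne_top.mpr h1⟩
      obtain ⟨k₀, hk₀⟩ := eventually_atTop.mp ((hnear p hpy).and ((hnear q hqy).and hdiff))
      refine Set.mem_iUnion.mpr ⟨k₀, Set.mem_iInter₂.mpr fun k hk => ?_⟩
      obtain ⟨h1, h2, h3⟩ := hk₀ k hk
      have hpos : (0 : ℝ) < 1 / ((k : ℝ) + 1) := by positivity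
      have hst : ∀ r : WebPath, r.StartsAt y →
          r.start < ((y.2 + 1 / ((k : ℝ) + 1) : ℝ) : EReal) := fun r hr => by
        rw [hr.1]
        exact_mod_cast (by linarith : y.2 < y.2 + 1 / ((k : ℝ) + 1))
      have hpf := hfin p hp hpy (y.2 + 1 / ((k : ℝ) + 1) + t) (by linarith)
      have hqf := hfin q hq hqy (y.2 + 1 / ((k : ℝ) + 1) + t) (by linarith)
      refine ⟨![p, q], fun j => ?_, fun j => ?_⟩
      · fin_cases j
        · refine ⟨hst p hpy, h1, hpf, fun i hi => ?_⟩
          fin_cases i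
          · exact absurd rfl hi
          · exact h3.symm
        · refine ⟨hst q hqy, h2, hqf, fun i hi => ?_⟩
          fin_cases i
          · exact h3
          · exact absurd rfl hi
      · fin_cases j
        · exact hp
        · exact hq
    refine hsub.trans ?_
    rw [hmono.measure_iUnion]
    refine iSup_le fun k => le_iSup₂_of_le (y.1 - ε / 2) (y.2 + 1 / ((k : ℝ) + 1)) ?_
    exact measure_mono (Set.biInter_subset_of_mem (le_refl k))
  refine le_antisymm (ge_of_tendsto (h.spread_one t ht) ?_) zero_le
  filter_upwards [self_mem_nhdsWithin] with ε hε
  exact hbound ε hε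

theorem ae_existsUnique [IsProbabilityMeasure μ] (h : IsWebLimit β D μ)
    (hβ : IsBrownianPathLaw β) (hDc : D.Countable) (hD : Dense D) (y : ℝ × ℝ) :
    ∀ᵐ K ∂μ, ∃! p : WebPath, p ∈ K ∧ p.StartsAt y := by
  have hall : ∀ᵐ K ∂μ, ∀ t : ℚ, 0 < t → ∀ p ∈ K, ∀ q ∈ K, p.StartsAt y → q.StartsAt y →
      p (y.2 + t) = q (y.2 + t) := by
    refine ae_all_iff.mpr fun t => ?_
    by_cases ht : 0 < t
    · filter_upwards [h.ae_unique_at hβ hDc hD y (t := t) (by exact_mod_cast ht)] with K hK _ using hK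
    · simp [ht]
  filter_upwards [h.ae_isRichWeb hβ hDc hD, hall] with K hK hu
  obtain ⟨p, hp, hpy⟩ := hK.exists_startsAt hD y
  refine ⟨p, ⟨hp, hpy⟩, fun q ⟨hq, hqy⟩ => eq_of_startsAt hqy hpy fun t ht => ?_⟩
  by_contra hne
  have ho : IsOpen {s : ℝ | q s ≠ p s} := isOpen_ne_fun q.toMap.continuous p.toMap.continuous
  obtain ⟨ε, hε, hball⟩ := Metric.isOpen_iff.mp ho t hne
  obtain ⟨r, hr1, hr2⟩ := exists_rat_btwn (show t - y.2 < t - y.2 + ε by linarith)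
  have hr0 : (0 : ℝ) < r := by linarith
  refine hball (show y.2 + r ∈ Metric.ball t ε from ?_)
    (hu r (by exact_mod_cast hr0) q hq p hp hqy hpy)
  rw [Metric.mem_ball, Real.dist_eq, abs_of_pos (by linarith)]
  linarith

/-! ### Finite-dimensional distributions -/

lemma aemeasurable_pathFrom_pi [IsProbabilityMeasure μ] (h : IsWebLimit β D μ)
    (hβ : IsBrownianPathLaw β) (hDc : D.Countable) (hD : Dense D) {m : ℕ} (y : Fin m → ℝ × ℝ) :
    AEMeasurable (fun K j => pathFrom (y j) K) μ :=
  aemeasurable_pi_lambda _ fun j => aemeasurable_pathFrom (h.ae_existsUnique hβ hDc hD (y j))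

/-- By uniqueness, a tuple in `K` with the right starting points is the selected one. The lower
bound on closed sets is then an inequality between two probability laws, which forces equality. -/
lemma map_pathFrom_of_mem [IsProbabilityMeasure μ] (h : IsWebLimit β D μ)
    (hβ : IsBrownianPathLaw β) (hDc : D.Countable) (hD : Dense D) {m : ℕ} {y : Fin m → ℝ × ℝ}
    (hy : ∀ j, y j ∈ D) : μ.map (fun K j => pathFrom (y j) K) = coalLaw β y := by
  have := hβ.isProbabilityMeasure
  have := isProbabilityMeasure_coalLaw (β := β) y
  have hm := h.aemeasurable_pathFrom_pi hβ hDc hD y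
  have := Measure.isProbabilityMeasure_map (μ := μ) hm
  refine (eq_of_forall_isClosed_le fun F hF => ?_).symm
  have hS : IsClosed {z : Fin m → WebPath | ∀ j, (z j).StartsAt (y j)} := by
    rw [Set.ofPred_forall]
    exact isClosed_iInter fun j => (isClosed_startsAt (y j)).preimage
      (continuous_apply (A := fun _ : Fin m => WebPath) j)
  rw [Measure.map_apply_of_aemeasurable hm hF.measurableSet]
  calc coalLaw β y F ≤ coalLaw β y (F ∩ {z | ∀ j, (z j).StartsAt (y j)}) := by
        refine measure_mono_ae ?_
        filter_upwards [hβ.ae_coalLaw_startsAt y] with z hz hzF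
        exact ⟨hzF, hz⟩
    _ ≤ μ (hitSet (F ∩ {z | ∀ j, (z j).StartsAt (y j)})) := h.coalescing m y hy _ (hF.inter hS)
    _ ≤ μ ((fun K j => pathFrom (y j) K) ⁻¹' F) := by
        refine measure_mono_ae ?_
        filter_upwards [ae_all_iff.mpr fun j => h.ae_existsUnique hβ hDc hD (y j)] with K hK
        rintro ⟨z, ⟨hzF, hzy⟩, hzK⟩
        change (fun j => pathFrom (y j) K) ∈ F
        convert hzF using 1
        funext j
        exact (hK j).unique (pathFrom_spec (hK j).exists) ⟨hzK j, hzy j⟩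

/-- Both sides are continuous along points of `D` tending to `y`: the coalescing law by
transversality, the selected paths by compactness of `K` and uniqueness at `y`. -/
theorem map_pathFrom [IsProbabilityMeasure μ] (h : IsWebLimit β D μ)
    (hβ : IsBrownianPathLaw β) (hDc : D.Countable) (hD : Dense D) {m : ℕ} (y : Fin m → ℝ × ℝ) :
    μ.map (fun K j => pathFrom (y j) K) = coalLaw β y := by
  have := hβ.isProbabilityMeasure
  have := isProbabilityMeasure_coalLaw (β := β) y
  have hm := fun y : Fin m → ℝ × ℝ => h.aemeasurable_pathFrom_pi hβ hDc hD y
  have := Measure.isProbabilityMeasure_map (μ := μ) (hm y)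
  -- The approximating sequence depends only on the point, so equal points of the tuple keep equal
  -- approximations, as continuity of the coalescing law requires.
  choose u huD hu using fun y => exists_seq_dense hD y
  refine ext_of_forall_integral_eq_of_IsFiniteMeasure fun f => ?_
  refine tendsto_nhds_unique ?_ (hβ.tendsto_integral_coalLaw (yn := fun k j => u (y j) k)
    (fun j => hu (y j)) (fun i j hij k => by simp only [hij]) f)
  have hmap : ∀ y : Fin m → ℝ × ℝ, ∫ z, f z ∂(μ.map fun K j => pathFrom (y j) K) =
      ∫ K, f (fun j => pathFrom (y j) K) ∂μ := fun y =>
    integral_map (hm y) f.continuous.aestronglyMeasurable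
  simp only [← h.map_pathFrom_of_mem hβ hDc hD (y := fun j => u (y j) _) fun j => huD _ _, hmap]
  refine tendsto_integral_of_dominated_convergence (fun _ => ‖f‖) (fun n => ?_)
    (integrable_const _) (fun n => Eventually.of_forall fun ω => f.norm_coe_le_norm _) ?_
  · exact (f.continuous.measurable.comp_aemeasurable (hm _)).aestronglyMeasurable
  · filter_upwards [ae_all_iff.mpr fun j => h.ae_existsUnique hβ hDc hD (y j),
      ae_all_iff.mpr fun j => ae_all_iff.mpr fun k => h.ae_existsUnique hβ hDc hD (u (y j) k)]
      with K hK hKu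
    refine (f.continuous.tendsto _).comp (tendsto_pi_nhds.mpr fun j => ?_)
    refine tendsto_of_unique (fun q hq hqy => ?_) (hu (y j))
      (fun k => (pathFrom_spec (hKu j k).exists).1) fun k => (pathFrom_spec (hKu j k).exists).2
    exact (hK j).unique ⟨hq, hqy⟩ (pathFrom_spec (hK j).exists)

/-! ### The closure property -/

lemma ae_coalescesOn [IsProbabilityMeasure μ] (h : IsWebLimit β D μ)
    (hβ : IsBrownianPathLaw β) (hDc : D.Countable) (hD : Dense D) :
    ∀ᵐ K ∂μ, CoalescesOn D K := by
  have hst : ∀ᵐ K ∂μ, ∀ y ∈ D, ∀ y' ∈ D, Sticky (pathFrom y K) (pathFrom y' K) := by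
    refine (ae_ball_iff hDc).mpr fun y hy => (ae_ball_iff hDc).mpr fun y' hy' => ?_
    have h1 := hβ.ae_coalLaw_sticky ![y, y']
    rw [← h.map_pathFrom hβ hDc hD] at h1
    exact ae_of_ae_map (h.aemeasurable_pathFrom_pi hβ hDc hD _) h1
  filter_upwards [hst, (ae_ball_iff hDc).mpr fun y _ => h.ae_existsUnique hβ hDc hD y]
    with K hK hu
  rintro p ⟨hp, y, hy, hpy⟩ q ⟨hq, y', hy', hqy⟩
  rw [(hu y hy).unique ⟨hp, hpy⟩ (pathFrom_spec (hu y hy).exists),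
    (hu y' hy').unique ⟨hq, hqy⟩ (pathFrom_spec (hu y' hy').exists)]
  exact hK y hy y' hy'

/-- A bad `x` in `[-L, L]` is caught by one of about `4L / η` windows of length `η`. The union bound
thus costs a factor of order `1 / η`, which is what (B₂) absorbs. -/
lemma ae_isThin_at [IsProbabilityMeasure μ] (h : IsWebLimit β D μ) (t₀ : ℝ) {t : ℝ} (ht : 0 < t)
    (L : ℕ) : ∀ᵐ K ∂μ, ∀ x : ℝ, |x| ≤ L → ∃ ε > 0, K ∉ spreadEvent 2 t₀ t (x - ε) (x + ε) := by
  rw [ae_iff]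
  set s : ℝ → ℝ≥0∞ := fun ε => ⨆ (a : ℝ) (t₀ : ℝ), μ (spreadEvent 2 t₀ t a (a + ε)) with hs
  -- The constant is not sharp: there are `2M + 2` windows, and `(2M + 2) η ≤ 4L + 4 + 4η` with `η <
  -- 1`.
  have hbound : ∀ η : ℝ, 0 < η → η < 1 → μ {K : PathSets | ¬ ∀ x : ℝ, |x| ≤ L →
      ∃ ε > 0, K ∉ spreadEvent 2 t₀ t (x - ε) (x + ε)} ≤
      ENNReal.ofReal (4 * L + 15) * ((ENNReal.ofReal η)⁻¹ * s η) := by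
    intro η hη hη1
    set M : ℕ := ⌈(L + 1) / (η / 2)⌉₊ with hM
    have hcover : {K : PathSets | ¬ ∀ x : ℝ, |x| ≤ L →
        ∃ ε > 0, K ∉ spreadEvent 2 t₀ t (x - ε) (x + ε)} ⊆
        ⋃ i ∈ Finset.Icc (-(M : ℤ) - 1) M,
          spreadEvent 2 t₀ t (i * (η / 2)) (i * (η / 2) + η) := by
      intro K hK
      have hK : ¬ ∀ x : ℝ, |x| ≤ L → ∃ ε > 0, K ∉ spreadEvent 2 t₀ t (x - ε) (x + ε) := hK
      push Not at hK
      obtain ⟨x, hx, hKx⟩ := hK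
      have hx' := abs_le.mp hx
      have hη2 : 0 < η / 2 := by linarith
      have hfl := Int.floor_le ((x - η / 4) / (η / 2))
      have hfl' := Int.lt_floor_add_one ((x - η / 4) / (η / 2))
      -- Windows of length `η` overlap by half, so the one with this index contains `[x - η / 4, x +
      -- η / 4]`.
      set i := ⌊(x - η / 4) / (η / 2)⌋ with hi
      have hMle : (L + 1) / (η / 2) ≤ M := Nat.le_ceil _
      rw [div_le_iff₀ hη2] at hMle
      rw [le_div_iff₀ hη2] at hfl
      rw [div_lt_iff₀ hη2] at hfl'
      refine Set.mem_biUnion (x := i) ?_ (spreadEvent_mono 2 t₀ t ?_ ?_ (hKx (η / 4) (by linarith)))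
      · rw [Finset.mem_coe, Finset.mem_Icc]
        constructor
        · have : (-(M : ℝ) - 1) * (η / 2) ≤ (i : ℝ) * (η / 2) := by linarith
          have := le_of_mul_le_mul_right this hη2
          exact_mod_cast this
        · have : (i : ℝ) * (η / 2) ≤ (M : ℝ) * (η / 2) := by linarith
          have := le_of_mul_le_mul_right this hη2
          exact_mod_cast this
      · exact hfl
      · linarith
    refine (measure_mono hcover).trans ((measure_biUnion_finset_le _ _).trans
      ((Finset.sum_le_sum (g := fun _ => s η) fun (i : ℤ) _ =>
        le_iSup₂_of_le ((i : ℤ) * (η / 2) : ℝ) t₀ le_rfl).trans ?_))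
    rw [Finset.sum_const, nsmul_eq_mul, ← mul_assoc]
    refine mul_le_mul_left ?_ _
    rw [← ENNReal.ofReal_inv_of_pos hη, ← ENNReal.ofReal_mul (by positivity),
      ← ENNReal.ofReal_natCast]
    refine ENNReal.ofReal_le_ofReal ?_
    have hcard : (Finset.Icc (-(M : ℤ) - 1) M).card = 2 * M + 2 := by
      rw [Int.card_Icc]
      omega
    rw [hcard, ← div_eq_mul_inv, le_div_iff₀ hη]
    have hMlt : (M : ℝ) < (L + 1) / (η / 2) + 1 := Nat.ceil_lt_add_one (by positivity)
    have h1 : (L + 1) / (η / 2) * η = 2 * (L + 1) := by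
      field_simp
    have h2 : (M : ℝ) * η ≤ 2 * (L + 1) + η := by
      have := mul_le_mul_of_nonneg_right hMlt.le hη.le
      rw [add_mul, h1, one_mul] at this
      exact this
    push_cast
    nlinarith
  have hlim := ENNReal.Tendsto.const_mul (a := ENNReal.ofReal (4 * L + 15)) (h.spread_two t ht)
    (Or.inr ENNReal.ofReal_ne_top)
  rw [mul_zero] at hlim
  refine le_antisymm (ge_of_tendsto hlim ?_) zero_le
  filter_upwards [Ioo_mem_nhdsGT (zero_lt_one (α := ℝ))] with η hη
  exact hbound η hη.1 hη.2

lemma ae_isThin [IsProbabilityMeasure μ] (h : IsWebLimit β D μ) : ∀ᵐ K ∂μ, IsThin K := by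
  have hall : ∀ᵐ K ∂μ, ∀ (t₀ t : ℚ) (L : ℕ), 0 < t → ∀ x : ℝ, |x| ≤ L →
      ∃ ε > 0, K ∉ spreadEvent 2 t₀ t (x - ε) (x + ε) := by
    refine ae_all_iff.mpr fun t₀ => ae_all_iff.mpr fun t => ae_all_iff.mpr fun L => ?_
    by_cases ht : 0 < t
    · filter_upwards [h.ae_isThin_at t₀ (t := t) (by exact_mod_cast ht) L] with K hK _ using hK
    · simp [ht]
  filter_upwards [hall] with K hK t₀ t ht x
  obtain ⟨L, hL⟩ := exists_nat_gt |x|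
  exact hK t₀ t L ht x hL.le

/-- It suffices to approximate the paths from `D`. Points of `E` tending to a point of `D` have
paths in `K`, and these converge to the unique path from that point; uniqueness is used at the
countably many points of `D` only. -/
theorem ae_eq_closure [IsProbabilityMeasure μ] (h : IsWebLimit β D μ)
    (hβ : IsBrownianPathLaw β) (hDc : D.Countable) (hD : Dense D) {E : Set (ℝ × ℝ)}
    (hE : Dense E) :
    ∀ᵐ K : PathSets ∂μ, (K : Set WebPath) = closure (pathsFrom E K) := by
  filter_upwards [h.ae_isRichWeb hβ hDc hD, h.ae_coalescesOn hβ hDc hD, h.ae_isThin,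
    (ae_ball_iff hDc).mpr fun y _ => h.ae_existsUnique hβ hDc hD y] with K hK hco hthin hu
  refine Set.Subset.antisymm ?_ (closure_minimal (fun p hp => hp.1) K.isCompact.isClosed)
  rw [hK.eq_closure hD hco hthin]
  refine closure_minimal ?_ isClosed_closure
  rintro p ⟨hp, y, hy, hpy⟩
  obtain ⟨u, huE, hlim⟩ := exists_seq_dense hE y
  choose P hPK hP using fun k => hK.exists_startsAt hD (u k)
  have := tendsto_of_unique (fun q hq hqy => (hu y hy).unique ⟨hq, hqy⟩ ⟨hp, hpy⟩) hlim hPK hP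
  exact mem_closure_of_tendsto this (Eventually.of_forall fun k => ⟨hPK k, u k, huE k, hP k⟩)

theorem isBrownianWebLaw [IsProbabilityMeasure μ] (h : IsWebLimit β D μ)
    (hβ : IsBrownianPathLaw β) (hDc : D.Countable) (hD : Dense D)
    (hex : ∀ m : ℕ, ∃ (y : Fin m → ℝ × ℝ) (ν : Measure (Fin m → WebPath)),
      IsCoalescingBrownianLaw y ν) : IsBrownianWebLaw μ where
  unique_path := h.ae_existsUnique hβ hDc hD
  finite_dim m y := by
    refine ⟨fun K j => pathFrom (y j) K, ?_, h.aemeasurable_pathFrom_pi hβ hDc hD y, ?_⟩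
    · filter_upwards [ae_all_iff.mpr fun j => h.ae_existsUnique hβ hDc hD (y j)] with K hK j
      exact pathFrom_spec (hK j).exists
    · rw [h.map_pathFrom hβ hDc hD]
      obtain ⟨y₀, ν, hν⟩ := hex m
      exact hν.isCoalescingBrownianLaw_coalLaw hβ y
  closure_eq _ _ hE := h.ae_eq_closure hβ hDc hD hE

end IsWebLimit

/-! ### Uniqueness of the law of the web -/

/-- The finite set of the paths in a tuple. -/
def finiteSet {k : ℕ} (z : Fin (k + 1) → WebPath) : PathSets :=
  ⟨⟨Set.range z, (Set.finite_range z).isCompact⟩, Set.range_nonempty z⟩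

lemma continuous_finiteSet {k : ℕ} :
    Continuous (finiteSet : (Fin (k + 1) → WebPath) → PathSets) := by
  refine LipschitzWith.continuous (K := 1) (LipschitzWith.of_dist_le_mul fun z w => ?_)
  rw [NNReal.coe_one, one_mul, Metric.NonemptyCompacts.dist_eq]
  refine Metric.hausdorffDist_le_of_mem_dist dist_nonneg ?_ ?_
  · rintro _ ⟨j, rfl⟩
    exact ⟨w j, ⟨j, rfl⟩, dist_le_pi_dist z w j⟩
  · rintro _ ⟨j, rfl⟩
    exact ⟨z j, ⟨j, rfl⟩, by rw [dist_comm]; exact dist_le_pi_dist z w j⟩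

/-- Finitely many balls around the `q k` cover the compact set `K`, and all later finite sets
contain their centres. -/
lemma tendsto_finiteSet {K : PathSets} {q : ℕ → WebPath} (hq : ∀ k, q k ∈ K)
    (hK : (K : Set WebPath) ⊆ closure (Set.range q)) :
    Tendsto (fun k : ℕ => finiteSet fun j : Fin (k + 1) => q j) atTop (𝓝 K) := by
  rw [Metric.tendsto_atTop]
  intro ε hε
  have hcover : (K : Set WebPath) ⊆ ⋃ k, Metric.ball (q k) (ε / 2) := fun p hp => by
    obtain ⟨_, ⟨k, rfl⟩, hk⟩ := Metric.mem_closure_iff.mp (hK hp) (ε / 2) (half_pos hε)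
    exact Set.mem_iUnion.mpr ⟨k, hk⟩
  obtain ⟨F, hF⟩ := K.isCompact.elim_finite_subcover _ (fun k => Metric.isOpen_ball) hcover
  refine ⟨F.sup id, fun n hn => ?_⟩
  rw [Metric.NonemptyCompacts.dist_eq]
  refine lt_of_le_of_lt (Metric.hausdorffDist_le_of_mem_dist (half_pos hε).le ?_ ?_)
    (half_lt_self hε)
  · rintro _ ⟨j, rfl⟩
    exact ⟨q j, hq j, by rw [dist_self]; exact (half_pos hε).le⟩
  · intro p hp
    obtain ⟨k, hk⟩ := Set.mem_iUnion.mp (hF hp)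
    obtain ⟨hkF, hpk⟩ := Set.mem_iUnion.mp hk
    have hkn : k ≤ n := (Finset.le_sup (f := id) hkF).trans hn
    exact ⟨q k, ⟨⟨k, Nat.lt_succ_of_le hkn⟩, rfl⟩, (Metric.mem_ball.mp hpk).le⟩

namespace IsBrownianWebLaw

variable {β : Measure WebPath} {ν : Measure PathSets}

lemma map_pathFrom (h : IsBrownianWebLaw ν) (hβ : IsBrownianPathLaw β) {m : ℕ}
    (y : Fin m → ℝ × ℝ) : ν.map (fun K j => pathFrom (y j) K) = coalLaw β y := by
  obtain ⟨W, hW, -, hlaw⟩ := h.finite_dim m y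
  rw [← hlaw.eq_coalLaw hβ]
  refine Measure.map_congr ?_
  filter_upwards [hW, ae_all_iff.mpr fun j => h.unique_path (y j)] with K hK hu
  funext j
  exact (hu j).unique (pathFrom_spec (hu j).exists) (hK j)

lemma tendsto_integral [IsProbabilityMeasure ν] (h : IsBrownianWebLaw ν)
    (hβ : IsBrownianPathLaw β) {u : ℕ → ℝ × ℝ} (hu : DenseRange u)
    (f : BoundedContinuousFunction PathSets ℝ) :
    Tendsto (fun k : ℕ => ∫ z, f (finiteSet z) ∂(coalLaw β fun j : Fin (k + 1) => u j)) atTop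
      (𝓝 (∫ K, f K ∂ν)) := by
  have hm : ∀ k : ℕ, AEMeasurable (fun K (j : Fin (k + 1)) => pathFrom (u j) K) ν := fun k =>
    aemeasurable_pi_lambda _ fun j => aemeasurable_pathFrom (h.unique_path _)
  have hmap : ∀ k : ℕ, ∫ z, f (finiteSet z) ∂(coalLaw β fun j : Fin (k + 1) => u j) =
      ∫ K, f (finiteSet fun j : Fin (k + 1) => pathFrom (u j) K) ∂ν := by
    intro k
    rw [← h.map_pathFrom hβ]
    exact integral_map (hm k) (f.continuous.comp continuous_finiteSet).aestronglyMeasurable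
  simp only [hmap]
  refine tendsto_integral_of_dominated_convergence (fun _ => ‖f‖) (fun k => ?_)
    (integrable_const _) (fun n => Eventually.of_forall fun ω => f.norm_coe_le_norm _) ?_
  · exact ((f.continuous.comp continuous_finiteSet).measurable.comp_aemeasurable
      (hm k)).aestronglyMeasurable
  · filter_upwards [h.closure_eq (Set.range u) (Set.countable_range u) hu,
      ae_all_iff.mpr fun k => h.unique_path (u k)] with K hK huniq
    refine (f.continuous.tendsto K).comp (tendsto_finiteSet
      (q := fun k => pathFrom (u k) K) (fun k => (pathFrom_spec (huniq k).exists).1) ?_)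
    rw [hK]
    refine closure_mono ?_
    rintro p ⟨hp, _, ⟨k, rfl⟩, hpy⟩
    exact ⟨k, (huniq k).unique (pathFrom_spec (huniq k).exists) ⟨hp, hpy⟩⟩

/-- The integral of a bounded continuous function is a limit of integrals over the finite subsets of
paths from a dense sequence, and these depend only on the coalescing laws. -/
theorem eq {ν' : Measure PathSets} [IsProbabilityMeasure ν] [IsProbabilityMeasure ν']
    (h : IsBrownianWebLaw ν) (h' : IsBrownianWebLaw ν') (hβ : IsBrownianPathLaw β) : ν = ν' := by
  obtain ⟨u, hu⟩ := exists_dense_seq (ℝ × ℝ)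
  exact ext_of_forall_integral_eq_of_IsFiniteMeasure fun f =>
    tendsto_nhds_unique (h.tendsto_integral hβ hu f) (h'.tendsto_integral hβ hu f)

end IsBrownianWebLaw

/-! ### Convergence of approximations -/

/-- Tightness makes the laws relatively compact, so every ultrafilter has a limit; ultrafilters take
the place of subsequences. -/
theorem IsWebApproximation.exists_tendsto {β : Measure WebPath} {D : Set (ℝ × ℝ)}
    {μ : ℕ → ProbabilityMeasure PathSets}
    (h : IsWebApproximation β D fun n => (μ n : Measure PathSets)) (hβ : IsBrownianPathLaw β)
    (hDc : D.Countable) (hD : Dense D)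
    (hex : ∀ m : ℕ, ∃ (y : Fin m → ℝ × ℝ) (ν : Measure (Fin m → WebPath)),
      IsCoalescingBrownianLaw y ν)
    (h₁ : ∀ t : ℝ, 0 < t → Tendsto (fun ε : ℝ => limsup (fun n => ⨆ (a : ℝ) (t₀ : ℝ),
      (μ n : Measure PathSets) (spreadEvent 1 t₀ t a (a + ε))) atTop) (𝓝[>] 0) (𝓝 0))
    (h₂ : ∀ t : ℝ, 0 < t → Tendsto (fun ε : ℝ => (ENNReal.ofReal ε)⁻¹ *
      limsup (fun n => ⨆ (a : ℝ) (t₀ : ℝ),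
      (μ n : Measure PathSets) (spreadEvent 2 t₀ t a (a + ε))) atTop) (𝓝[>] 0) (𝓝 0))
    (𝒰 : Ultrafilter ℕ) (h𝒰 : (𝒰 : Filter ℕ) ≤ atTop) :
    ∃ ν : ProbabilityMeasure PathSets, IsBrownianWebLaw (ν : Measure PathSets) ∧
      Tendsto μ 𝒰 (𝓝 ν) := by
  have hcpt : IsCompact (closure (Set.range μ)) := by
    refine isCompact_closure_of_isTightMeasureSet ?_
    convert h.isTightMeasureSet hβ hD using 1
    ext ρ
    constructor
    · rintro ⟨_, ⟨n, rfl⟩, rfl⟩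
      exact ⟨n, rfl⟩
    · rintro ⟨n, rfl⟩
      exact ⟨μ n, ⟨n, rfl⟩, rfl⟩
  obtain ⟨ν, -, hν⟩ := hcpt.ultrafilter_le_nhds (𝒰.map μ) (by
    rw [le_principal_iff]
    exact mem_map.mpr (Eventually.of_forall fun n => subset_closure ⟨n, rfl⟩))
  have hν : Tendsto μ 𝒰 (𝓝 ν) := hν
  exact ⟨ν, (h.isWebLimit h₁ h₂ h𝒰 hν).isBrownianWebLaw hβ hDc hD hex, hν⟩

/-! ### From the hypotheses of the theorem to web approximations -/

lemma IsCoalescingBrownianLaw.exists_isBrownianPathLaw {m : ℕ} {y : Fin (m + 1) → ℝ × ℝ}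
    {ν : Measure (Fin (m + 1) → WebPath)} (h : IsCoalescingBrownianLaw y ν) :
    ∃ β, IsBrownianPathLaw β := by
  obtain ⟨Ω, _, P, _, B, -, hB, -⟩ := h
  exact ⟨_, Ω, _, P, ‹_›, B 0, hB 0, rfl⟩

lemma limsup_iSup_spreadEvent_le {Ω : ℕ → Type*} [∀ n, MeasurableSpace (Ω n)]
    {P : (n : ℕ) → Measure (Ω n)} {X : (n : ℕ) → Ω n → PathSets}
    (hX : ∀ n, AEMeasurable (X n) (P n)) (k : ℕ) {t : ℝ} (ht : 0 < t) (ε : ℝ) :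
    limsup (fun n => ⨆ (a : ℝ) (t₀ : ℝ), (P n).map (X n) (spreadEvent k t₀ t a (a + ε))) atTop ≤
      limsup (fun n => ⨆ (a : ℝ) (t₀ : ℝ), P n {ω | k ≤ etaHat (X n ω) t₀ t a (a + ε)}) atTop := by
  refine limsup_le_limsup (Eventually.of_forall fun n => iSup₂_mono fun a t₀ => ?_)
  rw [Measure.map_apply_of_aemeasurable (hX n) (isOpen_spreadEvent _ _ _ _ _).measurableSet]
  exact measure_mono fun ω hω => spreadEvent_subset k ht hω

/-- If the tuple of the `θ` lies in an open set `U`, then `X` contains a tuple in `U`. Convergence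
in distribution therefore becomes a lower bound on open hitting events, which involves the law of
`X` alone. -/
lemma isWebApproximation_map {Ω : ℕ → Type*} [∀ n, MeasurableSpace (Ω n)]
    {P : (n : ℕ) → Measure (Ω n)} [∀ n, IsProbabilityMeasure (P n)]
    {X : (n : ℕ) → Ω n → PathSets} (hX : ∀ n, AEMeasurable (X n) (P n))
    (hnc : ∀ n, ∀ᵐ ω ∂(P n), Noncrossing (X n ω)) {D : Set (ℝ × ℝ)}
    {θ : (n : ℕ) → D → Ω n → WebPath} (hθ : ∀ n y, ∀ᵐ ω ∂(P n), θ n y ω ∈ X n ω)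
    (hlim : ∀ (m : ℕ) (y : Fin m → D), ∃ ν : ProbabilityMeasure (Fin m → WebPath),
      IsCoalescingBrownianLaw (fun j => (y j : ℝ × ℝ)) (ν : Measure _) ∧
      TendstoInDistribution (fun n ω j => θ n (y j) ω) atTop id P (ν : Measure _))
    {β : Measure WebPath} (hβ : IsBrownianPathLaw β) :
    IsWebApproximation β D fun n => (P n).map (X n) where
  isProbabilityMeasure n := Measure.isProbabilityMeasure_map (hX n)
  noncrossing n := (ae_map_iff (hX n) isClosed_noncrossing.measurableSet).mpr (hnc n)
  coalescing m y hy U hU := by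
    obtain ⟨ν, hν, hconv⟩ := hlim m fun j => ⟨y j, hy j⟩
    have h1 := ProbabilityMeasure.le_liminf_measure_open_of_tendsto hconv.tendsto hU
    simp only [ProbabilityMeasure.coe_mk, Measure.map_id] at h1
    rw [hν.eq_coalLaw hβ] at h1
    refine h1.trans (liminf_le_liminf (Eventually.of_forall fun n => ?_))
    rw [Measure.map_apply_of_aemeasurable (hconv.forall_aemeasurable n) hU.measurableSet,
      Measure.map_apply_of_aemeasurable (hX n) (isOpen_hitSet hU).measurableSet]
    refine measure_mono_ae ?_
    filter_upwards [ae_all_iff.mpr fun j => hθ n ⟨y j, hy j⟩] with ω hω hωU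
    exact ⟨_, hωU, hω⟩

end

end BrownianWeb

theorem theorem2p2 {Ω : ℕ → Type*} [∀ n, MeasurableSpace (Ω n)]
    (P : (n : ℕ) → Measure (Ω n)) [∀ n, IsProbabilityMeasure (P n)]
    (X : (n : ℕ) → Ω n → BrownianWeb.PathSets)
    (hX : ∀ n, AEMeasurable (X n) (P n))
    (hnc : ∀ n, ∀ᵐ ω ∂(P n), BrownianWeb.Noncrossing (X n ω))
    (D : Set (ℝ × ℝ)) (hDc : D.Countable) (hDd : Dense D)
    (hI₁ : ∃ θ : (n : ℕ) → D → Ω n → BrownianWeb.WebPath,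
      (∀ n y, ∀ᵐ ω ∂(P n), θ n y ω ∈ X n ω) ∧
      ∀ (m : ℕ) (y : Fin m → D),
        ∃ ν : ProbabilityMeasure (Fin m → BrownianWeb.WebPath),
          BrownianWeb.IsCoalescingBrownianLaw (fun j => (y j : ℝ × ℝ)) (ν : Measure _) ∧
          TendstoInDistribution (fun n ω j => θ n (y j) ω) atTop id P (ν : Measure _))
    (hB₁ : ∀ t : ℝ, 0 < t → Tendsto
      (fun ε : ℝ => limsup (fun n => ⨆ (a : ℝ) (t₀ : ℝ),
        P n {ω | 1 ≤ BrownianWeb.etaHat (X n ω) t₀ t a (a + ε)}) atTop)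
      (𝓝[>] 0) (𝓝 0))
    (hB₂ : ∀ t : ℝ, 0 < t → Tendsto
      (fun ε : ℝ => (ENNReal.ofReal ε)⁻¹ * limsup (fun n => ⨆ (a : ℝ) (t₀ : ℝ),
        P n {ω | 2 ≤ BrownianWeb.etaHat (X n ω) t₀ t a (a + ε)}) atTop)
      (𝓝[>] 0) (𝓝 0)) :
    (∃ ν : ProbabilityMeasure BrownianWeb.PathSets,
      BrownianWeb.IsBrownianWebLaw (ν : Measure _)) ∧
    ∀ ν : ProbabilityMeasure BrownianWeb.PathSets,
      BrownianWeb.IsBrownianWebLaw (ν : Measure _) →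
        TendstoInDistribution X atTop id P (ν : Measure _) := by
  obtain ⟨θ, hθ, hlim⟩ := hI₁
  obtain ⟨y₀, hy₀⟩ := hDd.nonempty
  -- The standard Brownian law is read off from the limit in (I₁) for a single point of `D`.
  obtain ⟨β, hβ⟩ : ∃ β, BrownianWeb.IsBrownianPathLaw β := by
    obtain ⟨ν, hν, -⟩ := hlim 1 fun _ => ⟨y₀, hy₀⟩
    exact hν.exists_isBrownianPathLaw
  have happ := BrownianWeb.isWebApproximation_map hX hnc hθ hlim hβ
  have hex : ∀ m : ℕ, ∃ (y : Fin m → ℝ × ℝ) (ν : Measure (Fin m → BrownianWeb.WebPath)),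
      BrownianWeb.IsCoalescingBrownianLaw y ν := fun m => by
    obtain ⟨ν, hν, -⟩ := hlim m fun _ => ⟨y₀, hy₀⟩
    exact ⟨_, _, hν⟩
  let μ : ℕ → ProbabilityMeasure BrownianWeb.PathSets := fun n =>
    ⟨(P n).map (X n), Measure.isProbabilityMeasure_map (hX n)⟩
  have happ' : BrownianWeb.IsWebApproximation β D
      fun n => (μ n : Measure BrownianWeb.PathSets) := happ
  have key := happ'.exists_tendsto hβ hDc hDd hex
    (fun t ht => tendsto_of_tendsto_of_tendsto_of_le_of_le tendsto_const_nhds (hB₁ t ht)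
      (fun _ => zero_le) fun ε => by
        have hle := BrownianWeb.limsup_iSup_spreadEvent_le hX 1 ht ε
        rw [Nat.cast_one] at hle
        exact hle)
    (fun t ht => tendsto_of_tendsto_of_tendsto_of_le_of_le tendsto_const_nhds (hB₂ t ht)
      (fun _ => zero_le) fun ε => mul_le_mul_right (by
        have hle := BrownianWeb.limsup_iSup_spreadEvent_le hX 2 ht ε
        rw [Nat.cast_ofNat] at hle
        exact hle) _)
  refine ⟨?_, fun ν hν => ⟨hX, aemeasurable_id, ?_⟩⟩
  -- The limit along any one free ultrafilter is a Brownian web, which settles existence.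
  · obtain ⟨ν, hν, -⟩ := key (hyperfilter ℕ) Nat.hyperfilter_le_atTop
    exact ⟨ν, hν⟩
  · have hT : Tendsto μ atTop (𝓝 ν) := by
      -- Along every ultrafilter the laws tend to some Brownian web law, and there is only one.
      rw [tendsto_iff_ultrafilter]
      intro 𝒰 h𝒰
      obtain ⟨ν', hν', hconv⟩ := key 𝒰 h𝒰
      have heq : ν' = ν := ProbabilityMeasure.toMeasure_injective (hν'.eq hν hβ)
      rwa [heq] at hconv
    have hid : (⟨(ν : Measure BrownianWeb.PathSets).map id,
        Measure.isProbabilityMeasure_map aemeasurable_id⟩ :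
        ProbabilityMeasure BrownianWeb.PathSets) = ν := Subtype.ext Measure.map_id
    rw [← hid] at hT
    exact hT
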